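/- Let $n\ge 1$ and $K=\mathbb Q(q,t)$. Let $x^{(1)},\dots,x^{(n)}$ be $n$ countably infinite alphabets, and let $\Lambda_n=K[p_k(x^{(i)}) : k\ge 1,\ 1\le i\le n]$ be the ring of multi-symmetric functions, where $p_k(x^{(i)})=\sum_j (x^{(i)}_j)^k$. For an $n$-tuple of partitions $\boldsymbol\lambda=(\lambda^{(1)},\dots,\lambda^{(n)})$ put $\overline{\boldsymbol\lambda}=(|\lambda^{(1)}|,\dots,|\lambda^{(n)}|)$, $m_{\boldsymbol\lambda}=\prod_{i} m_{\lambda^{(i)}}(x^{(i)})$ (products of monomial symmetric functions) and $p_{\boldsymbol\lambda}=\prod_i p_{\lambda^{(i)}}(x^{(1)},\dots,x^{(i)})$ (products of power sums in the unions of the first $i$ alphabets). For $\alpha\in\mathbb N^n$ put $|\alpha|=\sum_i\alpha_i$ and $n(\alpha)=\sum_i(i-1)\alpha_i$. Write $\boldsymbol\mu\le\boldsymbol\lambda$ if $\sum_{i<k}|\mu^{(i)}|+\mu^{(k)}_1+\dots+\mu^{(k)}_j\le\sum_{i<k}|\lambda^{(i)}|+\lambda^{(k)}_1+\dots+\lambda^{(k)}_j$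 for all $1\le k\le n$ and all $j\ge 0$. Let $\langle\!\langle\cdot,\cdot\rangle\!\rangle$ be the bilinear form on $\Lambda_n$ with $$\langle\!\langle p_{\boldsymbol\lambda},p_{\boldsymbol\mu}\rangle\!\rangle=\delta_{\boldsymbol\lambda\boldsymbol\mu}\,q^{(n-1)|\overline{\boldsymbol\lambda}|-n(\overline{\boldsymbol\lambda})}\,z_{\lambda^{(1)}}\cdots z_{\lambda^{(n)}}\prod_{i=1}^{\ell(\lambda^{(n)})}\frac{1-q^{\lambda^{(n)}_i}}{1-t^{\lambda^{(n)}_i}},\qquad z_\lambda=\prod_{r\ge1}r^{m_r(\lambda)}m_r(\lambda)!,$$ where $m_r(\lambda)$ is the number of parts of $\lambda$ equal to $r$. Then there is a unique basis $\{P_{\boldsymbol\lambda}^{(q,t)}\}_{\boldsymbol\lambda}$ of $\Lambda_n$ over $K$ (the multi-Macdonald polynomials) such that $P_{\boldsymbol\lambda}^{(q,t)}-m_{\boldsymbol\lambda}$ is a linear combination of the $m_{\boldsymbol\mu}$ with $\boldsymbol\mu\le\boldsymbol\lambda$, $\boldsymbol\mu\ne\boldsymbol\lambda$, and $\langle\!\langle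 P_{\boldsymbol\lambda}^{(q,t)},P_{\boldsymbol\mu}^{(q,t)}\rangle\!\rangle=0$ for $\boldsymbol\lambda\ne\boldsymbol\mu$. For every $\boldsymbol\lambda$ it satisfies $$P_{\boldsymbol\lambda}^{(q^{-1},t^{-1})}[X^{(1)},X^{(2)},\dots,X^{(n)}]=q^{\,n(\overline{\boldsymbol\lambda})-(n-1)|\overline{\boldsymbol\lambda}|}\,P_{\boldsymbol\lambda}^{(q,t)}[q^{n-1}X^{(1)},q^{n-2}X^{(2)},\dots,X^{(n)}].$$ Here the left-hand side is obtained from $P_{\boldsymbol\lambda}^{(q,t)}$ by substituting $(q^{-1},t^{-1})$ for $(q,t)$ in its coefficients, and $f\mapsto f[q^{n-1}X^{(1)},q^{n-2}X^{(2)},\dots,X^{(n)}]$ is the $K$-algebra homomorphism with $p_k(x^{(i)})\mapsto q^{k(n-i)}p_k(x^{(i)})$. For $n=1$ this is the invariance $P_\lambda^{(q^{-1},t^{-1})}=P_\lambda^{(q,t)}$ of the Macdonald polynomials. -/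

import Mathlib

/-!
Multi-symmetric functions in `n` infinite alphabets over the field of rational functions in `q, t`,
and the multi-Macdonald polynomials. Alphabets are numbered from `0` to `n - 1` and the variables of
each alphabet are numbered by the natural numbers, so that the `i`-th alphabet below is the
`(i+1)`-st one in the usual numbering, and the `j`-th part below is the `(j+1)`-st part.
-/

namespace MultiMac

open Finset

noncomputable section

/-! ### The field of rational functions in `q` and `t` -/

/-- The field of rational functions in two variables over the rational numbers. -/
abbrev Kqt : Type := FractionRing (MvPolynomial (Fin 2) ℚ)

/-- The parameter `q`. -/
def q : Kqt := algebraMap (MvPolynomial (Fin 2) ℚ) Kqt (MvPolynomial.X 0)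

/-- The parameter `t`. -/
def t : Kqt := algebraMap (MvPolynomial (Fin 2) ℚ) Kqt (MvPolynomial.X 1)

theorem isAlgebraic_adjoin_inv :
    Algebra.IsAlgebraic (Algebra.adjoin ℚ (Set.range ![q⁻¹, t⁻¹])) Kqt := by
  set A := Algebra.adjoin ℚ (Set.range ![q⁻¹, t⁻¹]) with hA
  have hq : IsAlgebraic A q := by
    have h : IsAlgebraic A (q⁻¹) :=
      isAlgebraic_algebraMap (R := A) (A := Kqt) ⟨q⁻¹, Algebra.subset_adjoin ⟨0, rfl⟩⟩
    simpa using h.inv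
  have ht : IsAlgebraic A t := by
    have h : IsAlgebraic A (t⁻¹) :=
      isAlgebraic_algebraMap (R := A) (A := Kqt) ⟨t⁻¹, Algebra.subset_adjoin ⟨1, rfl⟩⟩
    simpa using h.inv
  have hpoly : ∀ f : MvPolynomial (Fin 2) ℚ,
      IsAlgebraic A (algebraMap (MvPolynomial (Fin 2) ℚ) Kqt f) := by
    intro f
    induction f using MvPolynomial.induction_on with
    | C a =>
      have h := isAlgebraic_algebraMap (R := A) (A := Kqt) (algebraMap ℚ A a)
      rw [← IsScalarTower.algebraMap_apply ℚ A Kqt] at h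
      rw [← MvPolynomial.algebraMap_eq, ← IsScalarTower.algebraMap_apply]
      exact h
    | add f g hf hg => rw [map_add]; exact hf.add hg
    | mul_X f i hf =>
      rw [map_mul]
      refine hf.mul ?_
      fin_cases i
      · exact hq
      · exact ht
  refine ⟨fun y => ?_⟩
  obtain ⟨a, b, -, rfl⟩ := IsFractionRing.div_surjective (A := MvPolynomial (Fin 2) ℚ) y
  rw [div_eq_mul_inv]
  exact (hpoly a).mul (hpoly b).inv

/-- The elements `q⁻¹` and `t⁻¹` are algebraically independent. -/
theorem algebraicIndependent_inv : AlgebraicIndependent ℚ ![q⁻¹, t⁻¹] := by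
  have := isAlgebraic_adjoin_inv
  have hb : IsTranscendenceBasis ℚ ![q⁻¹, t⁻¹] := by
    refine Algebra.IsAlgebraic.isTranscendenceBasis_of_le_trdeg_of_finite ℚ ![q⁻¹, t⁻¹] ?_
    have h2 : AlgebraicIndependent ℚ
        (fun i : Fin 2 => algebraMap (MvPolynomial (Fin 2) ℚ) Kqt (MvPolynomial.X i)) :=
      (MvPolynomial.algebraicIndependent_X (Fin 2) ℚ).map'
        (f := IsScalarTower.toAlgHom ℚ (MvPolynomial (Fin 2) ℚ) Kqt)
        (IsFractionRing.injective (MvPolynomial (Fin 2) ℚ) Kqt)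
    exact h2.cardinalMk_le_trdeg
  exact hb.1

theorem injective_aeval_inv : Function.Injective
    (MvPolynomial.aeval ![q⁻¹, t⁻¹] : MvPolynomial (Fin 2) ℚ →ₐ[ℚ] Kqt).toRingHom :=
  algebraicIndependent_inv

/-- The field homomorphism of the rational functions in `q, t` that sends
`(q, t)` to `(q⁻¹, t⁻¹)`. -/
def invQT : Kqt →+* Kqt :=
  IsFractionRing.lift (A := MvPolynomial (Fin 2) ℚ) (K := Kqt)
    injective_aeval_inv

theorem invQT_q : invQT q = q⁻¹ := by
  exact (IsFractionRing.lift_algebraMap injective_aeval_inv (MvPolynomial.X 0)).trans (by simp)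

theorem invQT_t : invQT t = t⁻¹ := by
  exact (IsFractionRing.lift_algebraMap injective_aeval_inv (MvPolynomial.X 1)).trans (by simp)

/-! ### Partitions and multi-partitions -/

/-- A partition: a weakly decreasing sequence of natural numbers with finitely many non-zero
entries. -/
abbrev Ptn : Type := {f : ℕ →₀ ℕ // Antitone f}

/-- The degree `|λ|`. -/
def Ptn.size (la : Ptn) : ℕ := ∑ j ∈ la.1.support, la.1 j

/-- `m_r(λ)`, the number of entries equal to `r` (used for `r ≥ 1`). -/
def Ptn.mult (la : Ptn) (r : ℕ) : ℕ := #{j ∈ la.1.support | la.1 j = r}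

/-- `z_λ = ∏_{r ≥ 1} r ^ m_r(λ) * m_r(λ)!`; only the `r` that occur as parts contribute. -/
def Ptn.z (la : Ptn) : ℕ :=
  ∏ r ∈ la.1.support.image la.1, r ^ la.mult r * (la.mult r).factorial

/-- An `n`-tuple of partitions. -/
abbrev MPtn (n : ℕ) : Type := Fin n → Ptn

/-- The composition `(|λ⁽¹⁾|, …, |λ⁽ⁿ⁾|)`. -/
def MPtn.bar {n : ℕ} (la : MPtn n) : Fin n → ℕ := fun i => (la i).size

/-- `|α| = α₁ + ⋯ + αₙ`. -/
def compSize {n : ℕ} (a : Fin n → ℕ) : ℕ := ∑ i, a i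

/-- `n(α) = ∑ (i - 1) αᵢ`, where `i` runs from `1` to `n`. -/
def compN {n : ℕ} (a : Fin n → ℕ) : ℕ := ∑ i : Fin n, (i : ℕ) * a i

/-- The dominance order on multi-partitions: `mu ≤ la`. -/
def MPtn.Dom {n : ℕ} (mu la : MPtn n) : Prop :=
  ∀ (k : Fin n) (j : ℕ),
    ∑ i ∈ Iio k, (mu i).size + ∑ r ∈ range j, (mu k).1 r ≤
      ∑ i ∈ Iio k, (la i).size + ∑ r ∈ range j, (la k).1 r

/-! ### Multi-symmetric functions -/

/-- The ring of multi-symmetric functions in `n` alphabets, that is, the polynomial ring over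
the field of rational functions in `q, t` in the power sums of the single alphabets: the variable
`X (i, r)` stands for `p_{r+1}(x⁽ⁱ⁾)`. -/
abbrev MSym (n : ℕ) : Type := MvPolynomial (Fin n × ℕ) Kqt

/-- The power sum `p_k(x⁽ⁱ⁾) = ∑_j (x_j⁽ⁱ⁾) ^ k` as a formal power series in the variables
`x_j⁽ⁱ⁾`, indexed by the pairs `(i, j)`. -/
def powerSumSeries (n : ℕ) (i : Fin n) (k : ℕ) : MvPowerSeries (Fin n × ℕ) Kqt :=
  open Classical in
  fun d => if ∃ j : ℕ, d = Finsupp.single (i, j) k then 1 else 0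

/-- A multi-symmetric function as a formal power series in the variables `x_j⁽ⁱ⁾`. -/
def toSeries (n : ℕ) : MSym n →ₐ[Kqt] MvPowerSeries (Fin n × ℕ) Kqt :=
  MvPolynomial.aeval fun ir => powerSumSeries n ir.1 (ir.2 + 1)

/-- The monomial symmetric function `m_μ(x⁽ⁱ⁾)`: the sum of the monomials whose exponents are the
distinct permutations of `μ`. -/
def monomialSeries (n : ℕ) (i : Fin n) (mu : Ptn) : MvPowerSeries (Fin n × ℕ) Kqt :=
  open Classical in
  fun d => if ∃ σ : Equiv.Perm ℕ, d = Finsupp.mapDomain (fun j => (i, σ j)) mu.1 then 1 else 0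

/-- The multi-monomial symmetric function `m_{λ⁽¹⁾}(x⁽¹⁾) ⋯ m_{λ⁽ⁿ⁾}(x⁽ⁿ⁾)`. -/
def multiMonomial {n : ℕ} (la : MPtn n) : MvPowerSeries (Fin n × ℕ) Kqt :=
  ∏ i, monomialSeries n i (la i)

/-- The power sum `p_k(x⁽¹⁾, …, x⁽ⁱ⁾) = p_k(x⁽¹⁾) + ⋯ + p_k(x⁽ⁱ⁾)` of the union of the first
alphabets up to the `i`-th one (used for `k ≥ 1`). -/
def unionPowerSum (n : ℕ) (i : Fin n) (k : ℕ) : MSym n :=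
  ∑ l ∈ Iic i, MvPolynomial.X (l, k - 1)

/-- The multi-power sum `p_{λ⁽¹⁾}(x⁽¹⁾) p_{λ⁽²⁾}(x⁽¹⁾, x⁽²⁾) ⋯ p_{λ⁽ⁿ⁾}(x⁽¹⁾, …, x⁽ⁿ⁾)`. -/
def multiPowerSum {n : ℕ} (la : MPtn n) : MSym n :=
  ∏ i, ∏ j ∈ (la i).1.support, unionPowerSum n i ((la i).1 j)

/-- The norm `z_λ(q, t) = q^{(n-1)|λ̄| - n(λ̄)} z_{λ⁽¹⁾} ⋯ z_{λ⁽ⁿ⁾} ∏ (1 - q^a) / (1 - t^a)`, where `a`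
runs over the parts of the last partition `λ⁽ⁿ⁾`. -/
def multiZ {n : ℕ} (la : MPtn n) : Kqt :=
  q ^ (((n : ℤ) - 1) * compSize la.bar - compN la.bar) * (∏ i, ((la i).z : Kqt)) *
    ∏ i ∈ univ.filter (fun i : Fin n => (i : ℕ) + 1 = n), ∏ j ∈ (la i).1.support,
      (1 - q ^ (la i).1 j) / (1 - t ^ (la i).1 j)

/-! ### The scalar product -/

/-- The algebra endomorphism that rewrites a multi-symmetric function in terms of the power sums
of the unions of alphabets: it sends `p_k(x⁽ⁱ⁾)` to `Y_{i,k} - Y_{i-1,k}`, where `Y_{i,k}`, which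
stands for `p_k(x⁽¹⁾, …, x⁽ⁱ⁾)`, is again called `X (i, k - 1)`. -/
def unionCoords (n : ℕ) : MSym n →ₐ[Kqt] MSym n :=
  MvPolynomial.aeval fun ir =>
    MvPolynomial.X ir -
      ∑ l ∈ univ.filter (fun l : Fin n => (l : ℕ) + 1 = ir.1), MvPolynomial.X (l, ir.2)

/-- The exponent of the monomial `∏ Y_{i,a}`, with `a` running over the parts of `λ⁽ⁱ⁾`: the
variable `Y_{i,r+1}` occurs as often as the part `r + 1` does in `λ⁽ⁱ⁾`. -/
def MPtn.exponent {n : ℕ} (la : MPtn n) : (Fin n × ℕ) →₀ ℕ :=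
  ∑ i, ∑ j ∈ (la i).1.support, Finsupp.single (i, (la i).1 j - 1) 1

/-- `z_λ(q, t)` as a function of the exponent of `λ`. -/
def exponentZ {n : ℕ} (d : (Fin n × ℕ) →₀ ℕ) : Kqt :=
  d.prod fun ir m =>
    q ^ ((n - 1 - (ir.1 : ℕ)) * (ir.2 + 1) * m) * (((ir.2 + 1) ^ m * m.factorial : ℕ) : Kqt) *
      (if (ir.1 : ℕ) + 1 = n then ((1 - q ^ (ir.2 + 1)) / (1 - t ^ (ir.2 + 1))) ^ m else 1)

/-- The scalar product on multi-symmetric functions: the bilinear form for which the multi-power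
sums are orthogonal with norms `z_λ(q, t)`, see `scalarProduct_multiPowerSum`. -/
def scalarProduct (n : ℕ) : LinearMap.BilinForm Kqt (MSym n) :=
  ((MvPolynomial.basisMonomials (Fin n × ℕ) Kqt).constr Kqt
    (fun d => exponentZ d • MvPolynomial.lcoeff Kqt d)).compl₁₂
      (unionCoords n).toLinearMap (unionCoords n).toLinearMap

theorem unionCoords_unionPowerSum (n : ℕ) (i : Fin n) (k : ℕ) :
    unionCoords n (unionPowerSum n i k) = MvPolynomial.X (i, k - 1) := by
  simp only [unionPowerSum, unionCoords, map_sum, MvPolynomial.aeval_X, sum_sub_distrib]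
  have h : ∑ l ∈ Iic i, ∑ m ∈ univ.filter (fun m : Fin n => (m : ℕ) + 1 = l),
      (MvPolynomial.X (m, k - 1) : MSym n) = ∑ m ∈ Iio i, MvPolynomial.X (m, k - 1) := by
    rw [sum_sigma']
    refine sum_bij (fun x _ => x.2) ?_ ?_ ?_ ?_
    · rintro ⟨l, m⟩ h
      simp only [mem_sigma, mem_Iic, mem_filter, mem_univ, true_and] at h
      have := h.1
      simp only [mem_Iio, Fin.lt_def, Fin.le_def] at this ⊢
      omega
    · rintro ⟨l, m⟩ h ⟨l', m'⟩ h' e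
      simp only [mem_sigma, mem_Iic, mem_filter, mem_univ, true_and] at h h' e
      subst e
      have : l = l' := Fin.ext (by omega)
      subst this
      rfl
    · intro m hm
      simp only [mem_Iio, Fin.lt_def] at hm
      refine ⟨⟨⟨(m : ℕ) + 1, by omega⟩, m⟩, ?_, rfl⟩
      simp only [mem_sigma, mem_Iic, mem_filter, mem_univ, true_and, Fin.le_def]
      exact ⟨hm, trivial⟩
    · intros; rfl
  rw [h, sub_eq_iff_eq_add, ← Iio_insert, sum_insert (by simp)]

theorem unionCoords_multiPowerSum {n : ℕ} (la : MPtn n) :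
    unionCoords n (multiPowerSum la) = MvPolynomial.monomial la.exponent 1 := by
  simp only [multiPowerSum, map_prod, unionCoords_unionPowerSum, MPtn.exponent,
    MvPolynomial.monomial_sum_one]
  rfl

theorem exponent_apply {n : ℕ} (la : MPtn n) (i : Fin n) (r : ℕ) :
    la.exponent (i, r) = (la i).mult (r + 1) := by
  simp only [MPtn.exponent, Finsupp.finsetSum_apply, Finsupp.single_apply, Prod.mk.injEq]
  rw [sum_eq_single i]
  · simp only [true_and, Ptn.mult, card_filter]
    refine sum_congr rfl fun j hj => ?_
    have : (la i).1 j ≠ 0 := by simpa using hj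
    congr 1
    simp only [eq_iff_iff]
    omega
  · intro b _ hb
    simp [hb]
  · simp

/-- The parts of a partition are determined by their multiplicities. -/
theorem ptn_ext {la mu : Ptn} (h : ∀ r, la.mult (r + 1) = mu.mult (r + 1)) : la = mu := by
  have key : ∀ (la : Ptn) (k j : ℕ), j < #{i ∈ la.1.support | k < la.1 i} ↔ k < la.1 j := by
    intro la k j
    have hset : ∃ N, {i ∈ la.1.support | k < la.1 i} = range N := by
      refine ⟨Nat.find (p := fun N => la.1 N ≤ k) ?_, ?_⟩
      · obtain ⟨N, hN⟩ := Infinite.exists_notMem_finset la.1.support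
        exact ⟨N, by simp at hN; simp [hN]⟩
      · ext i
        simp only [mem_filter, Finsupp.mem_support_iff, mem_range, Nat.lt_find_iff, not_le]
        constructor
        · rintro ⟨-, h⟩ m hm
          exact h.trans_le (la.2 hm)
        · intro h
          have := h i le_rfl
          exact ⟨by omega, this⟩
    obtain ⟨N, hN⟩ := hset
    have : j ∈ {i ∈ la.1.support | k < la.1 i} ↔ k < la.1 j := by
      simp only [mem_filter, Finsupp.mem_support_iff]
      omega
    rw [← this, hN, card_range, mem_range]
  have cnt : ∀ (la : Ptn) (k N : ℕ), (∀ j, la.1 j < N) →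
      #{i ∈ la.1.support | k < la.1 i} = ∑ r ∈ range N, if k < r + 1 then la.mult (r + 1) else 0 := by
    intro la k N hN
    rw [card_eq_sum_card_fiberwise (f := fun i => la.1 i - 1) (t := range N)]
    · refine sum_congr rfl fun r _ => ?_
      rw [filter_filter]
      split_ifs with hk
      · unfold Ptn.mult
        congr 1
        refine filter_congr fun i hi => ?_
        omega
      · rw [card_eq_zero, filter_eq_empty_iff]
        intro i hi
        omega
    · intro i hi
      have := hN i
      simp only [coe_range, Set.mem_Iio]
      omega
  have bdd : ∀ la : Ptn, ∀ j, la.1 j ≤ la.1 0 := fun la j => la.2 (Nat.zero_le j)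
  apply Subtype.ext
  ext j
  have e : ∀ k, k < la.1 j ↔ k < mu.1 j := by
    intro k
    rw [← key la, ← key mu, cnt la k (la.1 0 + mu.1 0 + 1) fun j => by have := bdd la j; omega,
      cnt mu k (la.1 0 + mu.1 0 + 1) fun j => by have := bdd mu j; omega]
    simp only [h]
  have h1 := e (la.1 j)
  have h2 := e (mu.1 j)
  omega

theorem exponent_injective (n : ℕ) : Function.Injective (MPtn.exponent (n := n)) := by
  intro la mu h
  funext i
  refine ptn_ext fun r => ?_
  rw [← exponent_apply, ← exponent_apply, h]

theorem prod_parts {M : Type*} [CommMonoid M] (la : Ptn) (N : ℕ) (hN : ∀ j, la.1 j ≤ N)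
    (g : ℕ → M) :
    ∏ j ∈ la.1.support, g (la.1 j) = ∏ r ∈ range N, g (r + 1) ^ la.mult (r + 1) := by
  rw [← prod_fiberwise_of_maps_to (g := fun i => la.1 i - 1) (t := range N)]
  · refine prod_congr rfl fun r _ => ?_
    have : {i ∈ la.1.support | la.1 i - 1 = r} = {i ∈ la.1.support | la.1 i = r + 1} := by
      refine filter_congr fun i hi => ?_
      have : la.1 i ≠ 0 := by simpa using hi
      omega
    rw [this, Ptn.mult, ← prod_const]
    refine prod_congr rfl fun i hi => ?_
    rw [(mem_filter.mp hi).2]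
  · intro i hi
    have := hN i
    have : la.1 i ≠ 0 := by simpa using hi
    simp only [mem_range]
    omega

theorem z_eq (la : Ptn) (N : ℕ) (hN : ∀ j, la.1 j ≤ N) :
    la.z = ∏ r ∈ range N, (r + 1) ^ la.mult (r + 1) * (la.mult (r + 1)).factorial := by
  unfold Ptn.z
  have himg : la.1.support.image la.1 ⊆ (range N).image (· + 1) := by
    intro r hr
    obtain ⟨j, hj, rfl⟩ := mem_image.mp hr
    have := hN j
    have : la.1 j ≠ 0 := by simpa using hj
    exact mem_image.mpr ⟨la.1 j - 1, by simp only [mem_range]; omega, by omega⟩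
  rw [prod_subset himg, prod_image (by simp)]
  intro r _ hr
  have : la.mult r = 0 := by
    rw [Ptn.mult, card_eq_zero, filter_eq_empty_iff]
    rintro j hj rfl
    exact hr (mem_image_of_mem _ hj)
  simp [this]

theorem q_ne_zero : q ≠ 0 := by
  simp [q]

theorem exponentZ_exponent {n : ℕ} (la : MPtn n) : exponentZ la.exponent = multiZ la := by
  obtain ⟨N, hN⟩ : ∃ N, ∀ i j, (la i).1 j ≤ N :=
    ⟨∑ i, (la i).1 0, fun i j => ((la i).2 (Nat.zero_le j)).trans
      (single_le_sum (f := fun i => (la i).1 0) (fun _ _ => Nat.zero_le _) (mem_univ i))⟩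
  have hsupp : la.exponent.support ⊆ univ ×ˢ range N := by
    rintro ⟨i, r⟩ hir
    rw [Finsupp.mem_support_iff, exponent_apply, Ptn.mult, Ne, card_eq_zero,
      filter_eq_empty_iff] at hir
    push Not at hir
    obtain ⟨j, -, hj⟩ := hir
    have := hN i j
    simp only [mem_product, mem_univ, mem_range, true_and]
    omega
  rw [exponentZ, Finsupp.prod_of_support_subset _ hsupp _ (by simp), prod_product]
  simp only [exponent_apply, prod_mul_distrib]
  unfold multiZ
  congr 1
  · congr 1
    · have hsize : ∀ i, (la i).size = ∑ r ∈ range N, (r + 1) * (la i).mult (r + 1) := by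
        intro i
        have := prod_parts (M := Multiplicative ℕ) (la i) N (hN i) Multiplicative.ofAdd
        apply_fun Multiplicative.toAdd at this
        simpa [Ptn.size, toAdd_prod, mul_comm] using this
      have : ((n : ℤ) - 1) * compSize la.bar - compN la.bar =
          ((∑ i : Fin n, (n - 1 - (i : ℕ)) * (la i).size : ℕ) : ℤ) := by
        simp only [compSize, compN, MPtn.bar]
        push_cast
        rw [mul_sum, ← sum_sub_distrib]
        refine sum_congr rfl fun i _ => ?_
        have := i.2
        rw [Nat.cast_sub (by omega), Nat.cast_sub (by omega)]
        push_cast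
        ring
      rw [this, zpow_natCast, ← prod_pow_eq_pow_sum]
      refine prod_congr rfl fun i _ => ?_
      rw [hsize, mul_sum, ← prod_pow_eq_pow_sum]
      refine prod_congr rfl fun r _ => ?_
      rw [mul_assoc]
    · refine prod_congr rfl fun i _ => ?_
      rw [z_eq (la i) N (hN i)]
      push_cast
      rfl
  · rw [prod_filter]
    refine prod_congr rfl fun i _ => ?_
    split_ifs with hi
    · rw [prod_parts (la i) N (hN i) (fun a => (1 - q ^ a) / (1 - t ^ a))]
    · simp

/-- The defining property of the scalar product. -/
theorem scalarProduct_multiPowerSum {n : ℕ} (la mu : MPtn n) :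
    scalarProduct n (multiPowerSum la) (multiPowerSum mu) =
      open Classical in if la = mu then multiZ la else 0 := by
  have hb : ∀ d, (MvPolynomial.monomial d (1 : Kqt)) =
      MvPolynomial.basisMonomials (Fin n × ℕ) Kqt d := fun d => by simp
  simp only [scalarProduct, LinearMap.compl₁₂_apply, AlgHom.toLinearMap_apply,
    unionCoords_multiPowerSum]
  rw [hb la.exponent, Module.Basis.constr_basis]
  simp only [LinearMap.smul_apply, MvPolynomial.lcoeff_apply, MvPolynomial.coeff_monomial,
    smul_eq_mul, exponentZ_exponent]
  by_cases h : la = mu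
  · simp [h]
  · have : mu.exponent ≠ la.exponent := fun e => h (exponent_injective n e.symm)
    simp [h, this]

/-! ### Multi-Macdonald polynomials -/

/-- The defining properties of the multi-Macdonald polynomials: they form a basis of the space of
multi-symmetric functions, the one indexed by `la` is the multi-monomial function of `la` plus a
linear combination of multi-monomial functions that are lower in the dominance order, and they are
pairwise orthogonal. -/
structure IsMultiMacdonald (n : ℕ) (P : MPtn n → MSym n) : Prop where
  linearIndependent : LinearIndependent Kqt P
  span_eq_top : Submodule.span Kqt (Set.range P) = ⊤
  triangular : ∀ la : MPtn n, toSeries n (P la) - multiMonomial la ∈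
    Submodule.span Kqt (multiMonomial '' {mu | mu.Dom la ∧ mu ≠ la})
  orthogonal : ∀ la mu : MPtn n, la ≠ mu → scalarProduct n (P la) (P mu) = 0

/-- The substitution of `(q⁻¹, t⁻¹)` for `(q, t)` in the coefficients of a multi-symmetric
function. -/
def invertParams (n : ℕ) : MSym n →+* MSym n := MvPolynomial.map invQT

/-- The plethystic substitution `f[q^{a₁} X⁽¹⁾, …, q^{aₙ} X⁽ⁿ⁾]`, under which
`p_k(x⁽ⁱ⁾)` goes to `p_k[q^{aᵢ} X⁽ⁱ⁾] = q ^ (k aᵢ) p_k(x⁽ⁱ⁾)`. -/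
def plethScale {n : ℕ} (a : Fin n → ℕ) : MSym n →ₐ[Kqt] MSym n :=
  MvPolynomial.aeval fun ir =>
    MvPolynomial.C (q ^ ((ir.2 + 1) * a ir.1)) * MvPolynomial.X ir

end

end MultiMac

/-! The form becomes a tensor product of ordinary Macdonald forms after a linear change of power
sums. Number the alphabets from `0` and put `c_m = q^{-(n-1-m)k} - t^k`. Let `Y_i` be the virtual
alphabet with `p_k[Y_i] = ∑_{m ≥ i} (c_m / c_i) p_k(x⁽ᵐ⁾)`. Abel summation writes `p_k[Y_i]` in the
power sums of the unions, with the differences of consecutive `c_m / c_i` as coefficients. With `c_n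
= 0`, the norm of the `m`-th union power sum times `c_m - c_{m+1}` does not depend on `m`. Hence
distinct `Y_i` are orthogonal, and `p_k[Y_i]` has norm `q^{(n-1-i)k} k (1 - Q^k) / (1 - T^k)`, where
`T = q^{n-1-i} t`, and `Q = q` for `i = 0`, `Q = q T` otherwise (`ortNorm_eq`,
`scalarProduct_prod_ortHom`).

Let `P_i` be the ordinary Macdonald polynomials with these parameters. The products `∏
P_i,λ⁽ⁱ⁾[Y_i]` are orthogonal with non-zero norms. Since `Y_i` is `x⁽ⁱ⁾` plus a combination of later
alphabets, they are also unitriangular for the dominance order (`ortProd_triangular`). An orthogonal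
unitriangular family with non-zero norms is unique (`triangular_orthogonal_unique`), so these
products are the multi-Macdonald polynomials.

Inverting `q` and `t` inverts every `Q` and `T`, which fixes `P_i` (`map_macdonald`): the norm of
`p_k` only acquires the factor `(T / Q)^k`, a scalar on homogeneous functions. The ratio `c_m / c_i`
acquires the factor `q^{(n-1-m)k} q^{-(n-1-i)k}` (`invertParams_ortHom`). The first power of `q` is
the plethystic scaling of `x⁽ᵐ⁾`. The second is a scaling of `Y_i`, which by homogeneity comes out
as `q^{-(n-1-i)|λ⁽ⁱ⁾|}`; the product over `i` is the prefactor.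

The ordinary Macdonald polynomials are obtained as eigenvectors of the operator taking `f` to the
constant term in `z` of `f[X + (Q-1)/z] ∏ (1 - τ x_i z) / (1 - x_i z)`, with `τ = T⁻¹`. It is
self-adjoint (`fock_macOp`), does not raise the degree in any `j` variables
(`natDegree_addLetters_macOp`), hence is triangular, and its diagonal entries are pairwise distinct
(`coeff_macOp`, `macEig_injective`). -/

namespace MultiMac

open Finset

noncomputable section

/-! ### Symmetry of multi-symmetric series -/

/-- The exponent of the leading monomial of a multi-partition: the variable `x_j⁽ⁱ⁾` has the
exponent `λ⁽ⁱ⁾_j`. -/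
def MPtn.toExp {n : ℕ} (la : MPtn n) : (Fin n × ℕ) →₀ ℕ :=
  ∑ i, (la i).1.mapDomain (fun j => (i, j))

theorem toExp_apply {n : ℕ} (la : MPtn n) (i : Fin n) (j : ℕ) :
    la.toExp (i, j) = (la i).1 j := by
  rw [MPtn.toExp, Finsupp.finsetSum_apply, sum_eq_single i]
  · exact Finsupp.mapDomain_apply (Prod.mk_right_injective i) _ _
  · intro k _ hk
    refine Finsupp.mapDomain_of_notMem_range _ _ ?_
    rintro ⟨l, hl⟩
    exact hk (Prod.ext_iff.mp hl).1
  · simp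

/-- A permutation of the variables that permutes each alphabet. -/
def permVar {n : ℕ} (σ : Fin n → Equiv.Perm ℕ) : Equiv.Perm (Fin n × ℕ) :=
  Equiv.prodShear (Equiv.refl _) σ

@[simp] theorem permVar_apply {n : ℕ} (σ : Fin n → Equiv.Perm ℕ) (v : Fin n × ℕ) :
    permVar σ v = (v.1, σ v.1 v.2) := rfl

theorem coeff_powerSumSeries (n : ℕ) (i : Fin n) (k : ℕ) (d : (Fin n × ℕ) →₀ ℕ) :
    MvPowerSeries.coeff d (powerSumSeries n i k) =
      open Classical in if ∃ j : ℕ, d = Finsupp.single (i, j) k then 1 else 0 := rfl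

theorem toSeries_X (n : ℕ) (v : Fin n × ℕ) :
    toSeries n (MvPolynomial.X v) = powerSumSeries n v.1 (v.2 + 1) := by
  simp [toSeries]

/-- Renaming the variables is an algebra homomorphism that fixes every power sum, so it fixes
everything they generate. -/
theorem coeff_toSeries_perm {n : ℕ} (f : MSym n) (σ : Fin n → Equiv.Perm ℕ)
    (d : (Fin n × ℕ) →₀ ℕ) :
    MvPowerSeries.coeff (d.embDomain (permVar σ).toEmbedding) (toSeries n f) =
      MvPowerSeries.coeff d (toSeries n f) := by
  have h : (MvPowerSeries.killCompl (permVar σ).toEmbedding).comp (toSeries n) = toSeries n := by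
    refine MvPolynomial.algHom_ext fun v => MvPowerSeries.ext fun d => ?_
    rw [AlgHom.comp_apply, MvPowerSeries.coeff_killCompl, toSeries_X, coeff_powerSumSeries,
      coeff_powerSumSeries]
    congr 1
    refine propext ⟨?_, ?_⟩
    · rintro ⟨j, hj⟩
      refine ⟨(σ v.1).symm j, Finsupp.embDomain_injective (permVar σ).toEmbedding ?_⟩
      rw [hj, Finsupp.embDomain_single]
      simp
    · rintro ⟨j, rfl⟩
      exact ⟨σ v.1 j, by rw [Finsupp.embDomain_single]; simp⟩
  rw [← MvPowerSeries.coeff_killCompl, ← AlgHom.comp_apply, h]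

theorem exists_sort (f : ℕ →₀ ℕ) : ∃ (la : Ptn) (σ : Equiv.Perm ℕ), ∀ j, f (σ j) = la.1 j := by
  obtain ⟨N, hN⟩ : ∃ N, ∀ j, N ≤ j → f j = 0 := by
    refine ⟨f.support.sup id + 1, fun j hj => ?_⟩
    by_contra h
    have := le_sup (f := id) (Finsupp.mem_support_iff.mpr h)
    simp only [id] at this
    omega
  -- `Tuple.sort` sorts increasingly; the order dual makes the result decreasing.
  set g : Fin N → ℕᵒᵈ := fun i => OrderDual.toDual (f i) with hg
  set σ : Equiv.Perm ℕ := (Tuple.sort g).extendDomain Fin.equivSubtype with hσ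
  have hlt : ∀ i : Fin N, σ i = Tuple.sort g i := fun i =>
    Equiv.Perm.extendDomain_apply_image (Tuple.sort g) Fin.equivSubtype i
  have hge : ∀ j, N ≤ j → σ j = j := fun j hj =>
    Equiv.Perm.extendDomain_apply_not_subtype _ _ (by simpa using hj)
  refine ⟨⟨f.comapDomain σ σ.injective.injOn, ?_⟩, σ, fun j => rfl⟩
  intro i j hij
  simp only [Finsupp.comapDomain_apply]
  rcases lt_or_ge j N with hj | hj
  · have := Tuple.monotone_sort g (show (⟨i, hij.trans_lt hj⟩ : Fin N) ≤ ⟨j, hj⟩ from hij)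
    rw [show σ i = _ from hlt ⟨i, hij.trans_lt hj⟩, show σ j = _ from hlt ⟨j, hj⟩]
    exact this
  · rw [hge j hj, hN j hj]
    exact Nat.zero_le _

/-- Together with `coeff_toSeries_perm` this reduces a multi-symmetric series to its coefficients at
the exponents `MPtn.toExp`. -/
theorem exists_perm_toExp {n : ℕ} (d : (Fin n × ℕ) →₀ ℕ) :
    ∃ (la : MPtn n) (σ : Fin n → Equiv.Perm ℕ),
      d = la.toExp.embDomain (permVar σ).toEmbedding := by
  choose la σ h using fun i : Fin n =>
    exists_sort (d.comapDomain (fun j => (i, j)) (Prod.mk_right_injective i).injOn)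
  refine ⟨la, σ, ?_⟩
  ext v
  obtain ⟨w, rfl⟩ := (permVar σ).surjective v
  rw [← Equiv.coe_toEmbedding, Finsupp.embDomain_apply_self, Equiv.coe_toEmbedding]
  obtain ⟨i, j⟩ := w
  rw [toExp_apply, ← h]
  rfl

/-- The multiplicities of the parts of an exponent: the entry at `(i, r)` is the number of
variables of the `i`-th alphabet with exponent `r + 1`. -/
def partCount {n : ℕ} (d : (Fin n × ℕ) →₀ ℕ) : (Fin n × ℕ) →₀ ℕ :=
  d.sum fun v m => Finsupp.single (v.1, m - 1) 1

/-! ### Multiplicities of parts as an invariant of exponents -/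

theorem partCount_toExp {n : ℕ} (la : MPtn n) : partCount la.toExp = la.exponent := by
  ext ⟨i, r⟩
  simp only [partCount, Finsupp.sum, MPtn.exponent, Finsupp.finsetSum_apply]
  have hs : la.toExp.support = (univ.sigma (fun i : Fin n => (la i).1.support)).map
      (Equiv.sigmaEquivProd (Fin n) ℕ).toEmbedding := by
    ext ⟨i, j⟩
    simp only [Finsupp.mem_support_iff, toExp_apply, mem_map_equiv, mem_sigma, mem_univ,
      true_and]
    rfl
  rw [hs, sum_map, sum_sigma]
  simp only [Equiv.coe_toEmbedding, Equiv.sigmaEquivProd_apply, toExp_apply]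

theorem partCount_embDomain {n : ℕ} (d : (Fin n × ℕ) →₀ ℕ) (σ : Fin n → Equiv.Perm ℕ) :
    partCount (d.embDomain (permVar σ).toEmbedding) = partCount d := by
  simp [partCount, Finsupp.sum_embDomain]

theorem embDomain_toExp_inj {n : ℕ} {la mu : MPtn n} {σ τ : Fin n → Equiv.Perm ℕ}
    (h : la.toExp.embDomain (permVar σ).toEmbedding =
      mu.toExp.embDomain (permVar τ).toEmbedding) : la = mu := by
  apply exponent_injective
  rw [← partCount_toExp, ← partCount_toExp, ← partCount_embDomain _ σ, h, partCount_embDomain]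

theorem degree_partCount {n : ℕ} (d : (Fin n × ℕ) →₀ ℕ) :
    (partCount d).degree = #d.support := by
  simp [partCount, Finsupp.sum, map_sum]

/-- Among the splittings of the exponent over the factors only one contributes to the coefficient of
the product. -/
theorem coeff_prod_of_unique {ι σ R : Type*} [CommSemiring R] [DecidableEq ι] (s : Finset ι)
    (f : ι → MvPowerSeries σ R) (l : ι → σ →₀ ℕ)
    (h : ∀ m : ι → σ →₀ ℕ, ∑ i ∈ s, m i = ∑ i ∈ s, l i →
      (∀ i ∈ s, MvPowerSeries.coeff (m i) (f i) ≠ 0) → ∀ i ∈ s, m i = l i) :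
    MvPowerSeries.coeff (∑ i ∈ s, l i) (∏ i ∈ s, f i) =
      ∏ i ∈ s, MvPowerSeries.coeff (l i) (f i) := by
  classical
  rw [MvPowerSeries.coeff_prod]
  rw [sum_eq_single (Finsupp.onFinset s (fun i => if i ∈ s then l i else 0)
    (fun i hi => by by_contra h; simp [h] at hi))]
  · refine prod_congr rfl fun i hi => by simp [hi]
  · intro m hm hne
    by_contra hz
    rw [mem_finsuppAntidiag] at hm
    have hz' := fun i hi h0 => hz (prod_eq_zero (i := i) hi h0)
    have := h m hm.1 hz'
    apply hne
    ext1 i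
    by_cases hi : i ∈ s
    · simp [hi, this i hi]
    · simp only [Finsupp.onFinset_apply, hi, if_false]
      exact Finsupp.notMem_support_iff.mp fun h' => hi (hm.2 h')
  · intro hm
    exfalso
    apply hm
    rw [mem_finsuppAntidiag]
    exact ⟨sum_congr rfl fun i hi => by simp [hi], Finsupp.support_onFinset_subset⟩

theorem exists_coeff_ne_zero_of_prod {ι σ R : Type*} [CommSemiring R]
    (s : Finset ι) (f : ι → MvPowerSeries σ R) (d : σ →₀ ℕ)
    (h : MvPowerSeries.coeff d (∏ i ∈ s, f i) ≠ 0) :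
    ∃ m : ι → σ →₀ ℕ, ∑ i ∈ s, m i = d ∧ ∀ i ∈ s, MvPowerSeries.coeff (m i) (f i) ≠ 0 := by
  classical
  rw [MvPowerSeries.coeff_prod] at h
  obtain ⟨m, hm, hne⟩ := exists_ne_zero_of_sum_ne_zero h
  exact ⟨m, (mem_finsuppAntidiag.mp hm).1, fun i hi hz => hne (prod_eq_zero hi hz)⟩

/-! ### Coefficients of the multi-monomial functions -/

theorem coeff_monomialSeries (n : ℕ) (i : Fin n) (mu : Ptn) (d : (Fin n × ℕ) →₀ ℕ) :
    MvPowerSeries.coeff d (monomialSeries n i mu) =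
      open Classical in
      if ∃ σ : Equiv.Perm ℕ, d = Finsupp.mapDomain (fun j => (i, σ j)) mu.1 then 1 else 0 := rfl

theorem exists_of_coeff_monomialSeries_ne_zero {n : ℕ} {i : Fin n} {mu : Ptn}
    {d : (Fin n × ℕ) →₀ ℕ} (h : MvPowerSeries.coeff d (monomialSeries n i mu) ≠ 0) :
    ∃ σ : Equiv.Perm ℕ, d = Finsupp.mapDomain (fun j => (i, σ j)) mu.1 := by
  classical
  by_contra h'
  exact h (if_neg h')

theorem sum_mapDomain_perm {n : ℕ} (la : MPtn n) (σ : Fin n → Equiv.Perm ℕ) :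
    ∑ i, (la i).1.mapDomain (fun j => (i, σ i j)) =
      la.toExp.embDomain (permVar σ).toEmbedding := by
  rw [Finsupp.embDomain_eq_mapDomain, MPtn.toExp, Finsupp.mapDomain_finsetSum]
  refine sum_congr rfl fun i _ => ?_
  rw [← Finsupp.mapDomain_comp]
  rfl

theorem coeff_multiMonomial {n : ℕ} (la mu : MPtn n) (σ : Fin n → Equiv.Perm ℕ) :
    MvPowerSeries.coeff (mu.toExp.embDomain (permVar σ).toEmbedding) (multiMonomial la) =
      open Classical in if la = mu then 1 else 0 := by
  split_ifs with h
  · subst h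
    rw [← sum_mapDomain_perm, multiMonomial, coeff_prod_of_unique]
    · refine prod_eq_one fun i _ => ?_
      rw [coeff_monomialSeries, if_pos ⟨σ i, rfl⟩]
    · intro m hm hne i _
      -- The factors live in disjoint alphabets, so each part of a splitting is the restriction of
      -- the total exponent to one alphabet.
      have hsupp : ∀ k (v : Fin n × ℕ), v.1 ≠ k → m k v = 0 := by
        intro k v hv
        have := hne k (mem_univ k)
        obtain ⟨τ, hτ⟩ := exists_of_coeff_monomialSeries_ne_zero this
        rw [hτ]
        refine Finsupp.mapDomain_of_notMem_range _ _ ?_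
        rintro ⟨l, rfl⟩
        exact hv rfl
      ext v
      by_cases hv : v.1 = i
      · have h1 : ∑ k, m k v = m i v :=
          sum_eq_single i (fun k _ hk => hsupp k v (by rw [hv]; exact hk.symm)) (by simp)
        have h2 : ∑ k, ((la k).1.mapDomain (fun j => (k, σ k j))) v =
            ((la i).1.mapDomain (fun j => (i, σ i j))) v := by
          refine sum_eq_single i (fun k _ hk => Finsupp.mapDomain_of_notMem_range _ _ ?_) (by simp)
          rintro ⟨l, rfl⟩
          exact hk hv
        rw [← h1, ← h2, ← Finsupp.finsetSum_apply, ← Finsupp.finsetSum_apply, hm]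
      · rw [hsupp i v hv, Finsupp.mapDomain_of_notMem_range]
        rintro ⟨l, rfl⟩
        exact hv rfl
  · by_contra hne
    obtain ⟨m, hm, hne⟩ := exists_coeff_ne_zero_of_prod _ _ _ hne
    have : ∀ i, ∃ τ : Equiv.Perm ℕ, m i = Finsupp.mapDomain (fun j => (i, τ j)) (la i).1 :=
      fun i => exists_of_coeff_monomialSeries_ne_zero (hne i (mem_univ i))
    choose τ hτ using this
    rw [sum_congr rfl fun i _ => hτ i, sum_mapDomain_perm] at hm
    exact h (embDomain_toExp_inj hm)

theorem coeff_multiMonomial_toExp {n : ℕ} (la mu : MPtn n) :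
    MvPowerSeries.coeff mu.toExp (multiMonomial la) =
      open Classical in if la = mu then 1 else 0 := by
  rw [← coeff_multiMonomial la mu fun _ => Equiv.refl ℕ]
  congr 2
  ext v
  obtain ⟨i, j⟩ := v
  exact (Finsupp.embDomain_apply_self
    (permVar fun _ : Fin n => Equiv.refl ℕ).toEmbedding mu.toExp (i, j)).symm

/-- A multi-symmetric function is the sum of its coefficients times multi-monomial functions. -/
theorem toSeries_eq_sum {n : ℕ} (f : MSym n) (s : Finset (MPtn n))
    (hs : ∀ la : MPtn n, MvPowerSeries.coeff la.toExp (toSeries n f) ≠ 0 → la ∈ s) :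
    toSeries n f = ∑ la ∈ s, MvPowerSeries.coeff la.toExp (toSeries n f) • multiMonomial la := by
  ext d
  obtain ⟨mu, σ, rfl⟩ := exists_perm_toExp d
  rw [coeff_toSeries_perm, map_sum]
  simp only [MvPowerSeries.coeff_smul, coeff_multiMonomial, mul_ite, mul_one, mul_zero]
  rw [sum_ite_eq' s mu]
  split_ifs with h
  · rfl
  · by_contra h'
    exact h (hs mu h')

/-! ### The multi-monomial functions as polynomials in the power sums -/

theorem exists_degree_bound {n : ℕ} (f : MSym n) :
    ∃ D, ∀ d, MvPowerSeries.coeff d (toSeries n f) ≠ 0 → d.degree ≤ D := by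
  classical
  induction f using MvPolynomial.induction_on with
  | C a =>
    refine ⟨0, fun d hd => ?_⟩
    rw [← MvPolynomial.algebraMap_eq, AlgHom.commutes, MvPowerSeries.algebraMap_apply,
      MvPowerSeries.coeff_C, ite_ne_right_iff] at hd
    simp [hd.1]
  | add f g hf hg =>
    obtain ⟨D, hD⟩ := hf
    obtain ⟨E, hE⟩ := hg
    refine ⟨max D E, fun d hd => ?_⟩
    rw [map_add, map_add] at hd
    by_cases h : MvPowerSeries.coeff d (toSeries n f) = 0
    · rw [h, zero_add] at hd
      exact (hE d hd).trans (le_max_right _ _)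
    · exact (hD d h).trans (le_max_left _ _)
  | mul_X f v hf =>
    obtain ⟨D, hD⟩ := hf
    refine ⟨D + (v.2 + 1), fun d hd => ?_⟩
    rw [map_mul, MvPowerSeries.coeff_mul] at hd
    obtain ⟨p, hp, hne⟩ := exists_ne_zero_of_sum_ne_zero hd
    rw [← mem_antidiagonal.mp hp, map_add]
    refine add_le_add (hD _ (left_ne_zero_of_mul hne)) ?_
    have h2 := right_ne_zero_of_mul hne
    rw [toSeries_X, coeff_powerSumSeries] at h2
    obtain ⟨j, hj⟩ : ∃ j, p.2 = Finsupp.single (v.1, j) (v.2 + 1) := by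
      by_contra h'
      exact h2 (if_neg h')
    simp [hj]

theorem le_degree_toExp {n : ℕ} (la : MPtn n) (i : Fin n) (s : Finset ℕ) :
    ∑ j ∈ s, (la i).1 j ≤ la.toExp.degree := by
  classical
  rw [Finsupp.degree_apply]
  calc ∑ j ∈ s, (la i).1 j = ∑ v ∈ s.map ⟨fun j => (i, j), Prod.mk_right_injective i⟩,
        la.toExp v := by simp [toExp_apply]
    _ ≤ ∑ v ∈ s.map ⟨fun j => (i, j), Prod.mk_right_injective i⟩ ∪ la.toExp.support,
        la.toExp v := sum_le_sum_of_subset subset_union_left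
    _ = _ := (sum_subset subset_union_right fun v _ hv => by simpa using hv).symm

/-- A partition of size at most `D` has at most `D` parts, each at most `D`. Finiteness is needed
because expansions in multi-monomials have to be finite sums, and because it makes the dominance
order well-founded. -/
theorem finite_degree_toExp_le (n D : ℕ) : {la : MPtn n | la.toExp.degree ≤ D}.Finite := by
  have hb : ∀ la : MPtn n, la.toExp.degree ≤ D → ∀ i j, (la i).1 j ≤ D := by
    intro la h i j
    simpa using (le_degree_toExp la i {j}).trans h
  have hz : ∀ la : MPtn n, la.toExp.degree ≤ D → ∀ i j, D ≤ j → (la i).1 j = 0 := by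
    intro la h i j hj
    by_contra h0
    have h1 := (le_degree_toExp la i (range (j + 1))).trans h
    have h2 : ∑ _r ∈ range (j + 1), 1 ≤ ∑ r ∈ range (j + 1), (la i).1 r := by
      refine sum_le_sum fun r hr => ?_
      have := (la i).2 (Nat.lt_succ_iff.mp (mem_range.mp hr))
      omega
    simp at h2
    omega
  rw [← Set.finite_coe_iff]
  refine Finite.of_injective
    (fun la : {la : MPtn n | la.toExp.degree ≤ D} => fun (i : Fin n) (j : Fin D) =>
      (⟨(la.1 i).1 j, Nat.lt_succ_of_le (hb la.1 la.2 i j)⟩ : Fin (D + 1))) ?_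
  rintro ⟨la, hla⟩ ⟨mu, hmu⟩ h
  refine Subtype.ext (funext fun i => Subtype.ext (Finsupp.ext fun j => ?_))
  rcases lt_or_ge j D with hj | hj
  · exact congrArg Fin.val (congrFun (congrFun h i) ⟨j, hj⟩)
  · exact (hz la hla i j hj).trans (hz mu hmu i j hj).symm

theorem exists_finset_support {n : ℕ} (f : MSym n) : ∃ s : Finset (MPtn n),
    ∀ la : MPtn n, MvPowerSeries.coeff la.toExp (toSeries n f) ≠ 0 → la ∈ s := by
  obtain ⟨D, hD⟩ := exists_degree_bound f
  exact ⟨(finite_degree_toExp_le n D).toFinset, fun la h => by simpa using hD _ h⟩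

theorem partCount_add_single {n : ℕ} (d : (Fin n × ℕ) →₀ ℕ) (v : Fin n × ℕ) (r : ℕ)
    (hv : d v = 0) : partCount (d + Finsupp.single v (r + 1)) =
      partCount d + Finsupp.single (v.1, r) 1 := by
  classical
  unfold partCount
  rw [Finsupp.sum_add_index_of_disjoint]
  · have hs : (Finsupp.single v (r + 1)).support = {v} :=
      Finsupp.support_single v (Nat.succ_ne_zero r)
    rw [add_right_inj, Finsupp.sum, hs]
    simp
  · rw [disjoint_left]
    intro w hw hw'
    rw [Finsupp.support_single v (Nat.succ_ne_zero r), mem_singleton] at hw'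
    subst hw'
    exact (Finsupp.mem_support_iff.mp hw) hv

theorem exists_eq_add_single {σ : Type*} {e : σ →₀ ℕ} (he : e ≠ 0) :
    ∃ (e' : σ →₀ ℕ) (v : σ), e = e' + Finsupp.single v 1 := by
  obtain ⟨v, hv⟩ : ∃ v, e v ≠ 0 := by
    by_contra! h
    exact he (Finsupp.ext h)
  exact ⟨e - Finsupp.single v 1, v, (tsub_add_cancel_of_le (by
    rw [Finsupp.single_le_iff]; omega)).symm⟩

theorem exists_partCount_eq {n : ℕ} (k : ℕ) :
    ∀ e : (Fin n × ℕ) →₀ ℕ, e.degree = k → ∃ d, partCount d = e := by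
  induction k with
  | zero =>
    intro e he
    rw [Finsupp.degree_eq_zero_iff] at he
    exact ⟨0, by simp [partCount, he]⟩
  | succ k ih =>
    intro e he
    obtain ⟨e, ⟨i, r⟩, rfl⟩ := exists_eq_add_single (e := e) (by rintro rfl; simp at he)
    obtain ⟨d, rfl⟩ := ih e (by simpa using he)
    -- A variable index not yet used in any alphabet, on which the new part can be placed.
    obtain ⟨j, hj⟩ := Infinite.exists_notMem_finset (d.support.image Prod.snd)
    refine ⟨d + Finsupp.single (i, j) (r + 1), partCount_add_single d (i, j) r ?_⟩
    by_contra h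
    exact hj (mem_image.mpr ⟨(i, j), Finsupp.mem_support_iff.mpr h, rfl⟩)

/-- The coefficients of the products of power sums are triangular with respect to the number of
variables in a monomial. -/
theorem coeff_toSeries_monomial {n : ℕ} (k : ℕ) : ∀ (e d : (Fin n × ℕ) →₀ ℕ), e.degree = k →
    ∃ N : ℕ, MvPowerSeries.coeff d (toSeries n (MvPolynomial.monomial e 1)) = N ∧
      (N ≠ 0 → #d.support ≤ k ∧ (#d.support = k → partCount d = e)) ∧
      (partCount d = e → N ≠ 0) := by
  classical
  induction k with
  | zero =>
    intro e d he
    rw [Finsupp.degree_eq_zero_iff] at he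
    subst he
    refine ⟨if d = 0 then 1 else 0, ?_, ?_, ?_⟩
    · rw [MvPolynomial.monomial_zero', map_one, map_one, MvPowerSeries.coeff_one]
      simp
    · intro h
      have : d = 0 := by
        by_contra h'
        simp [h'] at h
      simp [this, partCount]
    · intro h
      have := degree_partCount d
      rw [h] at this
      have : d = 0 := by simpa using this.symm
      simp [this]
  | succ k ih =>
    intro e d he
    obtain ⟨e, ⟨i, r⟩, rfl⟩ := exists_eq_add_single (e := e) (by rintro rfl; simp at he)
    have he' : e.degree = k := by simpa using he
    choose N hN h1 h2 using fun d => ih e d he'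
    -- The coefficient is a count, so no cancellation can occur: one non-zero summand makes it
    -- non-zero in characteristic zero.
    refine ⟨∑ p ∈ (antidiagonal d).filter (fun p => ∃ j, p.2 = Finsupp.single (i, j) (r + 1)),
      N p.1, ?_, ?_, ?_⟩
    · rw [show MvPolynomial.monomial (e + Finsupp.single (i, r) 1) (1 : Kqt) =
        MvPolynomial.monomial e 1 * MvPolynomial.X (i, r) by
          rw [MvPolynomial.X, MvPolynomial.monomial_mul, mul_one], map_mul,
        MvPowerSeries.coeff_mul, sum_filter, Nat.cast_sum]
      refine sum_congr rfl fun p _ => ?_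
      rw [toSeries_X, coeff_powerSumSeries, hN]
      split_ifs <;> simp
    · intro h
      obtain ⟨p, hp, hne⟩ := exists_ne_zero_of_sum_ne_zero h
      obtain ⟨hp, j, hj⟩ := mem_filter.mp hp
      rw [HasAntidiagonal.mem_antidiagonal] at hp
      have h3 := h1 _ hne
      rw [hj] at hp
      -- Multiplication by a power sum either puts the part on a fresh variable, which adds one to
      -- the number of variables, or on a variable already present, which leaves that number at most
      -- `k`.
      by_cases h0 : p.1 (i, j) = 0
      · have hc := partCount_add_single p.1 (i, j) r h0
        have hs : #d.support = #p.1.support + 1 := by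
          rw [← degree_partCount, ← degree_partCount, ← hp, hc]
          simp
        refine ⟨by omega, fun h => ?_⟩
        rw [← hp, hc, h3.2 (by omega)]
      · have hs : d.support ⊆ p.1.support := by
          intro w hw
          rw [← hp] at hw
          rw [Finsupp.mem_support_iff] at hw ⊢
          intro hw0
          apply hw
          rw [Finsupp.add_apply, hw0, Finsupp.single_apply, if_neg, add_zero]
          rintro rfl
          exact h0 hw0
        have := card_le_card hs
        exact ⟨by omega, fun _ => by omega⟩
    · intro hd
      obtain ⟨j, hj⟩ : ∃ j, d (i, j) = r + 1 := by
        have h : partCount d (i, r) ≠ 0 := by rw [hd]; simp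
        rw [partCount, Finsupp.sum, Finsupp.finsetSum_apply] at h
        obtain ⟨w, hw, hne⟩ := exists_ne_zero_of_sum_ne_zero h
        rw [Finsupp.single_apply, ite_ne_right_iff] at hne
        obtain ⟨h1, h2⟩ := Prod.ext_iff.mp hne.1
        have := Finsupp.mem_support_iff.mp hw
        refine ⟨w.2, ?_⟩
        simp only at h1 h2
        rw [← h1]
        show d w = _
        omega
      have hsplit : d.erase (i, j) + Finsupp.single (i, j) (r + 1) = d := by
        rw [← hj, Finsupp.erase_add_single]
      have hmem : (d.erase (i, j), Finsupp.single (i, j) (r + 1)) ∈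
          (antidiagonal d).filter (fun p => ∃ j, p.2 = Finsupp.single (i, j) (r + 1)) :=
        mem_filter.mpr ⟨mem_antidiagonal.mpr hsplit, j, rfl⟩
      have hpos : N (d.erase (i, j)) ≠ 0 := by
        apply h2
        have := partCount_add_single (d.erase (i, j)) (i, j) r (by simp)
        rw [hsplit, hd] at this
        exact (add_right_cancel this).symm
      have := single_le_sum (f := fun p : ((Fin n × ℕ) →₀ ℕ) × ((Fin n × ℕ) →₀ ℕ) => N p.1)
        (fun _ _ => Nat.zero_le _) hmem
      simp only at this
      omega

/-- Choose a monomial `e` of maximal degree in `f` and an exponent `d` whose part multiplicities are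
`e`. By the triangularity of `coeff_toSeries_monomial` no other monomial of `f` contributes at `d`,
and `e` contributes a non-zero integer multiple of its coefficient. -/
theorem toSeries_injective (n : ℕ) : Function.Injective (toSeries n) := by
  classical
  rw [injective_iff_map_eq_zero]
  intro f hf
  by_contra h0
  obtain ⟨e, he, hmax⟩ := exists_max_image f.support Finsupp.degree
    (MvPolynomial.support_nonempty.mpr h0)
  obtain ⟨d, hd⟩ := exists_partCount_eq _ e rfl
  have hcard : #d.support = e.degree := by rw [← degree_partCount, hd]
  have h1 : MvPowerSeries.coeff d (toSeries n f) =
      f.coeff e * MvPowerSeries.coeff d (toSeries n (MvPolynomial.monomial e 1)) := by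
    conv_lhs => rw [f.as_sum]
    rw [map_sum, map_sum, sum_eq_single e]
    · rw [← mul_one (f.coeff e), ← smul_eq_mul, ← MvPolynomial.smul_monomial, map_smul,
        MvPowerSeries.coeff_smul, smul_eq_mul, mul_one]
    · intro e' he' hne
      obtain ⟨N, hN, h2, -⟩ := coeff_toSeries_monomial _ e' d rfl
      rw [← mul_one (f.coeff e'), ← smul_eq_mul, ← MvPolynomial.smul_monomial, map_smul,
        MvPowerSeries.coeff_smul, hN]
      by_cases hN0 : N = 0
      · simp [hN0]
      · have h3 := h2 hN0
        have := hmax e' he'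
        exact absurd ((h3.2 (by omega)).symm.trans hd) hne
    · intro h; exact absurd he h
  obtain ⟨N, hN, -, h2⟩ := coeff_toSeries_monomial _ e d rfl
  rw [hf, map_zero, hN] at h1
  exact mul_ne_zero (MvPolynomial.mem_support_iff.mp he) (Nat.cast_ne_zero.mpr (h2 hd)) h1.symm

/-- Induction on the total number of parts: the product of single-alphabet power sums with the parts
of `la` is a non-zero multiple of `multiMonomial la` plus multi-monomials with strictly fewer parts.
-/
theorem exists_toSeries_eq_multiMonomial {n : ℕ} (k : ℕ) : ∀ la : MPtn n,
    #la.toExp.support = k → ∃ f : MSym n, toSeries n f = multiMonomial la := by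
  classical
  induction k using Nat.strong_induction_on with
  | _ k ih =>
    intro la hk
    set p : MSym n := MvPolynomial.monomial la.exponent 1 with hp
    have hdeg : la.exponent.degree = k := by rw [← partCount_toExp, degree_partCount, hk]
    obtain ⟨s, hs⟩ := exists_finset_support p
    have hla : MvPowerSeries.coeff la.toExp (toSeries n p) ≠ 0 := by
      obtain ⟨N, hN, -, h2⟩ := coeff_toSeries_monomial _ la.exponent la.toExp rfl
      rw [hN]
      exact Nat.cast_ne_zero.mpr (h2 (partCount_toExp la))
    have hlow : ∀ mu ∈ s.erase la, ∃ f : MSym n, toSeries n f =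
        MvPowerSeries.coeff mu.toExp (toSeries n p) • multiMonomial mu := by
      intro mu hmu
      by_cases hc : MvPowerSeries.coeff mu.toExp (toSeries n p) = 0
      · exact ⟨0, by simp [hc]⟩
      · obtain ⟨N, hN, h1, -⟩ := coeff_toSeries_monomial _ la.exponent mu.toExp hdeg
        have hN0 : N ≠ 0 := by
          rintro rfl
          exact hc (by rw [hN, Nat.cast_zero])
        have h2 : #mu.toExp.support ≠ k := fun h => by
          have := (h1 hN0).2 h
          rw [partCount_toExp] at this
          exact (mem_erase.mp hmu).1 (exponent_injective n this)
        obtain ⟨f, hf⟩ := ih _ (lt_of_le_of_ne (h1 hN0).1 h2) mu rfl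
        exact ⟨MvPowerSeries.coeff mu.toExp (toSeries n p) • f, by rw [map_smul, hf]⟩
    choose! g hg using hlow
    refine ⟨(MvPowerSeries.coeff la.toExp (toSeries n p))⁻¹ • (p - ∑ mu ∈ s.erase la, g mu), ?_⟩
    rw [map_smul, map_sub, map_sum, sum_congr rfl hg, inv_smul_eq_iff₀ hla]
    rw [sub_eq_iff_eq_add', sum_erase_add s _ (hs la hla)]
    exact toSeries_eq_sum p s hs

/-- The multi-monomial function as a polynomial in the power sums. -/
def mm {n : ℕ} (la : MPtn n) : MSym n := (exists_toSeries_eq_multiMonomial _ la rfl).choose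

theorem toSeries_mm {n : ℕ} (la : MPtn n) : toSeries n (mm la) = multiMonomial la :=
  (exists_toSeries_eq_multiMonomial _ la rfl).choose_spec

theorem eq_sum_mm {n : ℕ} (f : MSym n) (s : Finset (MPtn n))
    (hs : ∀ la : MPtn n, MvPowerSeries.coeff la.toExp (toSeries n f) ≠ 0 → la ∈ s) :
    f = ∑ la ∈ s, MvPowerSeries.coeff la.toExp (toSeries n f) • mm la := by
  apply toSeries_injective
  rw [map_sum]
  simp only [map_smul, toSeries_mm]
  exact toSeries_eq_sum f s hs

/-- The coefficients at `toExp` are the coordinates with respect to `mm`. With the converse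
`coeff_eq_zero_of_mem_span_mm`, every triangularity claim becomes the vanishing of coefficients. -/
theorem mem_span_mm {n : ℕ} (f : MSym n) (S : Set (MPtn n))
    (hS : ∀ la : MPtn n, MvPowerSeries.coeff la.toExp (toSeries n f) ≠ 0 → la ∈ S) :
    f ∈ Submodule.span Kqt (mm '' S) := by
  obtain ⟨s, hs⟩ := exists_finset_support f
  rw [eq_sum_mm f s hs]
  refine Submodule.sum_mem _ fun la _ => ?_
  by_cases h : MvPowerSeries.coeff la.toExp (toSeries n f) = 0
  · simp [h]
  · exact Submodule.smul_mem _ _ (Submodule.subset_span ⟨la, hS la h, rfl⟩)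

theorem span_mm_eq_top (n : ℕ) : Submodule.span Kqt (Set.range (mm (n := n))) = ⊤ := by
  rw [eq_top_iff, ← Set.image_univ]
  exact fun f _ => mem_span_mm f _ fun _ _ => Set.mem_univ _

theorem coeff_mm {n : ℕ} (la mu : MPtn n) :
    MvPowerSeries.coeff mu.toExp (toSeries n (mm la)) =
      open Classical in if la = mu then 1 else 0 := by
  rw [toSeries_mm, coeff_multiMonomial_toExp]

theorem coeff_eq_zero_of_mem_span_mm {n : ℕ} {S : Set (MPtn n)} {f : MSym n}
    (hf : f ∈ Submodule.span Kqt (mm '' S)) {la : MPtn n} (hla : la ∉ S) :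
    MvPowerSeries.coeff la.toExp (toSeries n f) = 0 := by
  induction hf using Submodule.span_induction with
  | mem x hx =>
    obtain ⟨mu, hmu, rfl⟩ := hx
    rw [coeff_mm, if_neg]
    rintro rfl
    exact hla hmu
  | zero => simp
  | add x y _ _ hx hy => rw [map_add, map_add, hx, hy, add_zero]
  | smul a x _ hx => rw [map_smul, MvPowerSeries.coeff_smul, hx, mul_zero]

/-! ### Bilinear forms for which the monomials are orthogonal -/

section Fock

variable {σ τ : Type*}

/-- The norm `∏ N_v ^ m_v * m_v!` of a monomial. -/
def fockNorm (N : σ → Kqt) (d : σ →₀ ℕ) : Kqt := d.prod fun v m => N v ^ m * m.factorial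

/-- The bilinear form on polynomials for which the monomials are orthogonal, and multiplication by
`X v` is adjoint to `N v` times the derivative with respect to `X v`. -/
def fock (N : σ → Kqt) : LinearMap.BilinForm Kqt (MvPolynomial σ Kqt) :=
  (MvPolynomial.basisMonomials σ Kqt).constr Kqt
    (fun d => fockNorm N d • MvPolynomial.lcoeff Kqt d)

theorem fock_monomial (N : σ → Kqt) (d : σ →₀ ℕ) (a : Kqt) (h : MvPolynomial σ Kqt) :
    fock N (MvPolynomial.monomial d a) h = a * (fockNorm N d * h.coeff d) := by
  have : MvPolynomial.monomial d a = a • MvPolynomial.basisMonomials σ Kqt d := by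
    simp [MvPolynomial.smul_monomial]
  rw [this, fock, map_smul, Module.Basis.constr_basis]
  simp

theorem fock_symm (N : σ → Kqt) (f h : MvPolynomial σ Kqt) : fock N f h = fock N h f := by
  classical
  induction f using MvPolynomial.induction_on' with
  | add p q hp hq => rw [map_add, LinearMap.add_apply, hp, hq, map_add]
  | monomial d a =>
    induction h using MvPolynomial.induction_on' with
    | add p q hp hq => rw [map_add, hp, hq, map_add, LinearMap.add_apply]
    | monomial e b =>
      rw [fock_monomial, fock_monomial, MvPolynomial.coeff_monomial, MvPolynomial.coeff_monomial]
      by_cases h : d = e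
      · subst h; simp; ring
      · simp [h, Ne.symm h]

theorem fockNorm_add_single (N : σ → Kqt) (d : σ →₀ ℕ) (v : σ) :
    fockNorm N (d + Finsupp.single v 1) = N v * (d v + 1) * fockNorm N d := by
  classical
  have h1 : ∀ e : σ →₀ ℕ, fockNorm N e =
      (N v ^ e v * (e v).factorial) * ∏ w ∈ e.support.erase v, (N w ^ e w * (e w).factorial) := by
    intro e
    rw [fockNorm, Finsupp.prod]
    by_cases hv : v ∈ e.support
    · exact (mul_prod_erase _ (fun w => N w ^ e w * ((e w).factorial : Kqt)) hv).symm
    · rw [erase_eq_of_notMem hv, Finsupp.notMem_support_iff.mp hv]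
      simp
  have h2 : (d + Finsupp.single v 1).support.erase v = d.support.erase v := by
    ext w
    simp only [mem_erase, Finsupp.mem_support_iff, Finsupp.add_apply, Finsupp.single_apply]
    refine and_congr_right fun hw => ?_
    rw [if_neg (Ne.symm hw), add_zero]
  rw [h1, h1 d, h2, prod_congr rfl fun w hw => by
    rw [Finsupp.add_apply, Finsupp.single_apply, if_neg (mem_erase.mp hw).1.symm, add_zero]]
  simp only [Finsupp.add_apply, Finsupp.single_eq_same, Nat.factorial_succ]
  push_cast
  ring

theorem fock_X_mul (N : σ → Kqt) (v : σ) (f h : MvPolynomial σ Kqt) :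
    fock N (MvPolynomial.X v * f) h = N v * fock N f (MvPolynomial.pderiv v h) := by
  classical
  induction f using MvPolynomial.induction_on' with
  | add p q hp hq => simp only [mul_add, map_add, LinearMap.add_apply, hp, hq]
  | monomial d a =>
    rw [MvPolynomial.X, MvPolynomial.monomial_mul, one_mul, fock_monomial, fock_monomial,
      add_comm, fockNorm_add_single]
    have : (MvPolynomial.pderiv v h).coeff d = (d v + 1) * h.coeff (d + Finsupp.single v 1) := by
      induction h using MvPolynomial.induction_on' with
      | add p q hp hq => rw [map_add, MvPolynomial.coeff_add, hp, hq, MvPolynomial.coeff_add]; ring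
      | monomial e b =>
        rw [MvPolynomial.pderiv_monomial, MvPolynomial.coeff_monomial, MvPolynomial.coeff_monomial]
        by_cases he : e = d + Finsupp.single v 1
        · subst he
          simp
          ring
        · rw [if_neg he, mul_zero, ite_eq_right_iff]
          intro h'
          by_cases hv : e v = 0
          · simp [hv]
          · exfalso
            apply he
            rw [← h', tsub_add_cancel_of_le]
            rw [Finsupp.single_le_iff]; omega
    rw [this]
    ring

theorem fock_one (N : σ → Kqt) (h : MvPolynomial σ Kqt) :
    fock N 1 h = MvPolynomial.constantCoeff h := by
  rw [← MvPolynomial.C_1, MvPolynomial.C_apply, fock_monomial]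
  simp [fockNorm, MvPolynomial.constantCoeff_eq]

theorem fock_C_mul (N : σ → Kqt) (a : Kqt) (f h : MvPolynomial σ Kqt) :
    fock N (MvPolynomial.C a * f) h = a * fock N f h := by
  rw [MvPolynomial.C_mul', map_smul, LinearMap.smul_apply, smul_eq_mul]

theorem eq_zero_of_fock_eq_zero {N : σ → Kqt} (hN : ∀ v, N v ≠ 0) {f : MvPolynomial σ Kqt}
    (hf : ∀ h, fock N f h = 0) : f = 0 := by
  ext d
  have := hf (MvPolynomial.monomial d 1)
  rw [fock_symm, fock_monomial, one_mul] at this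
  refine (mul_eq_zero.mp this).resolve_left ?_
  refine prod_ne_zero_iff.mpr fun v _ => ?_
  exact mul_ne_zero (pow_ne_zero _ (hN v)) (Nat.cast_ne_zero.mpr (Nat.factorial_ne_zero _))

theorem map_fock (φ : Kqt →+* Kqt) (N : σ → Kqt) (f h : MvPolynomial σ Kqt) :
    fock (fun v => φ (N v)) (MvPolynomial.map φ f) (MvPolynomial.map φ h) = φ (fock N f h) := by
  induction f using MvPolynomial.induction_on' with
  | add p q hp hq => simp only [map_add, LinearMap.add_apply, hp, hq]
  | monomial d a =>
    rw [MvPolynomial.map_monomial, fock_monomial, fock_monomial, MvPolynomial.coeff_map]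
    simp [fockNorm, Finsupp.prod]

/-- Both sides obey the adjunction between `X v` and the derivative, since the scaling of the
variables multiplies the derivative by `c v`. This lets a change of norms be absorbed into one
argument, where it is a scalar on homogeneous elements if `c` is a power of the weight. -/
theorem fock_scale (N c : σ → Kqt) (f h : MvPolynomial σ Kqt) :
    fock (fun v => c v * N v) f h =
      fock N f (MvPolynomial.aeval (fun v => MvPolynomial.C (c v) * MvPolynomial.X v) h) := by
  induction f using MvPolynomial.induction_on generalizing h with
  | C a =>
    rw [← mul_one (MvPolynomial.C a), fock_C_mul, fock_C_mul, fock_one, fock_one]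
    congr 1
    induction h using MvPolynomial.induction_on with
    | C b => simp
    | add p q hp hq => simp only [map_add, hp, hq]
    | mul_X p v _ => simp
  | add p q hp hq => simp only [map_add, LinearMap.add_apply, hp, hq]
  | mul_X p v hp =>
    rw [mul_comm, fock_X_mul, fock_X_mul, hp, mul_comm (c v), mul_assoc, ← smul_eq_mul (c v),
      ← map_smul]
    congr 2
    induction h using MvPolynomial.induction_on with
    | C b => simp
    | add p q hp hq => simp only [map_add, smul_add, hp, hq]
    | mul_X p w hp =>
      by_cases h : w = v
      · subst h
        simp only [Derivation.leibniz, map_add, map_mul, MvPolynomial.aeval_X, smul_eq_mul,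
          MvPolynomial.pderiv_X_self, MvPolynomial.pderiv_C, map_one, ← hp,
          MvPolynomial.smul_eq_C_mul]
        ring
      · simp only [Derivation.leibniz, map_add, map_mul, MvPolynomial.aeval_X, smul_eq_mul,
          MvPolynomial.pderiv_X_of_ne h, MvPolynomial.pderiv_C, map_zero, ← hp,
          MvPolynomial.smul_eq_C_mul]
        ring

/-- Comparison of two such forms along a linear substitution that respects the form on the
variables. -/
theorem fock_linear_subst (N : σ → Kqt) (N' : τ → Kqt)
    (L : MvPolynomial τ Kqt →ₐ[Kqt] MvPolynomial σ Kqt)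
    (hL : ∀ v, ∃ (s : Finset σ) (a : σ → Kqt),
      L (MvPolynomial.X v) = ∑ w ∈ s, MvPolynomial.C (a w) * MvPolynomial.X w)
    (hN : ∀ v, fock N (L (MvPolynomial.X v)) (L (MvPolynomial.X v)) = N' v)
    (hN' : ∀ v w, v ≠ w → fock N (L (MvPolynomial.X v)) (L (MvPolynomial.X w)) = 0)
    (f h : MvPolynomial τ Kqt) : fock N (L f) (L h) = fock N' f h := by
  classical
  choose s a hs using hL
  -- `δ v` is the adjoint of multiplication by the linear form `L (X v)`.
  set δ : τ → Derivation Kqt (MvPolynomial σ Kqt) (MvPolynomial σ Kqt) :=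
    fun v => ∑ w ∈ s v, (a v w * N w) • MvPolynomial.pderiv w with hδ
  have hδ_apply : ∀ v p, δ v p = ∑ w ∈ s v, (a v w * N w) • MvPolynomial.pderiv w p := by
    intro v p
    simp only [hδ, ← Derivation.coeFnAddMonoidHom_apply, map_sum, Finset.sum_apply]
    rfl
  have adj : ∀ v p h, fock N (L (MvPolynomial.X v) * p) h = fock N p (δ v h) := by
    intro v p h
    rw [hs, sum_mul, map_sum, LinearMap.sum_apply, hδ_apply, map_sum]
    refine sum_congr rfl fun w _ => ?_
    rw [mul_assoc, fock_C_mul, fock_X_mul, map_smul, smul_eq_mul, mul_assoc]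
  -- A first-order operator with constant coefficients sends a linear form to a constant, which
  -- adjointness identifies as the pairing of the two forms.
  have hgen : ∀ v w, δ v (L (MvPolynomial.X w)) =
      MvPolynomial.C (fock N (L (MvPolynomial.X v)) (L (MvPolynomial.X w))) := by
    intro v w
    have h1 : ∃ c, δ v (L (MvPolynomial.X w)) = MvPolynomial.C c := by
      rw [hs, hδ_apply]
      refine ⟨∑ u ∈ s v, (a v u * N u) * ∑ x ∈ s w, if x = u then a w x else 0, ?_⟩
      rw [map_sum]
      refine sum_congr rfl fun u _ => ?_
      rw [map_mul, MvPolynomial.smul_eq_C_mul, map_sum, map_sum]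
      congr 1
      refine sum_congr rfl fun x _ => ?_
      rw [MvPolynomial.pderiv_C_mul]
      split_ifs with hx
      · subst hx
        simp
      · simp [MvPolynomial.pderiv_X_of_ne hx]
    obtain ⟨c, hc⟩ := h1
    have h2 := adj v 1 (L (MvPolynomial.X w))
    rw [mul_one, hc, fock_one] at h2
    rw [hc, h2]
    simp
  -- By orthogonality of the images, `δ v` acts on the image of `L` as `N' v` times the derivative;
  -- it suffices to know this on generators.
  have hder : ∀ v h, δ v (L h) = N' v • L (MvPolynomial.pderiv v h) := by
    intro v h
    induction h using MvPolynomial.induction_on with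
    | C b =>
      rw [← MvPolynomial.algebraMap_eq, AlgHom.commutes, Derivation.map_algebraMap,
        Derivation.map_algebraMap, map_zero, smul_zero]
    | add p q hp hq => simp only [map_add, smul_add, hp, hq]
    | mul_X p w hp =>
      rw [map_mul, Derivation.leibniz, hp, hgen, Derivation.leibniz]
      by_cases h : v = w
      · subst h
        simp only [hN, MvPolynomial.pderiv_X_self, MvPolynomial.smul_eq_C_mul, map_add, map_mul,
          smul_eq_mul, map_one]
        ring
      · simp only [hN' v w h, MvPolynomial.pderiv_X_of_ne (Ne.symm h), MvPolynomial.smul_eq_C_mul,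
          map_mul, smul_eq_mul, map_zero, mul_zero, zero_add]
        ring
  induction f using MvPolynomial.induction_on generalizing h with
  | C b =>
    rw [← mul_one (MvPolynomial.C b), map_mul, map_one, ← MvPolynomial.algebraMap_eq,
      AlgHom.commutes, MvPolynomial.algebraMap_eq, MvPolynomial.algebraMap_eq, fock_C_mul,
      fock_C_mul, fock_one, fock_one]
    congr 1
    induction h using MvPolynomial.induction_on with
    | C b =>
      rw [← MvPolynomial.algebraMap_eq, AlgHom.commutes]
      simp
    | add p q hp hq => simp only [map_add, hp, hq]
    | mul_X p v _ => simp [hs]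
  | add p q hp hq => simp only [map_add, LinearMap.add_apply, hp, hq]
  | mul_X p v hp =>
    rw [mul_comm, map_mul, adj, hder, map_smul, smul_eq_mul, hp, fock_X_mul]

end Fock

/-- The norms of the power sums of the unions of alphabets. -/
def unionNorm (n : ℕ) (v : Fin n × ℕ) : Kqt :=
  (v.2 + 1) * q ^ ((n - 1 - (v.1 : ℕ)) * (v.2 + 1)) *
    if (v.1 : ℕ) + 1 = n then (1 - q ^ (v.2 + 1)) / (1 - t ^ (v.2 + 1)) else 1

/-- `exponentZ` is a product over the variables in which a variable of multiplicity `m` contributes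
`N ^ m * m!`. So the form is determined by the norms of the single union power sums. -/
theorem scalarProduct_eq_fock (n : ℕ) (f h : MSym n) :
    scalarProduct n f h = fock (unionNorm n) (unionCoords n f) (unionCoords n h) := by
  have : (fun d => exponentZ d • MvPolynomial.lcoeff Kqt d) =
      fun d : (Fin n × ℕ) →₀ ℕ => fockNorm (unionNorm n) d • MvPolynomial.lcoeff Kqt d := by
    funext d
    congr 1
    rw [exponentZ, fockNorm]
    refine Finsupp.prod_congr fun v _ => ?_
    rw [unionNorm]
    split_ifs with h
    · simp only [mul_pow, ← pow_mul]
      push_cast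
      ring
    · simp only [mul_pow, ← pow_mul, one_pow]
      push_cast
      ring
  rw [scalarProduct, this]
  rfl

/-! ### The functions `h_m[X (1 - τ)]` and the vertex operator -/

section Series

variable {R : Type*} [CommRing R] [Algebra Kqt R]

theorem mul_succ_cancel {x y : R} {m : ℕ} (h : x * ((m : R) + 1) = y * ((m : R) + 1)) :
    x = y := by
  have hm : ((m : Kqt) + 1) ≠ 0 := Nat.cast_add_one_ne_zero m
  have h1 : ((m : R) + 1) * algebraMap Kqt R ((m : Kqt) + 1)⁻¹ = 1 := by
    rw [← map_natCast (algebraMap Kqt R), ← map_one (algebraMap Kqt R), ← map_add, ← map_mul,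
      mul_inv_cancel₀ hm]
  rw [← mul_one x, ← h1, ← mul_assoc, h, mul_assoc, h1, mul_one]

/-- The logarithmic derivative of the generating function of the `h_m[X (1 - τ)]`, where
`c r` is the power sum `p_{r+1}`. -/
def logDeriv (τ : Kqt) (c : ℕ → R) : PowerSeries R :=
  PowerSeries.mk fun r => (1 - τ ^ (r + 1)) • c r

/-- The functions `h_m[X (1 - τ)]` in terms of the power sums, by Newton's recursion. -/
def hseq (τ : Kqt) (c : ℕ → R) : ℕ → R
  | 0 => 1
  | m + 1 => ((m : Kqt) + 1)⁻¹ • ∑ k : Fin (m + 1), (1 - τ ^ ((k : ℕ) + 1)) • c k *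
      hseq τ c (m - k)
  decreasing_by omega

theorem hseq_succ (τ : Kqt) (c : ℕ → R) (m : ℕ) :
    hseq τ c (m + 1) * ((m : R) + 1) =
      ∑ k ∈ range (m + 1), (1 - τ ^ (k + 1)) • c k * hseq τ c (m - k) := by
  rw [hseq, sum_range]
  have hm : ((m : Kqt) + 1) ≠ 0 := Nat.cast_add_one_ne_zero m
  have h1 : ((m : R) + 1) = algebraMap Kqt R ((m : Kqt) + 1) := by simp
  rw [h1, mul_comm, ← Algebra.smul_def, smul_inv_smul₀ hm]

theorem derivative_hseq (τ : Kqt) (c : ℕ → R) :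
    PowerSeries.derivative R (PowerSeries.mk (hseq τ c)) =
      logDeriv τ c * PowerSeries.mk (hseq τ c) := by
  ext m
  rw [PowerSeries.coeff_derivative, PowerSeries.coeff_mk, hseq_succ, PowerSeries.coeff_mul,
    Nat.sum_antidiagonal_eq_sum_range_succ_mk]
  simp [logDeriv]

/-- In characteristic zero a linear first-order differential equation has a unique power series
solution with given constant term. The multiplicativity of the generating function follows from
this. -/
theorem eq_mk_hseq {τ : Kqt} {c : ℕ → R} {W : PowerSeries R}
    (h0 : PowerSeries.constantCoeff W = 1)
    (h : PowerSeries.derivative R W = logDeriv τ c * W) : W = PowerSeries.mk (hseq τ c) := by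
  have key : ∀ m, PowerSeries.coeff m W = hseq τ c m := by
    intro m
    induction m using Nat.strong_induction_on with
    | _ m ih =>
      cases m with
      | zero => rw [PowerSeries.coeff_zero_eq_constantCoeff_apply, h0, hseq]
      | succ m =>
        refine mul_succ_cancel (m := m) ?_
        rw [← PowerSeries.coeff_derivative, h, hseq_succ, PowerSeries.coeff_mul,
          Nat.sum_antidiagonal_eq_sum_range_succ_mk]
        refine sum_congr rfl fun k hk => ?_
        rw [ih _ (by omega)]
        simp [logDeriv]
  ext m
  rw [key, PowerSeries.coeff_mk]

theorem mk_hseq_add (τ : Kqt) (c c' : ℕ → R) :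
    PowerSeries.mk (hseq τ fun r => c r + c' r) =
      PowerSeries.mk (hseq τ c) * PowerSeries.mk (hseq τ c') := by
  symm
  apply eq_mk_hseq
  · rw [map_mul]
    simp [← PowerSeries.coeff_zero_eq_constantCoeff_apply, hseq]
  · rw [Derivation.leibniz, derivative_hseq, derivative_hseq, smul_eq_mul, smul_eq_mul]
    have : logDeriv τ (fun r => c r + c' r) = logDeriv τ c + logDeriv τ c' := by
      ext m
      simp [logDeriv]
    rw [this]
    ring

theorem mk_hseq_zero (τ : Kqt) : PowerSeries.mk (hseq τ fun _ => (0 : R)) = 1 := by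
  symm
  apply eq_mk_hseq
  · simp
  · rw [show (1 : PowerSeries R) = PowerSeries.C 1 by simp, PowerSeries.derivative_C]
    have : logDeriv τ (fun _ => (0 : R)) = 0 := by
      ext m
      simp [logDeriv]
    rw [this, zero_mul]

theorem mk_hseq_sum {ι : Type*} (τ : Kqt) (s : Finset ι) (c : ι → ℕ → R) :
    PowerSeries.mk (hseq τ fun r => ∑ b ∈ s, c b r) =
      ∏ b ∈ s, PowerSeries.mk (hseq τ (c b)) := by
  classical
  induction s using Finset.induction_on with
  | empty => simpa using mk_hseq_zero τ
  | insert a s ha ih =>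
    rw [prod_insert ha, ← ih, ← mk_hseq_add]
    simp only [sum_insert ha]

theorem map_hseq {S : Type*} [CommRing S] [Algebra Kqt S] (φ : R →ₐ[Kqt] S) (τ : Kqt) (c : ℕ → R)
    (m : ℕ) : φ (hseq τ c m) = hseq τ (fun r => φ (c r)) m := by
  induction m using Nat.strong_induction_on with
  | _ m ih =>
    cases m with
    | zero => simp [hseq]
    | succ m =>
      refine mul_succ_cancel (m := m) ?_
      rw [hseq_succ, ← map_natCast φ, ← map_one φ, ← map_add, ← map_mul, hseq_succ, map_sum]
      refine sum_congr rfl fun k hk => ?_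
      rw [map_mul, map_smul, ih _ (by omega)]

theorem hseq_C (τ : Kqt) (c : ℕ → R) (m : ℕ) :
    hseq τ (fun r => Polynomial.C (c r)) m = Polynomial.C (hseq τ c m) :=
  (map_hseq (Polynomial.CAlgHom (R := Kqt) (A := R)) τ c m).symm

theorem hseq_MvPolynomial_C {ι : Type*} (τ : Kqt) (c : ℕ → R) (m : ℕ) :
    hseq τ (fun r => (MvPolynomial.C (c r) : MvPolynomial ι R)) m =
      MvPolynomial.C (hseq τ c m) :=
  (map_hseq (IsScalarTower.toAlgHom Kqt R (MvPolynomial ι R)) τ c m).symm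

theorem hseq_scale (τ : Kqt) (c : ℕ → R) (x : R) (m : ℕ) :
    hseq τ (fun r => x ^ (r + 1) * c r) m = x ^ m * hseq τ c m := by
  induction m using Nat.strong_induction_on with
  | _ m ih =>
    cases m with
    | zero => simp [hseq]
    | succ m =>
      refine mul_succ_cancel (m := m) ?_
      rw [hseq_succ, mul_assoc, hseq_succ, mul_sum]
      refine sum_congr rfl fun k hk => ?_
      have hk' : k ≤ m := Nat.lt_succ_iff.mp (mem_range.mp hk)
      rw [ih _ (by omega), show x ^ (m + 1) = x ^ (k + 1) * x ^ (m - k) by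
        rw [← pow_add]; congr 1; omega, ← mul_smul_comm]
      ring

theorem hseq_letter (τ : Kqt) (x : R) (m : ℕ) :
    hseq τ (fun r => x ^ (r + 1)) (m + 1) = (1 - τ) • x ^ (m + 1) := by
  induction m using Nat.strong_induction_on with
  | _ m ih =>
    refine mul_succ_cancel (m := m) ?_
    rw [hseq_succ, sum_range_succ, Nat.sub_self, hseq, mul_one]
    have h1 : ∀ k ∈ range m, (1 - τ ^ (k + 1)) • x ^ (k + 1) *
        hseq τ (fun r => x ^ (r + 1)) (m - k) =
        ((1 - τ ^ (k + 1)) * (1 - τ)) • x ^ (m + 1) := by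
      intro k hk
      have hk' := mem_range.mp hk
      obtain ⟨j, rfl⟩ : ∃ j, m = k + 1 + j := ⟨m - k - 1, by omega⟩
      rw [show k + 1 + j - k = j + 1 by omega, ih j (by omega), smul_mul_smul_comm, ← pow_add]
      congr 2
    rw [sum_congr rfl h1, ← sum_smul, ← add_smul]
    -- Newton's recursion for one letter: all earlier values but the first are multiples of `1 - τ`,
    -- and the sum of the coefficients telescopes.
    have h2 : ∑ k ∈ range m, (1 - τ ^ (k + 1)) * (1 - τ) + (1 - τ ^ (m + 1)) =
        (1 - τ) * ((m : Kqt) + 1) := by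
      clear ih h1
      induction m with
      | zero => simp
      | succ m ih =>
        rw [sum_range_succ]
        push_cast
        linear_combination ih
    rw [h2, mul_smul, smul_mul_assoc]
    congr 1
    rw [Algebra.smul_def]
    simp [mul_comm]

/-- The generating function `(1 - τ x z) / (1 - x z)` of a single letter. -/
theorem mk_hseq_letter (τ : Kqt) (x : R) :
    PowerSeries.mk (hseq τ fun r => x ^ (r + 1)) * (1 - PowerSeries.C x * PowerSeries.X) =
      1 - PowerSeries.C (τ • x) * PowerSeries.X := by
  ext m
  rw [mul_sub, mul_one, mul_left_comm, ← mul_assoc]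
  cases m with
  | zero => simp [hseq]
  | succ m =>
    rw [map_sub, map_sub, PowerSeries.coeff_succ_mul_X, PowerSeries.coeff_succ_mul_X,
      PowerSeries.coeff_C_mul, PowerSeries.coeff_mk, PowerSeries.coeff_mk, hseq_letter,
      PowerSeries.coeff_one, if_neg (Nat.succ_ne_zero m), PowerSeries.coeff_C]
    cases m with
    | zero => simp [hseq, sub_smul]
    | succ m =>
      rw [hseq_letter, if_neg (Nat.succ_ne_zero m), mul_smul_comm, ← pow_succ']
      simp

end Series

/-- The pairing of a polynomial in `u` with the coefficients of a power series, shifted by one. -/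
def shiftPair {R : Type*} [CommRing R] (W : PowerSeries R) : Polynomial R →ₗ[R] R :=
  Polynomial.lsum fun m => LinearMap.mulLeft R (PowerSeries.coeff (m + 1) W)

/-! ### Pairing polynomials with the generating function of the letters -/

theorem shiftPair_monomial {R : Type*} [CommRing R] (W : PowerSeries R) (m : ℕ) (c : R) :
    shiftPair W (Polynomial.monomial m c) = PowerSeries.coeff (m + 1) W * c := by
  simp [shiftPair, Polynomial.lsum_apply, Polynomial.sum_monomial_index]

theorem shiftPair_eq_sum {R : Type*} [CommRing R] (W : PowerSeries R) (M : ℕ) (c : ℕ → R) :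
    shiftPair W (∑ m ∈ range M, Polynomial.monomial m (c m)) =
      ∑ m ∈ range M, PowerSeries.coeff (m + 1) W * c m := by
  rw [map_sum]
  simp only [shiftPair_monomial]

/-- Multiplying the polynomial by `X - x` is the same as multiplying the series by `1 - x z` and
shifting the coefficients once more, so a factor can be traded between the two. -/
theorem shiftPair_mul {R : Type*} [CommRing R] (W W' : PowerSeries R) (x y : R)
    (h : W' * (1 - PowerSeries.C x * PowerSeries.X) =
      W * (1 - PowerSeries.C y * PowerSeries.X)) (p : Polynomial R) :
    shiftPair W' ((Polynomial.X - Polynomial.C x) * p) =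
      shiftPair W ((Polynomial.X - Polynomial.C y) * p) := by
  induction p using Polynomial.induction_on' with
  | add p q hp hq => rw [mul_add, mul_add, map_add, map_add, hp, hq]
  | monomial m c =>
    have h' := congrArg (PowerSeries.coeff (m + 2)) h
    rw [mul_sub, mul_sub, mul_one, mul_one, mul_left_comm, mul_left_comm W, ← mul_assoc,
      ← mul_assoc, map_sub, map_sub, PowerSeries.coeff_succ_mul_X, PowerSeries.coeff_succ_mul_X,
      PowerSeries.coeff_C_mul, PowerSeries.coeff_C_mul] at h'
    simp only [sub_mul, map_sub, Polynomial.X_mul_monomial, Polynomial.C_mul_monomial,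
      shiftPair_monomial]
    linear_combination c * h'

/-- A polynomial that vanishes at all the letters is orthogonal to the generating function of
the letters. -/
theorem shiftPair_eq_zero {R ι : Type*} [CommRing R] [IsDomain R] [Algebra Kqt R] (τ : Kqt)
    (s : Finset ι) (a : ι → R) (ha : Set.InjOn a s) :
    ∀ p : Polynomial R, (∀ b ∈ s, p.eval (a b) = 0) →
      shiftPair (∏ b ∈ s, PowerSeries.mk (hseq τ fun r => a b ^ (r + 1))) p = 0 := by
  classical
  induction s using Finset.induction_on with
  | empty =>
    intro p _
    rw [prod_empty]
    induction p using Polynomial.induction_on' with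
    | add p q hp hq => rw [map_add, hp (by simp), hq (by simp), add_zero]
    -- The empty product is the series `1`; its constant term is invisible because the pairing
    -- starts at the first coefficient.
    | monomial m c => simp [shiftPair_monomial, PowerSeries.coeff_one]
  | insert b s hb ih =>
    intro p hp
    -- The factor `X - a b` is traded for `X - τ • a b`, which removes the letter `a b` from the
    -- series. As the letters are distinct, the cofactor still vanishes at the remaining ones.
    obtain ⟨p, rfl⟩ := Polynomial.dvd_iff_isRoot.mpr (hp b (mem_insert_self b s))
    rw [prod_insert hb, shiftPair_mul (∏ b ∈ s, PowerSeries.mk (hseq τ fun r => a b ^ (r + 1)))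
      _ (a b) (τ • a b) (by rw [mul_right_comm, mk_hseq_letter, mul_comm])]
    refine ih (ha.mono (by simp)) _ fun b' hb' => ?_
    have h1 := hp b' (mem_insert_of_mem hb')
    rw [Polynomial.eval_mul] at h1 ⊢
    refine mul_eq_zero_of_right _ ((mul_eq_zero.mp h1).resolve_left ?_)
    rw [Polynomial.eval_sub, Polynomial.eval_X, Polynomial.eval_C, sub_eq_zero]
    intro h
    have := ha (mem_insert_of_mem hb') (mem_insert_self b s) h
    subst this
    exact hb hb'

section Plethysm

set_option maxSynthPendingDepth 6

/-! ### The Macdonald operator on symmetric functions in one alphabet -/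

/-- The homomorphism from the symmetric functions in one alphabet that sends `p_{r+1}` to `c r`. -/
def pev {R : Type*} [CommRing R] [Algebra Kqt R] (c : ℕ → R) : MSym 1 →ₐ[Kqt] R :=
  MvPolynomial.aeval fun v => c v.2

theorem pev_X {R : Type*} [CommRing R] [Algebra Kqt R] (c : ℕ → R) (v : Fin 1 × ℕ) :
    pev c (MvPolynomial.X v) = c v.2 := by
  simp [pev]

/-- The power sum `p_{r+1}` of a single alphabet. -/
abbrev pw (r : ℕ) : MSym 1 := MvPolynomial.X (0, r)

theorem pev_C {R : Type*} [CommRing R] [Algebra Kqt R] (c : ℕ → R) (a : Kqt) :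
    pev c (MvPolynomial.C a) = algebraMap Kqt R a :=
  (pev c).commutes a

theorem X_eq_pw (v : Fin 1 × ℕ) : (MvPolynomial.X v : MSym 1) = pw v.2 := by
  rw [pw, ← Fin.eq_zero v.1]

/-- The plethystic shift `f[X] ↦ f[X + (Q - 1) u]`. -/
def shiftU (Q : Kqt) : MSym 1 →ₐ[Kqt] Polynomial (MSym 1) :=
  pev fun r => Polynomial.C (pw r) +
    Polynomial.C (MvPolynomial.C (Q ^ (r + 1) - 1)) * Polynomial.X ^ (r + 1)

/-- The Macdonald operator: the constant term in `z` of
`f[X + (Q - 1) / z] * ∏ (1 - τ x_i z) / (1 - x_i z)`. -/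
def macOp (Q τ : Kqt) : MSym 1 →ₗ[Kqt] MSym 1 :=
  Polynomial.lsum (fun m => LinearMap.mulLeft Kqt (hseq τ pw m)) ∘ₗ (shiftU Q).toLinearMap

theorem macOp_eq_sum (Q τ : Kqt) (f : MSym 1) (M : ℕ) (hM : (shiftU Q f).natDegree < M) :
    macOp Q τ f = ∑ m ∈ range M, hseq τ pw m * (shiftU Q f).coeff m := by
  rw [macOp, LinearMap.comp_apply, AlgHom.toLinearMap_apply, Polynomial.lsum_apply,
    Polynomial.sum_over_range' _ (by simp) M hM]
  rfl

/-- The extension of a homomorphism `A → A[u]` to `A[s] → A[s][u]`. -/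
def extendHom {A : Type*} [CommRing A] (ψ : A →+* Polynomial A) :
    Polynomial A →+* Polynomial (Polynomial A) :=
  Polynomial.eval₂RingHom ((Polynomial.mapRingHom Polynomial.C).comp ψ)
    (Polynomial.C Polynomial.X)

theorem coeff_extendHom {A : Type*} [CommRing A] (ψ : A →+* Polynomial A) (y : Polynomial A)
    (m r : ℕ) : ((extendHom ψ y).coeff m).coeff r = (ψ (y.coeff r)).coeff m := by
  induction y using Polynomial.induction_on' with
  | add p q hp hq => simp only [map_add, Polynomial.coeff_add, hp, hq]
  | monomial k a =>
    rw [extendHom, Polynomial.coe_eval₂RingHom, Polynomial.eval₂_monomial, ← map_pow,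
      Polynomial.coeff_mul_C, RingHom.comp_apply, Polynomial.coe_mapRingHom, Polynomial.coeff_map,
      Polynomial.coeff_C_mul, Polynomial.coeff_X_pow, Polynomial.coeff_monomial]
    by_cases h : k = r
    · subst h; simp
    · simp [h, Ne.symm h]

/-! ### Adding several letters: the operator and degrees in finitely many variables -/

section Letters

/-- Symmetric functions in one alphabet and `j` additional letters. -/
abbrev LSym (j : ℕ) : Type := MvPolynomial (Fin j) (MSym 1)

/-- The addition of letters `s x_b` to the alphabet. -/
def addLetters (j : ℕ) : MSym 1 →ₐ[Kqt] Polynomial (LSym j) :=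
  pev (R := Polynomial (LSym j)) fun r => Polynomial.C (MvPolynomial.C (pw r)) +
    Polynomial.X ^ (r + 1) * Polynomial.C (∑ b : Fin j, (MvPolynomial.X b : LSym j) ^ (r + 1))

/-- The shift of the alphabet, in the presence of letters. -/
def shiftLetters (Q : Kqt) (j : ℕ) : LSym j →+* Polynomial (LSym j) :=
  MvPolynomial.eval₂Hom ((Polynomial.mapRingHom MvPolynomial.C).comp (shiftU Q).toRingHom)
    (fun b => Polynomial.C (MvPolynomial.X b))

theorem MSym.ringHom_ext {R : Type*} [CommRing R] [Algebra Kqt R] {f g : MSym 1 →+* R}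
    (hf : ∀ a : Kqt, f (algebraMap Kqt _ a) = algebraMap Kqt R a)
    (hg : ∀ a : Kqt, g (algebraMap Kqt _ a) = algebraMap Kqt R a)
    (h : ∀ r, f (pw r) = g (pw r)) : f = g :=
  MvPolynomial.ringHom_ext (fun a => (hf a).trans (hg a).symm) fun v => by rw [X_eq_pw, h]

/-- The substitutions `X ↦ X + s ∑ x_b` and `X ↦ X + (Q - 1) u` commute, as one sees on power sums.
-/
theorem extendHom_addLetters (Q : Kqt) (j : ℕ) (f : MSym 1) :
    extendHom (shiftLetters Q j) (addLetters j f) =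
      (shiftU Q f).map (addLetters j : MSym 1 →+* Polynomial (LSym j)) := by
  have : (extendHom (shiftLetters Q j)).comp (addLetters j : MSym 1 →+* Polynomial (LSym j)) =
      (Polynomial.mapRingHom (addLetters j : MSym 1 →+* Polynomial (LSym j))).comp
        (shiftU Q : MSym 1 →+* Polynomial (MSym 1)) := by
    refine MSym.ringHom_ext (fun a => ?_) (fun a => ?_) fun r => ?_
    · simp only [RingHom.comp_apply, RingHom.coe_coe, AlgHom.commutes]
      simp [extendHom, shiftLetters, Polynomial.algebraMap_apply, MvPolynomial.algebraMap_apply]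
    · simp [Polynomial.algebraMap_apply]
    · simp [extendHom, shiftLetters, addLetters, shiftU, pev_X, Polynomial.eval₂_finsetSum,
        Polynomial.eval₂_pow, Polynomial.eval₂_C, Polynomial.algebraMap_apply,
        MvPolynomial.algebraMap_apply]
      ring
  exact congrArg (fun φ => φ f) this

/-- At `u = s x_b` the term `(Q - 1) u` merges with the letter `s x_b` into `s Q x_b`. Hence this
evaluation does not raise the degree in `s`, although `u` itself has been given degree one. -/
theorem eval_addLetters_shiftU (Q : Kqt) (j : ℕ) (b : Fin j) (f : MSym 1) :
    ((shiftU Q f).map (addLetters j : MSym 1 →+* Polynomial (LSym j))).eval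
        (Polynomial.X * Polynomial.C (MvPolynomial.X b)) =
      (addLetters j f).map (MvPolynomial.eval₂Hom MvPolynomial.C (fun b' : Fin j =>
        if b' = b then MvPolynomial.C (MvPolynomial.C Q) * MvPolynomial.X b
          else MvPolynomial.X b') : LSym j →+* LSym j) := by
  set ρ : LSym j →+* LSym j := MvPolynomial.eval₂Hom MvPolynomial.C (fun b' : Fin j =>
    if b' = b then MvPolynomial.C (MvPolynomial.C Q) * MvPolynomial.X b else MvPolynomial.X b')
    with hρ
  have hX : ∀ b', ρ (MvPolynomial.X b') =
      if b' = b then MvPolynomial.C (MvPolynomial.C Q) * MvPolynomial.X b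
        else MvPolynomial.X b' := fun b' => by simp [hρ]
  have hC : ∀ a, ρ (MvPolynomial.C a) = MvPolynomial.C a := fun a => by simp [hρ]
  have : ((Polynomial.evalRingHom (Polynomial.X * Polynomial.C (MvPolynomial.X b))).comp
      (Polynomial.mapRingHom (addLetters j : MSym 1 →+* Polynomial (LSym j)))).comp
        (shiftU Q : MSym 1 →+* Polynomial (MSym 1)) =
      (Polynomial.mapRingHom ρ).comp (addLetters j : MSym 1 →+* Polynomial (LSym j)) := by
    refine MSym.ringHom_ext (fun a => ?_) (fun a => ?_) fun r => ?_
    · simp [Polynomial.algebraMap_apply]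
    · simp [Polynomial.algebraMap_apply, MvPolynomial.algebraMap_apply, hC]
    · have h1 : ∑ b', ρ (MvPolynomial.X b') ^ (r + 1) = (∑ b', MvPolynomial.X b' ^ (r + 1)) +
          (MvPolynomial.C (MvPolynomial.C Q) ^ (r + 1) - 1) * MvPolynomial.X b ^ (r + 1) := by
        rw [← sub_eq_iff_eq_add', ← sum_sub_distrib, sum_eq_single b]
        · rw [hX, if_pos rfl]; ring
        · intro b' _ hb'
          rw [hX, if_neg hb', sub_self]
        · simp
      have h2 : (Polynomial.mapRingHom ρ).comp (addLetters j : MSym 1 →+* Polynomial (LSym j))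
          (pw r) = Polynomial.C (MvPolynomial.C (pw r)) + Polynomial.X ^ (r + 1) *
            Polynomial.C (∑ b', ρ (MvPolynomial.X b') ^ (r + 1)) := by
        simp [addLetters, pev_X, hC, Polynomial.map_sum]
      rw [h2, h1]
      simp [addLetters, shiftU, pev_X, Polynomial.eval_finsetSum, Polynomial.algebraMap_apply,
        MvPolynomial.algebraMap_apply]
      ring
  exact congrArg (fun φ => φ f) this

/-- The generating function of the letters. -/
def letterSeries (τ : Kqt) (j : ℕ) : PowerSeries (LSym j) :=
  ∏ b : Fin j, PowerSeries.mk (hseq τ fun r => (MvPolynomial.X b : LSym j) ^ (r + 1))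

theorem addLetters_hseq (τ : Kqt) (j m : ℕ) :
    addLetters j (hseq τ pw m) = ∑ k ∈ range (m + 1),
      Polynomial.C (MvPolynomial.C (hseq τ pw k)) *
        (Polynomial.C (PowerSeries.coeff (m - k) (letterSeries τ j)) *
          Polynomial.X ^ (m - k)) := by
  have h1 : (fun r => addLetters j (pw r)) = fun r =>
      (Polynomial.C (MvPolynomial.C (pw r)) : Polynomial (LSym j)) +
        Polynomial.X ^ (r + 1) *
          Polynomial.C (∑ b : Fin j, (MvPolynomial.X b : LSym j) ^ (r + 1)) := by
    funext r
    rw [addLetters, pev_X]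
  rw [map_hseq, h1, ← PowerSeries.coeff_mk m (hseq τ _), mk_hseq_add, PowerSeries.coeff_mul,
    Nat.sum_antidiagonal_eq_sum_range_succ_mk]
  refine sum_congr rfl fun k _ => ?_
  rw [PowerSeries.coeff_mk, PowerSeries.coeff_mk, hseq_scale, letterSeries, ← mk_hseq_sum,
    PowerSeries.coeff_mk]
  rw [hseq_C, hseq_C, hseq_MvPolynomial_C, mul_comm (Polynomial.X ^ _)]

/-- The Macdonald operator does not raise the degree in any finite set of variables. -/
theorem natDegree_addLetters_macOp (Q τ : Kqt) (j D : ℕ) (f : MSym 1)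
    (hf : (addLetters j f).natDegree ≤ D) : (addLetters j (macOp Q τ f)).natDegree ≤ D := by
  set F : ℕ → Polynomial (LSym j) := fun m => addLetters j ((shiftU Q f).coeff m) with hF
  obtain ⟨M, hM⟩ : ∃ M, (shiftU Q f).natDegree < M := ⟨_, Nat.lt_succ_self _⟩
  have hFM : ∀ m, M ≤ m → F m = 0 := fun m hm => by
    rw [hF]
    simp only
    rw [Polynomial.coeff_eq_zero_of_natDegree_lt (hM.trans_le hm), map_zero]
  have hFc : ∀ m, F m = ((shiftU Q f).map
      (addLetters j : MSym 1 →+* Polynomial (LSym j))).coeff m := fun m => by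
    rw [Polynomial.coeff_map]; rfl
  have hFD : ∀ m r, D < r → (F m).coeff r = 0 := by
    intro m r hr
    rw [hFc, ← extendHom_addLetters, coeff_extendHom,
      Polynomial.coeff_eq_zero_of_natDegree_lt (hf.trans_lt hr), map_zero, Polynomial.coeff_zero]
  -- The coefficient of `s ^ d` after the evaluation `u = s x_b`, which vanishes beyond the degree
  -- of `f`.
  have heval : ∀ (b : Fin j) (d : ℕ), D < d → ∑ m ∈ range M,
      (if m ≤ d then (F m).coeff (d - m) * MvPolynomial.X b ^ m else 0) = 0 := by
    intro b d hd
    have h1 : (∑ m ∈ range M, F m * (Polynomial.X * Polynomial.C (MvPolynomial.X b)) ^ m).coeff d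
        = 0 := by
      have h2 := eval_addLetters_shiftU Q j b f
      rw [Polynomial.eval_eq_sum_range' (n := M) (Polynomial.natDegree_map_le.trans_lt hM)] at h2
      simp only [← hFc] at h2
      rw [h2]
      exact Polynomial.coeff_eq_zero_of_natDegree_lt
        ((Polynomial.natDegree_map_le.trans hf).trans_lt hd)
    refine Eq.trans ?_ h1
    rw [Polynomial.finsetSum_coeff]
    refine sum_congr rfl fun m _ => ?_
    rw [mul_pow, ← mul_assoc, ← map_pow, Polynomial.coeff_mul_C, Polynomial.coeff_mul_X_pow',
      ite_mul, zero_mul]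
  rw [Polynomial.natDegree_le_iff_coeff_eq_zero]
  intro D' hD'
  rw [macOp_eq_sum Q τ f M hM, map_sum]
  simp only [map_mul, addLetters_hseq, sum_mul]
  -- Grouping by the index `k` of `h_k[X (1 - τ)]` leaves, for each `k`, a sum against the
  -- generating function of the letters alone; each of these sums vanishes.
  rw [sum_comm' (t' := range M) (s' := fun k => Ico k M) (by
    intro x y; simp only [mem_range, mem_Ico]; omega), Polynomial.finsetSum_coeff]
  refine sum_eq_zero fun k hk => ?_
  rw [mem_range] at hk
  simp only [mul_assoc]
  rw [← mul_sum, Polynomial.coeff_C_mul]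
  refine mul_eq_zero_of_right _ ?_
  rw [Polynomial.finsetSum_coeff, sum_Ico_eq_sum_range]
  have hterm : ∀ l, (Polynomial.C (PowerSeries.coeff (k + l - k) (letterSeries τ j)) *
      (Polynomial.X ^ (k + l - k) * F (k + l))).coeff D' =
      PowerSeries.coeff l (letterSeries τ j) *
        (if l ≤ D' then (F (k + l)).coeff (D' - l) else 0) := by
    intro l
    rw [Polynomial.coeff_C_mul, mul_comm (Polynomial.X ^ _), Polynomial.coeff_mul_X_pow',
      Nat.add_sub_cancel_left]
  refine (sum_congr rfl fun l _ => hterm l).trans ?_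
  -- The term `l = 0` has too high a degree in `s` and drops out; this is why the pairing may be
  -- shifted by one.
  rw [show M - k = (M - k - 1) + 1 by omega, sum_range_succ']
  simp only [Nat.zero_le, if_true, Nat.sub_zero, hFD _ _ hD', mul_zero, add_zero]
  rw [← shiftPair_eq_sum, letterSeries]
  refine shiftPair_eq_zero τ univ _ ((MvPolynomial.X_injective).injOn) _ fun b _ => ?_
  -- In degree `D' + k` the terms with `m ≤ k` vanish, and the rest is `x_b ^ (k + 1)` times the
  -- value at `x_b` of the polynomial to be paired. So that polynomial vanishes at every letter.
  have h3 := heval b (D' + k) (by omega)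
  rw [range_eq_Ico, ← sum_Ico_consecutive _ (Nat.zero_le (k + 1)) (show k + 1 ≤ M by omega)] at h3
  rw [sum_eq_zero (s := Ico 0 (k + 1)), zero_add, sum_Ico_eq_sum_range] at h3
  swap
  · intro m hm
    rw [mem_Ico] at hm
    rw [hFD _ _ (by omega)]
    simp
  rw [Polynomial.eval_finsetSum]
  refine (mul_eq_zero.mp (Eq.trans ?_ h3 : MvPolynomial.X b ^ (k + 1) * _ = 0)).resolve_left
    (pow_ne_zero _ (MvPolynomial.X_ne_zero b))
  rw [mul_sum, show M - (k + 1) = M - k - 1 by omega]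
  refine sum_congr rfl fun l _ => ?_
  rw [Polynomial.eval_monomial]
  by_cases hl : l + 1 ≤ D'
  · rw [if_pos hl, if_pos (by omega), show D' + k - (k + 1 + l) = D' - (l + 1) by omega,
      show k + (l + 1) = k + 1 + l by omega]
    ring
  · rw [if_neg hl, if_neg (by omega)]
    simp

end Letters

/-- The addition of a single letter to the alphabet. -/
def addLetter : MSym 1 →ₐ[Kqt] Polynomial (MSym 1) :=
  pev fun r => Polynomial.C (pw r) + Polynomial.X ^ (r + 1)

theorem extendHom_addLetter (Q : Kqt) (f : MSym 1) :
    extendHom (shiftU Q : MSym 1 →+* Polynomial (MSym 1)) (addLetter f) =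
      (shiftU Q f).map (addLetter : MSym 1 →+* Polynomial (MSym 1)) := by
  have : (extendHom (shiftU Q : MSym 1 →+* Polynomial (MSym 1))).comp
      (addLetter : MSym 1 →+* Polynomial (MSym 1)) =
      (Polynomial.mapRingHom (addLetter : MSym 1 →+* Polynomial (MSym 1))).comp
        (shiftU Q : MSym 1 →+* Polynomial (MSym 1)) := by
    refine MSym.ringHom_ext (fun a => ?_) (fun a => ?_) fun r => ?_
    · simp only [RingHom.comp_apply, RingHom.coe_coe, AlgHom.commutes]
      simp [extendHom, Polynomial.algebraMap_apply, shiftU]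
    · simp [Polynomial.algebraMap_apply]
    · simp [extendHom, addLetter, shiftU, pev_X, Polynomial.algebraMap_apply]
      ring
  exact congrArg (fun φ => φ f) this

/-- With `u` equal to the added letter `y`, the alphabet `X + y + (Q - 1) y` is `X + Q y`. -/
theorem eval_addLetter_shiftU (Q : Kqt) (f : MSym 1) :
    ((shiftU Q f).map (addLetter : MSym 1 →+* Polynomial (MSym 1))).eval Polynomial.X =
      (addLetter f).comp (Polynomial.C (MvPolynomial.C Q) * Polynomial.X) := by
  have : ((Polynomial.evalRingHom Polynomial.X).comp
      (Polynomial.mapRingHom (addLetter : MSym 1 →+* Polynomial (MSym 1)))).comp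
        (shiftU Q : MSym 1 →+* Polynomial (MSym 1)) =
      (Polynomial.compRingHom (Polynomial.C (MvPolynomial.C Q) * Polynomial.X)).comp
        (addLetter : MSym 1 →+* Polynomial (MSym 1)) := by
    refine MSym.ringHom_ext (fun a => ?_) (fun a => ?_) fun r => ?_
    · simp [Polynomial.algebraMap_apply]
    · simp [Polynomial.algebraMap_apply]
    · simp [addLetter, shiftU, pev_X, Polynomial.algebraMap_apply]
      ring
  exact congrArg (fun φ => φ f) this

theorem addLetter_hseq (τ : Kqt) (m : ℕ) :
    addLetter (hseq τ pw m) = ∑ k ∈ range (m + 1), Polynomial.C (hseq τ pw k) *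
      ((if m - k = 0 then 1 else 1 - τ) • Polynomial.X ^ (m - k)) := by
  have h1 : (fun r => addLetter (pw r)) = fun r =>
      (Polynomial.C (pw r) : Polynomial (MSym 1)) + Polynomial.X ^ (r + 1) := by
    funext r
    rw [addLetter, pev_X]
  rw [map_hseq, h1, ← PowerSeries.coeff_mk m (hseq τ _), mk_hseq_add, PowerSeries.coeff_mul,
    Nat.sum_antidiagonal_eq_sum_range_succ_mk]
  refine sum_congr rfl fun k _ => ?_
  rw [PowerSeries.coeff_mk, PowerSeries.coeff_mk, hseq_C]
  congr 1
  rcases m - k with _ | e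
  · simp [hseq]
  · rw [hseq_letter, if_neg (Nat.succ_ne_zero e)]

/-- The effect of the Macdonald operator on the top coefficient with respect to one variable. -/
theorem coeff_addLetter_macOp (Q τ : Kqt) (D : ℕ) (f : MSym 1)
    (hf : (addLetter f).natDegree ≤ D) :
    (addLetter (macOp Q τ f)).coeff D = τ • macOp Q τ ((addLetter f).coeff D) +
      ((1 - τ) * Q ^ D) • (addLetter f).coeff D := by
  set F : ℕ → Polynomial (MSym 1) := fun m => addLetter ((shiftU Q f).coeff m) with hF
  set fD := (addLetter f).coeff D with hfD
  obtain ⟨M, hM, hM'⟩ : ∃ M, (shiftU Q f).natDegree < M ∧ (shiftU Q fD).natDegree < M :=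
    ⟨_, Nat.lt_succ_of_le (le_max_left _ _), Nat.lt_succ_of_le (le_max_right _ _)⟩
  have hFc : ∀ m, F m = ((shiftU Q f).map
      (addLetter : MSym 1 →+* Polynomial (MSym 1))).coeff m := fun m => by
    rw [Polynomial.coeff_map]; rfl
  have hFr : ∀ m r, (F m).coeff r = (shiftU Q ((addLetter f).coeff r)).coeff m := by
    intro m r
    rw [hFc, ← extendHom_addLetter, coeff_extendHom]
    rfl
  have hFD : ∀ m r, D < r → (F m).coeff r = 0 := by
    intro m r hr
    rw [hFr, Polynomial.coeff_eq_zero_of_natDegree_lt (hf.trans_lt hr), map_zero,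
      Polynomial.coeff_zero]
  have heval : ∀ d, ∑ m ∈ range M, (if m ≤ d then (F m).coeff (d - m) else 0) =
      (addLetter f).coeff d * MvPolynomial.C Q ^ d := by
    intro d
    rw [← Polynomial.comp_C_mul_X_coeff, ← eval_addLetter_shiftU,
      Polynomial.eval_eq_sum_range' (n := M) (Polynomial.natDegree_map_le.trans_lt hM),
      Polynomial.finsetSum_coeff]
    refine sum_congr rfl fun m _ => ?_
    rw [← hFc, Polynomial.coeff_mul_X_pow']
  -- The unweighted sum is the coefficient of degree `D + k` in the evaluation at the letter, hence
  -- zero for `k > 0` and the top coefficient times `Q ^ D` for `k = 0`.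
  have hinner : ∀ k < M, ∑ m ∈ Ico k M, (if m - k ≤ D then (F m).coeff (D - (m - k)) else 0) =
      if k = 0 then fD * MvPolynomial.C Q ^ D else 0 := by
    intro k hk
    have h3 := heval (D + k)
    rw [range_eq_Ico, ← sum_Ico_consecutive _ (Nat.zero_le k) hk.le, sum_eq_zero (s := Ico 0 k),
      zero_add] at h3
    · have : ∑ m ∈ Ico k M, (if m - k ≤ D then (F m).coeff (D - (m - k)) else 0) =
          ∑ m ∈ Ico k M, (if m ≤ D + k then (F m).coeff (D + k - m) else 0) := by
        refine sum_congr rfl fun m hm => ?_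
        rw [mem_Ico] at hm
        by_cases h : m - k ≤ D
        · rw [if_pos h, if_pos (by omega), show D + k - m = D - (m - k) by omega]
        · rw [if_neg h, if_neg (by omega)]
      rw [this, h3]
      by_cases hk0 : k = 0
      · subst hk0; simp [hfD]
      · rw [if_neg hk0, Polynomial.coeff_eq_zero_of_natDegree_lt (hf.trans_lt (by omega)), zero_mul]
    · intro m hm
      rw [mem_Ico] at hm
      rw [hFD _ _ (by omega), ite_self]
  rw [macOp_eq_sum Q τ f M hM, map_sum]
  simp only [map_mul, addLetter_hseq, sum_mul]
  rw [sum_comm' (t' := range M) (s' := fun k => Ico k M) (by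
    intro x y; simp only [mem_range, mem_Ico]; omega), Polynomial.finsetSum_coeff]
  -- The term `m = k` has weight `1 = τ + (1 - τ)` and the others have weight `1 - τ`. The `τ` parts
  -- add up to the operator on the top coefficient, the rest is `hinner`.
  have hterm : ∀ k ∈ range M, (∑ m ∈ Ico k M, Polynomial.C (hseq τ pw k) *
      ((if m - k = 0 then 1 else 1 - τ) • Polynomial.X ^ (m - k)) * F m).coeff D =
      τ • (hseq τ pw k * (shiftU Q fD).coeff k) +
        (1 - τ) • (hseq τ pw k * if k = 0 then fD * MvPolynomial.C Q ^ D else 0) := by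
    intro k hk
    rw [mem_range] at hk
    simp only [mul_assoc]
    rw [← hinner k hk, ← mul_sum, Polynomial.coeff_C_mul, Polynomial.finsetSum_coeff,
      ← mul_smul_comm, ← mul_smul_comm, ← mul_add]
    congr 1
    rw [← hFr k D, smul_sum, sum_eq_sum_Ico_succ_bot hk, sum_eq_sum_Ico_succ_bot hk, ← add_assoc]
    congr 1
    · simp [← add_smul]
    · refine sum_congr rfl fun m hm => ?_
      rw [mem_Ico] at hm
      rw [if_neg (by omega), smul_mul_assoc, Polynomial.coeff_smul, mul_comm (Polynomial.X ^ _),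
        Polynomial.coeff_mul_X_pow']
  refine (sum_congr rfl hterm).trans ?_
  rw [sum_add_distrib, ← smul_sum, ← smul_sum, ← macOp_eq_sum Q τ fD M hM']
  congr 1
  rw [sum_eq_single 0]
  · rw [if_pos rfl, hseq, one_mul, mul_smul, ← map_pow, mul_comm fD, MvPolynomial.C_mul']
  · intro k _ hk
    rw [if_neg hk, mul_zero]
  · intro h
    simp only [mem_range, not_lt, Nat.le_zero] at h
    omega

/-! ### The Macdonald operator is self-adjoint -/

/-- Chain rule in `u`. Only finitely many power sums occur in `f`; allowing every large bound `M`
lets the bounds be merged in the induction. -/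
theorem derivative_shiftU (Q : Kqt) (f : MSym 1) : ∃ M₀, ∀ M, M₀ ≤ M →
    Polynomial.derivative (shiftU Q f) = ∑ r ∈ range M,
      Polynomial.C (MvPolynomial.C ((r + 1) * (Q ^ (r + 1) - 1))) * Polynomial.X ^ r *
        shiftU Q (MvPolynomial.pderiv (0, r) f) := by
  induction f using MvPolynomial.induction_on with
  | C a => exact ⟨0, fun M _ => by simp [shiftU, Polynomial.algebraMap_apply]⟩
  | add p q hp hq =>
    obtain ⟨M₁, h₁⟩ := hp
    obtain ⟨M₂, h₂⟩ := hq
    refine ⟨max M₁ M₂, fun M hM => ?_⟩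
    rw [map_add, map_add, h₁ M (le_of_max_le_left hM), h₂ M (le_of_max_le_right hM),
      ← sum_add_distrib]
    simp only [map_add, mul_add]
  | mul_X p v hp =>
    obtain ⟨M₁, h₁⟩ := hp
    refine ⟨max M₁ (v.2 + 1), fun M hM => ?_⟩
    rw [map_mul, Polynomial.derivative_mul, h₁ M (le_of_max_le_left hM), sum_mul]
    have h2 : shiftU Q (MvPolynomial.X v) = Polynomial.C (pw v.2) +
        Polynomial.C (MvPolynomial.C (Q ^ (v.2 + 1) - 1)) * Polynomial.X ^ (v.2 + 1) := by
      rw [shiftU, pev_X]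
    have h3 : ∀ r, MvPolynomial.pderiv (0, r) (p * MvPolynomial.X v) =
        MvPolynomial.pderiv (0, r) p * MvPolynomial.X v + if r = v.2 then p else 0 := by
      intro r
      rw [Derivation.leibniz, X_eq_pw]
      by_cases hr : r = v.2
      · rw [if_pos hr, hr, pw, MvPolynomial.pderiv_X_self]
        simp only [smul_eq_mul]
        ring
      · rw [if_neg hr, pw, MvPolynomial.pderiv_X_of_ne (by simpa using Ne.symm hr)]
        simp only [smul_eq_mul]
        ring
    have h4 : Polynomial.derivative (shiftU Q (MvPolynomial.X v)) =
        Polynomial.C (MvPolynomial.C (((v.2 : Kqt) + 1) * (Q ^ (v.2 + 1) - 1))) *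
          Polynomial.X ^ v.2 := by
      rw [h2, map_add, Polynomial.derivative_C, zero_add, Polynomial.derivative_C_mul_X_pow,
        Nat.add_sub_cancel]
      congr 2
      rw [mul_comm ((v.2 : Kqt) + 1), map_mul]
      congr 1
    have h5 : ∀ a r, a * shiftU Q (MvPolynomial.pderiv (0, r) (p * MvPolynomial.X v)) =
        a * shiftU Q (MvPolynomial.pderiv (0, r) p) * shiftU Q (MvPolynomial.X v) +
          a * shiftU Q (if r = v.2 then p else 0) := by
      intro a r
      rw [h3, map_add (shiftU Q), map_mul (shiftU Q), mul_add, mul_assoc]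
    simp only [h5]
    rw [sum_add_distrib]
    refine congrArg₂ (· + ·) rfl ?_
    rw [sum_eq_single v.2, h4, if_pos rfl, mul_comm]
    · intro r _ hr
      rw [if_neg hr, map_zero, mul_zero]
    · intro h
      simp only [mem_range, not_lt] at h
      have := le_of_max_le_right hM
      omega

theorem coeff_succ_shiftU (Q : Kqt) (f : MSym 1) (m : ℕ) :
    (shiftU Q f).coeff (m + 1) * ((m : MSym 1) + 1) = ∑ r ∈ range (m + 1),
      ((r + 1) * (Q ^ (r + 1) - 1)) •
        (shiftU Q (MvPolynomial.pderiv (0, r) f)).coeff (m - r) := by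
  obtain ⟨M₀, h⟩ := derivative_shiftU Q f
  rw [← Polynomial.coeff_derivative, h (max M₀ (m + 1)) (le_max_left _ _),
    Polynomial.finsetSum_coeff, range_eq_Ico,
    ← sum_Ico_consecutive _ (Nat.zero_le (m + 1)) (le_max_right M₀ (m + 1)), ← range_eq_Ico]
  rw [sum_eq_zero (s := Ico _ _), add_zero]
  · refine sum_congr rfl fun r hr => ?_
    rw [mul_assoc, Polynomial.coeff_C_mul, Polynomial.coeff_X_pow_mul', if_pos
      (Nat.lt_succ_iff.mp (mem_range.mp hr)), MvPolynomial.C_mul']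
  · intro r hr
    rw [mem_Ico] at hr
    rw [mul_assoc, Polynomial.coeff_C_mul, Polynomial.coeff_X_pow_mul', if_neg (by omega), mul_zero]

/-- The norms `k (1 - Q ^ k) / (1 - T ^ k)` of the power sums. -/
def macNorm {n : ℕ} (Q T : Kqt) (v : Fin n × ℕ) : Kqt :=
  (v.2 + 1) * ((1 - Q ^ (v.2 + 1)) / (1 - T ^ (v.2 + 1)))

/-- Newton's recursion for `h_m` and the recursion `coeff_succ_shiftU` for the shift are adjoint to
each other. The constants match because `(1 - T^{-k}) / (1 - T^k) = -T^{-k}`, which explains the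
choice `τ = T⁻¹`. -/
theorem fock_hseq_mul {Q T : Kqt} (hT0 : T ≠ 0) (hT : ∀ k, T ^ (k + 1) ≠ 1) (m : ℕ) :
    ∀ f h : MSym 1, fock (macNorm Q T) (hseq T⁻¹ pw m * f) h =
      T⁻¹ ^ m * fock (macNorm Q T) f ((shiftU Q h).coeff m) := by
  induction m using Nat.strong_induction_on with
  | _ m ih =>
    intro f h
    cases m with
    | zero =>
      have h0 : (shiftU Q h).coeff 0 = h := by
        have : (Polynomial.constantCoeff.comp (shiftU Q : MSym 1 →+* Polynomial (MSym 1))) =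
            RingHom.id _ := by
          refine MSym.ringHom_ext (fun a => ?_) (fun a => rfl) fun r => ?_
          · simp [shiftU, Polynomial.algebraMap_apply]
          · simp [shiftU, pev_X]
        exact congrArg (fun φ => φ h) this
      rw [h0, hseq, one_mul, pow_zero, one_mul]
    | succ m =>
      have hm : ((m : Kqt) + 1) ≠ 0 := Nat.cast_add_one_ne_zero m
      apply mul_left_cancel₀ hm
      have e1 : ((m : Kqt) + 1) * fock (macNorm Q T) (hseq T⁻¹ pw (m + 1) * f) h =
          fock (macNorm Q T) ((hseq T⁻¹ pw (m + 1) * ((m : MSym 1) + 1)) * f) h := by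
        rw [← fock_C_mul]
        congr 2
        simp
        ring
      have e2 : ((m : Kqt) + 1) * (T⁻¹ ^ (m + 1) *
          fock (macNorm Q T) f ((shiftU Q h).coeff (m + 1))) = T⁻¹ ^ (m + 1) *
          fock (macNorm Q T) f ((shiftU Q h).coeff (m + 1) * ((m : MSym 1) + 1)) := by
        rw [mul_left_comm, ← smul_eq_mul ((m : Kqt) + 1), ← map_smul, MvPolynomial.smul_eq_C_mul]
        congr 2
        simp
        ring
      rw [e1, e2, hseq_succ, coeff_succ_shiftU, sum_mul, map_sum, LinearMap.sum_apply, map_sum,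
        mul_sum]
      refine sum_congr rfl fun r hr => ?_
      have hr' : r ≤ m := Nat.lt_succ_iff.mp (mem_range.mp hr)
      rw [MvPolynomial.smul_eq_C_mul, mul_assoc, mul_assoc, fock_C_mul, pw, fock_X_mul,
        ih _ (by omega), map_smul, smul_eq_mul, ← mul_assoc, ← mul_assoc, ← mul_assoc]
      congr 1
      have hp : T⁻¹ ^ (m + 1) = T⁻¹ ^ (m - r) * T⁻¹ ^ (r + 1) := by
        rw [← pow_add]; congr 1; omega
      rw [macNorm, hp, inv_pow T (r + 1)]
      simp only
      have h1 := pow_ne_zero (r + 1) hT0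
      have h2 : 1 - T ^ (r + 1) ≠ 0 := sub_ne_zero.mpr (hT r).symm
      generalize T ^ (r + 1) = y at *
      field_simp
      ring

/-- Writing `A_m` for the coefficient of `u ^ m` in the shift, both sides equal `∑ T^{-m} ⟨A_m f,
A_m h⟩`, which is symmetric in `f` and `h`. -/
theorem fock_macOp {Q T : Kqt} (hT0 : T ≠ 0) (hT : ∀ k, T ^ (k + 1) ≠ 1) (f h : MSym 1) :
    fock (macNorm Q T) (macOp Q T⁻¹ f) h = fock (macNorm Q T) f (macOp Q T⁻¹ h) := by
  obtain ⟨M, hM, hM'⟩ : ∃ M, (shiftU Q f).natDegree < M ∧ (shiftU Q h).natDegree < M :=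
    ⟨_, Nat.lt_succ_of_le (le_max_left _ _), Nat.lt_succ_of_le (le_max_right _ _)⟩
  rw [fock_symm _ f, macOp_eq_sum _ _ f M hM, macOp_eq_sum _ _ h M hM', map_sum, map_sum,
    LinearMap.sum_apply, LinearMap.sum_apply]
  refine sum_congr rfl fun m _ => ?_
  rw [fock_hseq_mul hT0 hT, fock_hseq_mul hT0 hT, fock_symm]

/-! ### Homogeneity -/

/-- The scaling of all variables by `c`. -/
def scaleHom (n : ℕ) (c : Kqt) : MSym n →ₐ[Kqt] MSym n :=
  MvPolynomial.aeval fun v => MvPolynomial.C (c ^ (v.2 + 1)) * MvPolynomial.X v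

theorem scaleHom_pw (c : Kqt) (r : ℕ) : scaleHom 1 c (pw r) = MvPolynomial.C c ^ (r + 1) * pw r := by
  simp [scaleHom]

/-- The operator preserves the degree: extracting the coefficient of `u ^ m` lowers it by `m` and
`h_m` restores it. -/
theorem macOp_scaleHom (Q τ c : Kqt) (f : MSym 1) :
    macOp Q τ (scaleHom 1 c f) = scaleHom 1 c (macOp Q τ f) := by
  have h1 : shiftU Q (scaleHom 1 c f) = ((shiftU Q f).map
      (scaleHom 1 c : MSym 1 →+* MSym 1)).comp
        (Polynomial.C (MvPolynomial.C c) * Polynomial.X) := by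
    have : (shiftU Q : MSym 1 →+* Polynomial (MSym 1)).comp (scaleHom 1 c : MSym 1 →+* MSym 1) =
        (Polynomial.compRingHom (Polynomial.C (MvPolynomial.C c) * Polynomial.X)).comp
          ((Polynomial.mapRingHom (scaleHom 1 c : MSym 1 →+* MSym 1)).comp
            (shiftU Q : MSym 1 →+* Polynomial (MSym 1))) := by
      refine MSym.ringHom_ext (fun a => ?_) (fun a => ?_) fun r => ?_
      · simp only [RingHom.comp_apply, RingHom.coe_coe, AlgHom.commutes]
      · simp [Polynomial.algebraMap_apply]
      · simp [scaleHom, shiftU, pev_X, Polynomial.algebraMap_apply]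
        ring
    exact congrArg (fun φ => φ f) this
  obtain ⟨M, hM, hM'⟩ : ∃ M, (shiftU Q f).natDegree < M ∧
      (shiftU Q (scaleHom 1 c f)).natDegree < M :=
    ⟨_, Nat.lt_succ_of_le (le_max_left _ _), Nat.lt_succ_of_le (le_max_right _ _)⟩
  rw [macOp_eq_sum _ _ f M hM, macOp_eq_sum _ _ _ M hM', map_sum]
  refine sum_congr rfl fun m _ => ?_
  rw [map_mul, map_hseq, h1, Polynomial.comp_C_mul_X_coeff, Polynomial.coeff_map]
  simp only [scaleHom_pw]
  rw [hseq_scale, RingHom.coe_coe]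
  ring

/-! ### Degrees in finitely many variables and coefficients -/

/-- The power series all of whose monomials lie in a given submonoid. -/
def supportedSubalgebra {σ : Type*} (S : AddSubmonoid (σ →₀ ℕ)) :
    Subalgebra Kqt (MvPowerSeries σ Kqt) where
  carrier := {g | ∀ d, MvPowerSeries.coeff d g ≠ 0 → d ∈ S}
  mul_mem' := by
    classical
    intro f g hf hg d hd
    rw [MvPowerSeries.coeff_mul] at hd
    obtain ⟨p, hp, hne⟩ := exists_ne_zero_of_sum_ne_zero hd
    rw [← HasAntidiagonal.mem_antidiagonal.mp hp]
    exact S.add_mem (hf _ (left_ne_zero_of_mul hne)) (hg _ (right_ne_zero_of_mul hne))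
  add_mem' := by
    intro f g hf hg d hd
    by_cases h : MvPowerSeries.coeff d f = 0
    · rw [map_add, h, zero_add] at hd
      exact hg d hd
    · exact hf d h
  algebraMap_mem' := by
    classical
    intro a d hd
    rw [MvPowerSeries.algebraMap_apply, MvPowerSeries.coeff_C, ite_ne_right_iff] at hd
    rw [hd.1]
    exact S.zero_mem

theorem pev_mem {σ : Type*} {S : AddSubmonoid (σ →₀ ℕ)} {c : ℕ → MvPowerSeries σ Kqt}
    (hc : ∀ r, c r ∈ supportedSubalgebra S) (f : MSym 1) : pev c f ∈ supportedSubalgebra S := by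
  induction f using MvPolynomial.induction_on with
  | C a => rw [pev_C]; exact Subalgebra.algebraMap_mem _ a
  | add p q hp hq => rw [map_add]; exact Subalgebra.add_mem _ hp hq
  | mul_X p v hp => rw [map_mul, pev_X]; exact Subalgebra.mul_mem _ hp (hc _)

/-- The exponents in which none of the given variables occurs. -/
def avoiding {σ ι : Type*} (v : ι → σ) : AddSubmonoid (σ →₀ ℕ) where
  carrier := {d | ∀ b, d (v b) = 0}
  zero_mem' := fun _ => rfl
  add_mem' := fun {d e} hd he b => by rw [Finsupp.add_apply, hd b, he b]

/-- The series `c r` do not involve the variables `v b`, so the part of a monomial in these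
variables can only come from the letters. -/
theorem coeff_eval₂_letters {σ : Type*} {j : ℕ} (v : Fin j → σ) (hv : Function.Injective v)
    {c : ℕ → MvPowerSeries σ Kqt} (hc : ∀ r, c r ∈ supportedSubalgebra (avoiding v))
    (p : LSym j) (α : Fin j →₀ ℕ) {β : σ →₀ ℕ} (hβ : β ∈ avoiding v) :
    MvPowerSeries.coeff (α.mapDomain v + β)
      (p.eval₂ (pev c : MSym 1 →+* MvPowerSeries σ Kqt) fun b => MvPowerSeries.X (v b)) =
      MvPowerSeries.coeff β (pev c (p.coeff α)) := by
  classical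
  induction p using MvPolynomial.induction_on' with
  | add p q hp hq =>
    rw [MvPolynomial.eval₂_add, map_add, hp, hq, MvPolynomial.coeff_add, map_add, map_add]
  | monomial γ a =>
    have h1 : (γ.prod fun b m => (MvPowerSeries.X (v b) : MvPowerSeries σ Kqt) ^ m) =
        MvPowerSeries.monomial (γ.mapDomain v) 1 := by
      induction γ using Finsupp.induction_linear with
      | zero => simp
      | add x y hx hy =>
        rw [Finsupp.prod_add_index' (by simp) (by simp [pow_add]), hx, hy,
          MvPowerSeries.monomial_mul_monomial, Finsupp.mapDomain_add, mul_one]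
      | single b m =>
        rw [Finsupp.prod_single_index (by simp), Finsupp.mapDomain_single,
          MvPowerSeries.X_pow_eq]
    rw [MvPolynomial.eval₂_monomial, h1, mul_comm, MvPowerSeries.coeff_monomial_mul, one_mul,
      MvPolynomial.coeff_monomial]
    by_cases h : γ = α
    · subst h
      rw [if_pos le_self_add, if_pos rfl, add_tsub_cancel_left]
      rfl
    · rw [if_neg h, map_zero, map_zero]
      split_ifs with hle
      · by_contra hne
        have h2 := pev_mem hc a _ hne
        apply h
        ext b
        have h3 := h2 b
        have h4 := hle (v b)
        rw [Finsupp.tsub_apply] at h3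
        rw [Finsupp.add_apply, Finsupp.mapDomain_apply hv, Finsupp.mapDomain_apply hv, hβ b] at *
        omega
      · rfl

/-! ### Degrees in the added letters -/

theorem degree_eq_of_isHomogeneous {σ R : Type*} [CommSemiring R] {p : MvPolynomial σ R} {r : ℕ}
    (hp : p.IsHomogeneous r) {α : σ →₀ ℕ} (hα : p.coeff α ≠ 0) : α.degree = r := by
  rw [Finsupp.degree_eq_weight_one]
  exact hp hα

theorem isHomogeneous_coeff_addLetters {j : ℕ} (f : MSym 1) :
    ∀ r, ((addLetters j f).coeff r).IsHomogeneous r := by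
  have hmul : ∀ y z : Polynomial (LSym j), (∀ r, (y.coeff r).IsHomogeneous r) →
      (∀ r, (z.coeff r).IsHomogeneous r) → ∀ r, ((y * z).coeff r).IsHomogeneous r := by
    intro y z hy hz r
    rw [Polynomial.coeff_mul]
    refine MvPolynomial.IsHomogeneous.sum _ _ _ fun p hp => ?_
    rw [← HasAntidiagonal.mem_antidiagonal.mp hp]
    exact (hy _).mul (hz _)
  have hC : ∀ (a : MSym 1) (r : ℕ),
      ((Polynomial.C (MvPolynomial.C a) : Polynomial (LSym j)).coeff r).IsHomogeneous r := by
    intro a r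
    rw [Polynomial.coeff_C]
    split_ifs with h
    · rw [h]; exact MvPolynomial.isHomogeneous_C _ _
    · exact MvPolynomial.isHomogeneous_zero _ _ _
  induction f using MvPolynomial.induction_on with
  | C a => rw [addLetters, pev_C]; exact hC _
  | add p q hp hq => intro r; rw [map_add, Polynomial.coeff_add]; exact (hp r).add (hq r)
  | mul_X p v hp =>
    rw [map_mul]
    refine hmul _ _ hp fun r => ?_
    rw [addLetters, pev_X, Polynomial.coeff_add]
    refine (hC _ r).add ?_
    rw [mul_comm, Polynomial.coeff_C_mul, Polynomial.coeff_X_pow]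
    split_ifs with h
    · rw [mul_one, h]
      refine MvPolynomial.IsHomogeneous.sum _ _ _ fun b _ => ?_
      simpa using (MvPolynomial.isHomogeneous_X (MSym 1) b).pow (v.2 + 1)
    · rw [mul_zero]; exact MvPolynomial.isHomogeneous_zero _ _ _

theorem coeff_eval_one_addLetters {j : ℕ} (f : MSym 1) (α : Fin j →₀ ℕ) :
    ((addLetters j f).eval 1).coeff α = ((addLetters j f).coeff α.degree).coeff α := by
  rw [Polynomial.eval_eq_sum_range' (n := (addLetters j f).natDegree + α.degree + 1) (by omega)]
  simp only [one_pow, mul_one]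
  rw [MvPolynomial.coeff_sum, sum_eq_single α.degree]
  · intro r _ hr
    by_contra h
    exact hr (degree_eq_of_isHomogeneous (isHomogeneous_coeff_addLetters f r) h).symm
  · intro h
    exact absurd (mem_range.mpr (by omega)) h

/-- The variable `s` records the total degree in the letters, so setting `s = 1` loses no
information. -/
theorem natDegree_addLetters_le_iff {j D : ℕ} (f : MSym 1) :
    (addLetters j f).natDegree ≤ D ↔
      ∀ α, ((addLetters j f).eval 1).coeff α ≠ 0 → α.degree ≤ D := by
  rw [Polynomial.natDegree_le_iff_coeff_eq_zero]
  constructor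
  · intro h α hα
    by_contra! hlt
    rw [coeff_eval_one_addLetters, h _ hlt] at hα
    exact hα (MvPolynomial.coeff_zero α)
  · intro h r hr
    ext1 α
    by_contra hne
    rw [MvPolynomial.coeff_zero] at hne
    obtain rfl := degree_eq_of_isHomogeneous (isHomogeneous_coeff_addLetters f r) hne
    rw [← coeff_eval_one_addLetters] at hne
    exact absurd (h α hne) (by omega)

/-! ### From added letters to the variables of a series -/

theorem pev_eq_eval₂ {σ : Type*} {j : ℕ} (v : Fin j → σ) (c : ℕ → MvPowerSeries σ Kqt)
    (f : MSym 1) :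
    pev (fun r => c r + ∑ b, MvPowerSeries.X (v b) ^ (r + 1)) f =
      ((addLetters j f).eval 1).eval₂ (pev c : MSym 1 →+* MvPowerSeries σ Kqt)
        fun b => MvPowerSeries.X (v b) := by
  have : (pev (fun r => c r + ∑ b, MvPowerSeries.X (v b) ^ (r + 1)) :
      MSym 1 →+* MvPowerSeries σ Kqt) =
      ((MvPolynomial.eval₂Hom (pev c : MSym 1 →+* MvPowerSeries σ Kqt)
        fun b : Fin j => MvPowerSeries.X (v b)).comp (Polynomial.evalRingHom (1 : LSym j))).comp
          (addLetters j : MSym 1 →+* Polynomial (LSym j)) := by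
    refine MSym.ringHom_ext (fun a => ?_) (fun a => ?_) fun r => ?_
    · simp
    · simp [Polynomial.algebraMap_apply, MvPolynomial.algebraMap_apply]
    · simp [addLetters, pev_X, Polynomial.eval_finsetSum, MvPolynomial.eval₂_sum]
  exact congrArg (fun φ => φ f) this

/-- The part of the power sum `p_k(x⁽ⁱ⁾)` in which the first `j` variables are omitted. -/
def tailSeries (n : ℕ) (i : Fin n) (j k : ℕ) : MvPowerSeries (Fin n × ℕ) Kqt :=
  open Classical in
  fun d => if ∃ l : ℕ, d = Finsupp.single (i, l + j) k then 1 else 0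

theorem coeff_tailSeries (n : ℕ) (i : Fin n) (j k : ℕ) (d : (Fin n × ℕ) →₀ ℕ) :
    MvPowerSeries.coeff d (tailSeries n i j k) =
      open Classical in if ∃ l : ℕ, d = Finsupp.single (i, l + j) k then 1 else 0 := rfl

theorem powerSumSeries_eq (n : ℕ) (i : Fin n) (j r : ℕ) :
    powerSumSeries n i (r + 1) = tailSeries n i j (r + 1) +
      ∑ b : Fin j, MvPowerSeries.X (i, (b : ℕ)) ^ (r + 1) := by
  classical
  ext d
  rw [map_add, map_sum, coeff_powerSumSeries, coeff_tailSeries]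
  simp only [MvPowerSeries.coeff_X_pow]
  have hinj : ∀ a b : ℕ, Finsupp.single (i, a) (r + 1) = Finsupp.single (i, b) (r + 1) →
      a = b := fun a b h => by
    simpa using (Finsupp.single_left_injective (Nat.succ_ne_zero r) h)
  by_cases h : ∃ l, d = Finsupp.single (i, l) (r + 1)
  · obtain ⟨l, rfl⟩ := h
    rw [if_pos ⟨l, rfl⟩]
    rcases lt_or_ge l j with hl | hl
    · rw [if_neg, sum_eq_single ⟨l, hl⟩, if_pos rfl, zero_add]
      · intro b _ hb
        rw [if_neg]
        intro h
        exact hb (Fin.ext (hinj _ _ h).symm)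
      · simp
      · rintro ⟨l', h⟩
        have := hinj _ _ h
        omega
    · rw [if_pos ⟨l - j, by rw [Nat.sub_add_cancel hl]⟩, sum_eq_zero, add_zero]
      intro b _
      rw [if_neg]
      intro h
      have := hinj _ _ h
      have := b.2
      omega
  · rw [if_neg h, if_neg, sum_eq_zero, add_zero]
    · intro b _
      rw [if_neg]
      intro h'
      exact h ⟨_, h'⟩
    · rintro ⟨l, h'⟩
      exact h ⟨_, h'⟩

theorem tailSeries_mem (n : ℕ) (i : Fin n) (j k : ℕ) : tailSeries n i j k ∈
    supportedSubalgebra (avoiding fun b : Fin j => (i, (b : ℕ))) := by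
  intro d hd b
  have : ∃ l : ℕ, d = Finsupp.single (i, l + j) k := by
    by_contra h
    exact hd (if_neg h)
  obtain ⟨l, rfl⟩ := this
  rw [Finsupp.single_apply, if_neg]
  intro h
  have h1 : l + j = (b : ℕ) := congrArg Prod.snd h
  have := b.2
  omega

/-- The shift of the variables of a single alphabet. -/
def shiftEmb (j : ℕ) : Fin 1 × ℕ ↪ Fin 1 × ℕ :=
  ⟨fun v => (v.1, v.2 + j), fun v w h => by
    simp only [Prod.mk.injEq, Nat.add_right_cancel_iff] at h
    exact Prod.ext h.1 h.2⟩

/-- An infinite alphabet without its first `j` variables is a copy of the whole alphabet. -/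
theorem coeff_pev_tailSeries (j : ℕ) (f : MSym 1) (d : (Fin 1 × ℕ) →₀ ℕ) :
    MvPowerSeries.coeff (d.embDomain (shiftEmb j)) (pev (fun r => tailSeries 1 0 j (r + 1)) f) =
      MvPowerSeries.coeff d (toSeries 1 f) := by
  have h : (MvPowerSeries.killCompl (shiftEmb j)).comp (pev fun r => tailSeries 1 0 j (r + 1)) =
      toSeries 1 := by
    refine MvPolynomial.algHom_ext fun v => MvPowerSeries.ext fun d => ?_
    rw [AlgHom.comp_apply, MvPowerSeries.coeff_killCompl, toSeries_X, pev_X,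
      coeff_powerSumSeries, coeff_tailSeries, Fin.eq_zero v.1]
    congr 1
    refine propext ⟨?_, ?_⟩
    · rintro ⟨l, hl⟩
      refine ⟨l, Finsupp.embDomain_injective (shiftEmb j) ?_⟩
      rw [hl, Finsupp.embDomain_single]
      rfl
    · rintro ⟨l, rfl⟩
      exact ⟨l, by rw [Finsupp.embDomain_single]; rfl⟩
  rw [← MvPowerSeries.coeff_killCompl, ← AlgHom.comp_apply, h]

theorem toSeries_one_eq_pev (f : MSym 1) :
    toSeries 1 f = pev (fun r => powerSumSeries 1 0 (r + 1)) f := by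
  have : toSeries 1 = pev fun r => powerSumSeries 1 0 (r + 1) :=
    MvPolynomial.algHom_ext fun v => by rw [toSeries_X, pev_X, Fin.eq_zero v.1]
  rw [this]

theorem embDomain_shiftEmb_mem (j : ℕ) (d : (Fin 1 × ℕ) →₀ ℕ) :
    d.embDomain (shiftEmb j) ∈ avoiding fun b : Fin j => ((0 : Fin 1), (b : ℕ)) := by
  intro b
  refine Finsupp.embDomain_of_notMem_range _ _ _ ?_
  rintro ⟨w, hw⟩
  have h1 : w.2 + j = (b : ℕ) := congrArg Prod.snd hw
  have := b.2
  omega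

theorem coeff_toSeries_letters (j : ℕ) (f : MSym 1) (α : Fin j →₀ ℕ) (d : (Fin 1 × ℕ) →₀ ℕ) :
    MvPowerSeries.coeff (α.mapDomain (fun b : Fin j => ((0 : Fin 1), (b : ℕ))) +
      d.embDomain (shiftEmb j)) (toSeries 1 f) =
      MvPowerSeries.coeff d (toSeries 1 (((addLetters j f).eval 1).coeff α)) := by
  have h1 : (fun r => powerSumSeries 1 0 (r + 1)) = fun r => tailSeries 1 0 j (r + 1) +
      ∑ b : Fin j, MvPowerSeries.X ((0 : Fin 1), (b : ℕ)) ^ (r + 1) :=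
    funext fun r => powerSumSeries_eq 1 0 j r
  rw [toSeries_one_eq_pev, h1, pev_eq_eval₂ (fun b : Fin j => ((0 : Fin 1), (b : ℕ))),
    coeff_eval₂_letters _ (fun a b h => Fin.ext (congrArg Prod.snd h))
      (fun r => tailSeries_mem 1 0 j (r + 1)) _ _ (embDomain_shiftEmb_mem j d),
    coeff_pev_tailSeries]

theorem exists_letters_decomposition {σ : Type*} {j : ℕ} {v : Fin j → σ}
    (hv : Function.Injective v) (d : σ →₀ ℕ) :
    ∃ (α : Fin j →₀ ℕ) (β : σ →₀ ℕ), β ∈ avoiding v ∧ d = α.mapDomain v + β ∧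
      α.degree = ∑ b, d (v b) := by
  classical
  refine ⟨d.comapDomain v hv.injOn, d.filter (fun x => x ∉ Set.range v), ?_, ?_, ?_⟩
  · intro b
    rw [Finsupp.filter_apply_neg]
    simp
  · ext x
    rw [Finsupp.add_apply]
    by_cases hx : x ∈ Set.range v
    · obtain ⟨b, rfl⟩ := hx
      rw [Finsupp.mapDomain_apply hv, Finsupp.filter_apply_neg _ _ (by simp),
        Finsupp.comapDomain_apply, add_zero]
    · rw [Finsupp.mapDomain_of_notMem_range _ _ hx,
        Finsupp.filter_apply_pos (fun x => x ∉ Set.range v) _ hx, zero_add]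
  · rw [Finsupp.degree_eq_sum]
    rfl

/-- Bounds for the degrees of the monomials of a symmetric function in a plethystic alphabet. -/
theorem sum_le_of_natDegree_le {σ : Type*} {j D : ℕ} {v : Fin j → σ}
    (hv : Function.Injective v) {c : ℕ → MvPowerSeries σ Kqt}
    (hc : ∀ r, c r - ∑ b, MvPowerSeries.X (v b) ^ (r + 1) ∈ supportedSubalgebra (avoiding v))
    {f : MSym 1} (hf : (addLetters j f).natDegree ≤ D) {d : σ →₀ ℕ}
    (hd : MvPowerSeries.coeff d (pev c f) ≠ 0) : ∑ b, d (v b) ≤ D := by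
  obtain ⟨α, β, hβ, rfl, hα⟩ := exists_letters_decomposition hv d
  rw [← hα]
  rw [show c = fun r => (c r - ∑ b, MvPowerSeries.X (v b) ^ (r + 1)) +
    ∑ b, MvPowerSeries.X (v b) ^ (r + 1) from funext fun r => by rw [sub_add_cancel],
    pev_eq_eval₂ v, coeff_eval₂_letters v hv hc _ _ hβ] at hd
  refine (natDegree_addLetters_le_iff f).mp hf α fun h => hd ?_
  rw [h, map_zero, map_zero]

/-- With `sum_range_le_of_natDegree_le` this translates bounds for exponents in the first `j`
variables into bounds for the degree in `s`, and back. Dominance is such a bound for every `j`. -/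
theorem natDegree_addLetters_le {j D : ℕ} {f : MSym 1}
    (hf : ∀ d, MvPowerSeries.coeff d (toSeries 1 f) ≠ 0 → ∑ r ∈ range j, d (0, r) ≤ D) :
    (addLetters j f).natDegree ≤ D := by
  rw [natDegree_addLetters_le_iff]
  intro α hα
  have h1 : toSeries 1 (((addLetters j f).eval 1).coeff α) ≠ 0 := fun h =>
    hα (toSeries_injective 1 (by rw [h, map_zero]))
  obtain ⟨d, hd⟩ := (MvPowerSeries.ne_zero_iff_exists_coeff_ne_zero _).mp h1
  rw [← coeff_toSeries_letters] at hd
  have h2 := hf _ hd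
  rw [sum_range] at h2
  rw [Finsupp.degree_eq_sum]
  refine le_trans (le_of_eq (sum_congr rfl fun b _ => ?_)) h2
  rw [Finsupp.add_apply, embDomain_shiftEmb_mem j d b, add_zero]
  exact (Finsupp.mapDomain_apply (f := fun b : Fin j => ((0 : Fin 1), (b : ℕ)))
    (fun a b h => Fin.ext (congrArg Prod.snd h)) α b).symm

theorem sum_range_le_of_natDegree_le {j D : ℕ} {f : MSym 1}
    (hf : (addLetters j f).natDegree ≤ D) {d : (Fin 1 × ℕ) →₀ ℕ}
    (hd : MvPowerSeries.coeff d (toSeries 1 f) ≠ 0) : ∑ r ∈ range j, d (0, r) ≤ D := by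
  rw [toSeries_one_eq_pev] at hd
  rw [sum_range]
  refine sum_le_of_natDegree_le (v := fun b : Fin j => ((0 : Fin 1), (b : ℕ)))
    (fun a b h => Fin.ext (congrArg Prod.snd h)) (fun r => ?_) hf hd
  rw [powerSumSeries_eq 1 0 j r, add_sub_cancel_right]
  exact tailSeries_mem 1 0 j (r + 1)

/-- The coefficients of the expansion with respect to a single letter. -/
theorem coeff_toSeries_letter (f : MSym 1) (a : ℕ) (d : (Fin 1 × ℕ) →₀ ℕ) :
    MvPowerSeries.coeff (Finsupp.single (0, 0) a + d.embDomain (shiftEmb 1)) (toSeries 1 f) =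
      MvPowerSeries.coeff d (toSeries 1 ((addLetter f).coeff a)) := by
  have h1 : addLetter f = (addLetters 1 f).map (MvPolynomial.eval₂Hom (RingHom.id (MSym 1))
      fun _ => (1 : MSym 1)) := by
    have : (addLetter : MSym 1 →+* Polynomial (MSym 1)) = (Polynomial.mapRingHom
        (MvPolynomial.eval₂Hom (RingHom.id (MSym 1)) fun _ : Fin 1 => (1 : MSym 1))).comp
          (addLetters 1 : MSym 1 →+* Polynomial (LSym 1)) := by
      refine MSym.ringHom_ext (fun a => ?_) (fun a => ?_) fun r => ?_
      · simp
      · simp [Polynomial.algebraMap_apply, MvPolynomial.algebraMap_apply]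
      · simp [addLetters, addLetter, pev_X]
    exact congrArg (fun φ => φ f) this
  have h2 : ((addLetters 1 f).eval 1).coeff (Finsupp.single 0 a) = (addLetter f).coeff a := by
    rw [coeff_eval_one_addLetters, h1, Polynomial.coeff_map, Finsupp.degree_single]
    have h3 := isHomogeneous_coeff_addLetters (j := 1) f a
    generalize (addLetters 1 f).coeff a = p at h3
    -- A homogeneous polynomial in a single letter is a monomial.
    have h4 : p = MvPolynomial.monomial (Finsupp.single 0 a) (p.coeff (Finsupp.single 0 a)) := by
      ext1 α
      rw [MvPolynomial.coeff_monomial]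
      split_ifs with h
      · rw [h]
      · by_contra hne
        have := degree_eq_of_isHomogeneous h3 hne
        apply h
        refine Finsupp.ext fun b => ?_
        rw [Fin.eq_zero b, Finsupp.single_eq_same, ← this, Finsupp.degree_eq_sum]
        simp
    conv_rhs => rw [h4]
    simp [MvPolynomial.eval₂_monomial]
  rw [← h2, ← coeff_toSeries_letters, Finsupp.mapDomain_single]
  rfl

end Plethysm

/-! ### Triangular families -/

section Triangular

variable {ι V : Type*} [AddCommGroup V] [Module Kqt V] {r : ι → ι → Prop}

/-- On the span `S` of the lower vectors, `T = E - e a` is triangular with non-zero diagonal entries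
`e b - e a`, hence maps `S` onto itself. So the defect `T (M a)`, which lies in `S`, can be removed
by subtracting an element of `S`. -/
theorem exists_eigenvector (M : ι → V) (E : V →ₗ[Kqt] V) (wf : WellFounded r)
    (htrans : ∀ a b c, r a b → r b c → r a c) (e : ι → Kqt)
    (he : ∀ a b, r a b → e a ≠ e b)
    (hE : ∀ a, E (M a) - e a • M a ∈ Submodule.span Kqt (M '' {b | r b a})) (a : ι) :
    ∃ P, P - M a ∈ Submodule.span Kqt (M '' {b | r b a}) ∧ E P = e a • P := by
  set S := Submodule.span Kqt (M '' {b | r b a}) with hS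
  set T : V →ₗ[Kqt] V := E - e a • LinearMap.id with hT
  have hTx : ∀ x, T x = E x - e a • x := fun x => by simp [hT]
  have key : ∀ b, r b a → M b ∈ S.map T := by
    intro b
    induction b using wf.induction with
    | _ b ih =>
      intro hb
      have hsub : Submodule.span Kqt (M '' {c | r c b}) ≤ S.map T := by
        rw [Submodule.span_le]
        rintro _ ⟨c, hc, rfl⟩
        exact ih c hc (htrans c b a hc hb)
      have h1 : T (M b) ∈ S.map T :=
        Submodule.mem_map_of_mem (Submodule.subset_span ⟨b, hb, rfl⟩)
      have h2 : M b = (e b - e a)⁻¹ • (T (M b) - (E (M b) - e b • M b)) := by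
        rw [hTx, sub_sub_sub_cancel_left, ← sub_smul, inv_smul_smul₀ (sub_ne_zero.mpr (he b a hb))]
      rw [h2]
      exact Submodule.smul_mem _ _ (Submodule.sub_mem _ h1 (hsub (hE b)))
  have h3 : T (M a) ∈ S.map T := by
    have : S ≤ S.map T := by
      rw [hS, Submodule.span_le]
      rintro _ ⟨b, hb, rfl⟩
      exact key b hb
    rw [hTx]
    exact this (hE a)
  obtain ⟨z, hz, hz'⟩ := h3
  refine ⟨M a - z, ?_, ?_⟩
  · rw [sub_sub_cancel_left]
    exact Submodule.neg_mem _ hz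
  · rw [← sub_eq_zero, ← hTx, map_sub, hz', sub_self]

/-- A unitriangular change of family is inverted by well-founded induction, inside any set of
indices closed downwards. -/
theorem span_triangular_le {M P : ι → V} (wf : WellFounded r)
    (hP : ∀ a, P a - M a ∈ Submodule.span Kqt (M '' {b | r b a})) (S : Set ι)
    (hS : ∀ a b, b ∈ S → r a b → a ∈ S) :
    Submodule.span Kqt (M '' S) ≤ Submodule.span Kqt (P '' S) := by
  have key : ∀ b, b ∈ S → M b ∈ Submodule.span Kqt (P '' S) := by
    intro b
    induction b using wf.induction with
    | _ b ih =>
      intro hb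
      have hsub : Submodule.span Kqt (M '' {c | r c b}) ≤ Submodule.span Kqt (P '' S) := by
        rw [Submodule.span_le]
        rintro _ ⟨c, hc, rfl⟩
        exact ih c hc (hS c b hb hc)
      rw [← sub_sub_cancel (P b) (M b)]
      exact Submodule.sub_mem _ (Submodule.subset_span ⟨b, hb, rfl⟩) (hsub (hP b))
  rw [Submodule.span_le]
  rintro _ ⟨b, hb, rfl⟩
  exact key b hb

theorem eq_zero_of_mem_span_of_orthogonal {B : LinearMap.BilinForm Kqt V} {P : ι → V}
    (horth : ∀ a b, a ≠ b → B (P a) (P b) = 0) (hnorm : ∀ a, B (P a) (P a) ≠ 0) (S : Set ι)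
    {x : V} (hx : x ∈ Submodule.span Kqt (P '' S)) (h : ∀ a ∈ S, B x (P a) = 0) : x = 0 := by
  obtain ⟨l, hl, rfl⟩ := (Finsupp.mem_span_image_iff_linearCombination Kqt).mp hx
  have : l = 0 := by
    ext a
    by_contra hne
    have ha : a ∈ S := hl (Finsupp.mem_support_iff.mpr hne)
    have h1 := h a ha
    rw [Finsupp.linearCombination_apply, Finsupp.sum, map_sum, LinearMap.sum_apply,
      sum_eq_single a] at h1
    · rw [map_smul, LinearMap.smul_apply, smul_eq_mul] at h1
      exact (mul_ne_zero hne (hnorm a)) h1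
    · intro b _ hb
      rw [map_smul, LinearMap.smul_apply, horth b a hb, smul_zero]
    · intro h2
      exact absurd (Finsupp.mem_support_iff.mpr hne) h2
  rw [this, map_zero]

/-- By induction the two families agree below `a`. The difference `P' a - P a` lies in the span of
these lower members and is orthogonal to each of them, so it vanishes as their norms are non-zero.
-/
theorem triangular_orthogonal_unique {M P P' : ι → V} (wf : WellFounded r)
    (htrans : ∀ a b c, r a b → r b c → r a c) (hirr : ∀ a, ¬ r a a)
    {B : LinearMap.BilinForm Kqt V}
    (hP : ∀ a, P a - M a ∈ Submodule.span Kqt (M '' {b | r b a}))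
    (hP' : ∀ a, P' a - M a ∈ Submodule.span Kqt (M '' {b | r b a}))
    (horth : ∀ a b, a ≠ b → B (P a) (P b) = 0) (hnorm : ∀ a, B (P a) (P a) ≠ 0)
    (horth' : ∀ a b, a ≠ b → B (P' a) (P' b) = 0) : P' = P := by
  funext a
  induction a using wf.induction with
  | _ a ih =>
    rw [← sub_eq_zero]
    refine eq_zero_of_mem_span_of_orthogonal horth hnorm {b | r b a} ?_ ?_
    · refine span_triangular_le wf hP _ (fun b c hc hb => htrans b c a hb hc) ?_
      rw [← sub_sub_sub_cancel_right (P' a) (P a) (M a)]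
      exact Submodule.sub_mem _ (hP' a) (hP a)
    · intro b hb
      have hne : a ≠ b := by
        rintro rfl
        exact hirr _ hb
      rw [map_sub, LinearMap.sub_apply, horth a b hne, sub_zero, ← ih b hb, horth' a b hne]

end Triangular

/-! ### The dominance order -/

theorem Ptn.size_eq_sum_range (la : Ptn) {J : ℕ} (hJ : ∀ j, J ≤ j → la.1 j = 0) :
    la.size = ∑ r ∈ range J, la.1 r := by
  refine sum_subset (fun j hj => ?_) fun j _ hj => by simpa using hj
  by_contra h
  exact (Finsupp.mem_support_iff.mp hj) (hJ j (by simpa using h))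

theorem exists_bound_toExp {n : ℕ} (la : MPtn n) : ∃ J, ∀ i j, J ≤ j → (la i).1 j = 0 := by
  refine ⟨la.toExp.support.sup Prod.snd + 1, fun i j hj => ?_⟩
  by_contra h
  have := le_sup (f := Prod.snd)
    (Finsupp.mem_support_iff.mpr (by rwa [toExp_apply] : la.toExp (i, j) ≠ 0))
  simp only at this
  omega

theorem degree_toExp {n : ℕ} (la : MPtn n) : la.toExp.degree = ∑ i, (la i).size := by
  rw [MPtn.toExp, map_sum]
  refine sum_congr rfl fun i _ => ?_
  rw [Finsupp.degree_mapDomain]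
  rfl

theorem MPtn.Dom.trans {n : ℕ} {a b c : MPtn n} (h : a.Dom b) (h' : b.Dom c) : a.Dom c :=
  fun k j => (h k j).trans (h' k j)

theorem MPtn.Dom.antisymm {n : ℕ} {a b : MPtn n} (h : a.Dom b) (h' : b.Dom a) : a = b := by
  have h1 : ∀ k j, ∑ i ∈ Iio k, (a i).size + ∑ r ∈ range j, (a k).1 r =
      ∑ i ∈ Iio k, (b i).size + ∑ r ∈ range j, (b k).1 r := fun k j => (h k j).antisymm (h' k j)
  funext k
  refine Subtype.ext (Finsupp.ext fun j => ?_)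
  have h2 := h1 k (j + 1)
  have h3 := h1 k j
  rw [sum_range_succ, sum_range_succ] at h2
  omega

theorem MPtn.Dom.degree_le {n : ℕ} {a b : MPtn n} (h : a.Dom b) :
    a.toExp.degree ≤ b.toExp.degree := by
  rw [degree_toExp, degree_toExp]
  cases n with
  | zero => simp
  | succ n =>
    obtain ⟨J, hJ⟩ := exists_bound_toExp a
    obtain ⟨J', hJ'⟩ := exists_bound_toExp b
    have h1 := h (Fin.last n) (max J J')
    rw [← (a _).size_eq_sum_range fun j hj => hJ _ j (le_of_max_le_left hj),
      ← (b _).size_eq_sum_range fun j hj => hJ' _ j (le_of_max_le_right hj)] at h1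
    have h2 : ∀ f : Fin (n + 1) → ℕ, ∑ i, f i = ∑ i ∈ Iio (Fin.last n), f i + f (Fin.last n) := by
      intro f
      have huniv : (univ : Finset (Fin (n + 1))) = insert (Fin.last n) (Iio (Fin.last n)) := by
        rw [Iio_insert]
        ext i
        simp [Fin.le_last]
      rw [huniv, sum_insert (by simp), add_comm (f _)]
    rw [h2, h2]
    exact h1

/-- The strict dominance order. -/
def MPtn.SDom {n : ℕ} (mu la : MPtn n) : Prop := mu.Dom la ∧ mu ≠ la

theorem MPtn.SDom.trans {n : ℕ} {a b c : MPtn n} (h : a.SDom b) (h' : b.SDom c) : a.SDom c := by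
  refine ⟨h.1.trans h'.1, ?_⟩
  rintro rfl
  exact h.2 (h.1.antisymm h'.1)

/-- Taking `k` last and `j` large in the dominance inequalities bounds the degree, so each element
has finitely many elements below it; their number strictly increases along the order. -/
theorem wellFounded_sDom (n : ℕ) : WellFounded (MPtn.SDom (n := n)) := by
  refine Subrelation.wf (r := InvImage (· < ·) fun la : MPtn n => {nu : MPtn n | nu.Dom la}.ncard)
    ?_ (InvImage.wf _ wellFounded_lt)
  intro mu la h
  refine Set.ncard_lt_ncard ⟨fun nu hnu => hnu.trans h.1, fun hsub => ?_⟩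
    ((finite_degree_toExp_le n la.toExp.degree).subset fun nu hnu => MPtn.Dom.degree_le hnu)
  exact h.2 (h.1.antisymm (hsub (a := la) fun _ _ => le_rfl))

/-- The strict dominance order on multi-partitions of the same degree. -/
def MPtn.HDom {n : ℕ} (mu la : MPtn n) : Prop :=
  mu.SDom la ∧ mu.toExp.degree = la.toExp.degree

theorem wellFounded_hDom (n : ℕ) : WellFounded (MPtn.HDom (n := n)) :=
  Subrelation.wf (fun h => h.1) (wellFounded_sDom n)

theorem MPtn.HDom.trans {n : ℕ} {a b c : MPtn n} (h : a.HDom b) (h' : b.HDom c) : a.HDom c :=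
  ⟨h.1.trans h'.1, h.2.trans h'.2⟩

theorem coeff_toExp_of_triangular {n : ℕ} {la : MPtn n} {f : MSym n} {S : Set (MPtn n)}
    (hf : f - mm la ∈ Submodule.span Kqt (mm '' S)) (hS : la ∉ S) :
    MvPowerSeries.coeff la.toExp (toSeries n f) = 1 := by
  have := coeff_eq_zero_of_mem_span_mm hf hS
  rw [map_sub, map_sub, coeff_mm, if_pos rfl, sub_eq_zero] at this
  exact this

/-- An orthogonal triangular family has non-zero norms if the form is non-degenerate. -/
theorem norm_ne_zero_of_triangular {n : ℕ} {P : MPtn n → MSym n}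
    {B : LinearMap.BilinForm Kqt (MSym n)} (hB : ∀ f, (∀ h, B f h = 0) → f = 0)
    (hP : ∀ a, P a - mm a ∈ Submodule.span Kqt (mm '' {b | b.SDom a}))
    (horth : ∀ a b, a ≠ b → B (P a) (P b) = 0) (a : MPtn n) : B (P a) (P a) ≠ 0 := by
  intro h0
  have hspan : Submodule.span Kqt (Set.range P) = ⊤ := by
    rw [eq_top_iff, ← span_mm_eq_top, ← Set.image_univ, ← Set.image_univ]
    exact span_triangular_le (wellFounded_sDom n) hP _
      fun _ _ _ _ => Set.mem_univ _
  have hz : P a = 0 := by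
    refine hB _ fun h => ?_
    have hh : h ∈ Submodule.span Kqt (Set.range P) := hspan ▸ Submodule.mem_top
    induction hh using Submodule.span_induction with
    | mem x hx =>
      obtain ⟨b, rfl⟩ := hx
      by_cases hab : a = b
      · rw [← hab, h0]
      · exact horth a b hab
    | zero => rw [map_zero]
    | add x y _ _ hx hy => rw [map_add, hx, hy, add_zero]
    | smul c x _ hx => rw [map_smul, hx, smul_zero]
  have h1 := coeff_toExp_of_triangular (hP a) fun h : a.SDom a => h.2 rfl
  rw [hz, map_zero, map_zero] at h1
  exact zero_ne_one h1

/-! ### Homogeneity and change of parameters -/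

theorem ext_coeff_toExp {n : ℕ} {f g : MSym n}
    (h : ∀ la : MPtn n, MvPowerSeries.coeff la.toExp (toSeries n f) =
      MvPowerSeries.coeff la.toExp (toSeries n g)) : f = g := by
  refine toSeries_injective n (MvPowerSeries.ext fun d => ?_)
  obtain ⟨la, σ, rfl⟩ := exists_perm_toExp d
  rw [coeff_toSeries_perm, coeff_toSeries_perm, h]

/-- Scaling `p_k` by `c ^ k` is scaling every variable by `c`. -/
theorem coeff_scaleHom {n : ℕ} (c : Kqt) (f : MSym n) (d : (Fin n × ℕ) →₀ ℕ) :
    MvPowerSeries.coeff d (toSeries n (scaleHom n c f)) =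
      c ^ d.degree * MvPowerSeries.coeff d (toSeries n f) := by
  have h : (toSeries n).comp (scaleHom n c) =
      (MvPowerSeries.rescaleAlgHom fun _ => c).comp (toSeries n) := by
    refine MvPolynomial.algHom_ext fun v => MvPowerSeries.ext fun d => ?_
    rw [AlgHom.comp_apply, AlgHom.comp_apply, MvPowerSeries.rescaleAlgHom_apply,
      MvPowerSeries.coeff_rescale, scaleHom, MvPolynomial.aeval_X, map_mul,
      MvPolynomial.algHom_C, ← Algebra.smul_def, map_smul, toSeries_X, coeff_powerSumSeries]
    split_ifs with hd
    · obtain ⟨j, rfl⟩ := hd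
      rw [Finsupp.prod_single_index (h := fun (_ : Fin n × ℕ) m => c ^ m) (pow_zero c)]
      rfl
    · simp
  have h' := congrArg (fun φ => MvPowerSeries.coeff d (φ f)) h
  simp only [AlgHom.comp_apply, MvPowerSeries.rescaleAlgHom_apply,
    MvPowerSeries.coeff_rescale] at h'
  rw [h', Finsupp.prod, prod_pow_eq_pow_sum, Finsupp.degree_apply]

theorem scaleHom_mm {n : ℕ} (c : Kqt) (la : MPtn n) :
    scaleHom n c (mm la) = c ^ la.toExp.degree • mm la := by
  refine ext_coeff_toExp fun mu => ?_
  rw [coeff_scaleHom, map_smul, map_smul, coeff_mm, smul_eq_mul]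
  split_ifs with h
  · rw [h]
  · simp

theorem scaleHom_of_triangular {n : ℕ} {la : MPtn n} {f : MSym n}
    (hf : f - mm la ∈ Submodule.span Kqt (mm '' {mu | mu.HDom la})) (c : Kqt) :
    scaleHom n c f = c ^ la.toExp.degree • f := by
  have h : ∀ g ∈ Submodule.span Kqt (mm '' {mu : MPtn n | mu.HDom la}),
      scaleHom n c g = c ^ la.toExp.degree • g := by
    intro g hg
    induction hg using Submodule.span_induction with
    | mem x hx =>
      obtain ⟨mu, hmu, rfl⟩ := hx
      rw [scaleHom_mm, hmu.2]
    | zero => rw [map_zero, smul_zero]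
    | add x y _ _ hx hy => rw [map_add, hx, hy, smul_add]
    | smul a x _ hx => rw [map_smul, hx, smul_comm]
  have h' := h _ hf
  rwa [map_sub, scaleHom_mm, smul_sub, sub_left_inj] at h'

theorem coeff_map_toSeries {n : ℕ} (φ : Kqt →+* Kqt) (f : MSym n) (d : (Fin n × ℕ) →₀ ℕ) :
    MvPowerSeries.coeff d (toSeries n (MvPolynomial.map φ f)) =
      φ (MvPowerSeries.coeff d (toSeries n f)) := by
  have h : ((toSeries n : MSym n →+* MvPowerSeries (Fin n × ℕ) Kqt).comp (MvPolynomial.map φ)) =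
      (MvPowerSeries.map φ).comp (toSeries n : MSym n →+* MvPowerSeries (Fin n × ℕ) Kqt) := by
    refine MvPolynomial.ringHom_ext (fun a => ?_) fun v => ?_
    · simp only [RingHom.comp_apply, MvPolynomial.map_C, RingHom.coe_coe, MvPolynomial.algHom_C]
      rw [MvPowerSeries.algebraMap_apply, MvPowerSeries.algebraMap_apply]
      simp
    · refine MvPowerSeries.ext fun d => ?_
      simp only [RingHom.comp_apply, MvPolynomial.map_X, RingHom.coe_coe, toSeries_X,
        MvPowerSeries.coeff_map, coeff_powerSumSeries]
      split_ifs <;> simp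
  have h' := congrArg (fun ψ => MvPowerSeries.coeff d (ψ f)) h
  simpa using h'

/-- A homomorphism of coefficients commutes with the expansion into series, and the coefficients of
`mm la` are `0` and `1`. -/
theorem map_mm {n : ℕ} (φ : Kqt →+* Kqt) (la : MPtn n) : MvPolynomial.map φ (mm la) = mm la := by
  refine ext_coeff_toExp fun mu => ?_
  rw [coeff_map_toSeries, coeff_mm]
  split_ifs <;> simp

theorem map_mem_span_mm {n : ℕ} (φ : Kqt →+* Kqt) {S : Set (MPtn n)} {f : MSym n}
    (hf : f ∈ Submodule.span Kqt (mm '' S)) :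
    MvPolynomial.map φ f ∈ Submodule.span Kqt (mm '' S) := by
  refine mem_span_mm _ S fun la hla => ?_
  by_contra h
  rw [coeff_map_toSeries, coeff_eq_zero_of_mem_span_mm hf h, map_zero] at hla
  exact hla rfl

/-! ### Dominance for the Macdonald operator -/

theorem sum_le_sum_range {f : ℕ → ℕ} (hf : Antitone f) (J : Finset ℕ) :
    ∑ r ∈ J, f r ≤ ∑ r ∈ range #J, f r := by
  induction J using Finset.induction_on_max with
  | empty => simp
  | insert a s h ih =>
    have ha : a ∉ s := fun h' => (h a h').false
    rw [sum_insert ha, card_insert_of_notMem ha, sum_range_succ, add_comm]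
    refine add_le_add ih (hf ?_)
    simpa using card_le_card (fun x hx => mem_range.mpr (h x hx) : s ⊆ range a)

theorem sum_range_le_of_coeff_mm {n : ℕ} {la : MPtn n} {d : (Fin n × ℕ) →₀ ℕ}
    (hd : MvPowerSeries.coeff d (toSeries n (mm la)) ≠ 0) (i : Fin n) (j : ℕ) :
    ∑ r ∈ range j, d (i, r) ≤ ∑ r ∈ range j, (la i).1 r := by
  obtain ⟨mu, σ, rfl⟩ := exists_perm_toExp d
  rw [toSeries_mm, coeff_multiMonomial] at hd
  obtain rfl : la = mu := by
    by_contra h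
    exact hd (if_neg h)
  have h : ∀ r, la.toExp.embDomain (permVar σ).toEmbedding (i, r) = (la i).1 ((σ i).symm r) := by
    intro r
    have h1 : (i, r) = (permVar σ).toEmbedding (i, (σ i).symm r) := by simp
    rw [h1, Finsupp.embDomain_apply_self, toExp_apply]
  simp only [h]
  have hmap := sum_map (range j) (σ i).symm.toEmbedding (la i).1
  simp only [Equiv.coe_toEmbedding] at hmap
  rw [← hmap]
  refine (sum_le_sum_range (la i).2 _).trans ?_
  rw [card_map, card_range]

theorem dom_of_sum_range_le {mu la : MPtn 1}
    (h : ∀ j, ∑ r ∈ range j, (mu 0).1 r ≤ ∑ r ∈ range j, (la 0).1 r) : mu.Dom la := by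
  intro k j
  obtain rfl := Fin.eq_zero k
  have : Iio (0 : Fin 1) = ∅ := by decide
  rw [this, sum_empty, sum_empty, zero_add, zero_add]
  exact h j

/-- For each `j` the degree of `mm la` in the first `j` variables is at most the sum of the first
`j` parts of `la`, and the operator does not raise this degree. -/
theorem dom_of_coeff_macOp_mm {Q τ : Kqt} {la mu : MPtn 1}
    (h : MvPowerSeries.coeff mu.toExp (toSeries 1 (macOp Q τ (mm la))) ≠ 0) : mu.Dom la := by
  refine dom_of_sum_range_le fun j => ?_
  have := sum_range_le_of_natDegree_le (natDegree_addLetters_macOp Q τ j _ _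
    (natDegree_addLetters_le fun d hd => sum_range_le_of_coeff_mm hd 0 j)) h
  simpa only [toExp_apply] using this

theorem degree_eq_of_coeff_macOp_mm {Q τ : Kqt} {la mu : MPtn 1}
    (h : MvPowerSeries.coeff mu.toExp (toSeries 1 (macOp Q τ (mm la))) ≠ 0) :
    mu.toExp.degree = la.toExp.degree := by
  have h1 := coeff_scaleHom 2 (macOp Q τ (mm la)) mu.toExp
  rw [← macOp_scaleHom, scaleHom_mm, map_smul, map_smul, map_smul, smul_eq_mul] at h1
  -- Scaling by `2` detects the degree, since the powers of `2` are distinct.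
  have h2 := mul_right_cancel₀ h h1
  have h3 : (2 : ℕ) ^ la.toExp.degree = 2 ^ mu.toExp.degree := by exact_mod_cast h2
  exact (Nat.pow_right_injective le_rfl h3).symm

/-! ### Eigenvalues of the Macdonald operator -/

/-- The recursion for the eigenvalues of the Macdonald operator. -/
def macEig (Q τ : Kqt) : ℕ → (ℕ → ℕ) → Kqt
  | 0, _ => 1
  | N + 1, l => τ * macEig Q τ N (fun r => l (r + 1)) + (1 - τ) * Q ^ l 0

theorem macEig_eq (Q τ : Kqt) (N : ℕ) : ∀ l : ℕ → ℕ,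
    macEig Q τ N l = τ ^ N + (1 - τ) * ∑ i ∈ range N, τ ^ i * Q ^ l i := by
  induction N with
  | zero => simp [macEig]
  | succ N ih =>
    intro l
    rw [macEig, ih, sum_range_succ', mul_add, mul_add, mul_sum, mul_sum, mul_sum]
    have : ∀ i ∈ range N, τ * ((1 - τ) * (τ ^ i * Q ^ l (i + 1))) =
        (1 - τ) * (τ ^ (i + 1) * Q ^ l (i + 1)) := fun i _ => by ring
    rw [sum_congr rfl this]
    ring

/-- By `macEig_eq`, the eigenvalue determines `∑ τ^i Q^{l i}`. Its monomials differ in the exponent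
of `τ`, so by algebraic independence each `l i` can be read off. -/
theorem macEig_injective {Q τ : Kqt} (h : AlgebraicIndependent ℚ ![Q, τ]) {N : ℕ} {l m : ℕ → ℕ}
    (he : macEig Q τ N l = macEig Q τ N m) (i : ℕ) (hi : i < N) : l i = m i := by
  set p : (ℕ → ℕ) → MvPolynomial (Fin 2) ℚ := fun l => ∑ i ∈ range N,
    MvPolynomial.monomial (Finsupp.single 0 (l i) + Finsupp.single 1 i) 1 with hp
  have hev : ∀ l, MvPolynomial.aeval ![Q, τ] (p l) = ∑ i ∈ range N, τ ^ i * Q ^ l i := by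
    intro l
    rw [hp, map_sum]
    refine sum_congr rfl fun i _ => ?_
    rw [MvPolynomial.aeval_monomial, Finsupp.prod_add_index' (by simp) (by intros; ring)]
    simp [mul_comm]
  have hτ : (1 : Kqt) - τ ≠ 0 := by
    intro h0
    have h1 : MvPolynomial.aeval ![Q, τ] (MvPolynomial.X 1 : MvPolynomial (Fin 2) ℚ) =
        MvPolynomial.aeval ![Q, τ] (1 : MvPolynomial (Fin 2) ℚ) := by
      rw [MvPolynomial.aeval_X, map_one]
      exact (sub_eq_zero.mp h0).symm
    have h2 := congrArg (MvPolynomial.coeff 0) (h h1)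
    rw [MvPolynomial.coeff_zero_X, MvPolynomial.coeff_zero_one] at h2
    exact zero_ne_one h2
  rw [macEig_eq, macEig_eq, add_right_inj, mul_right_inj' hτ, ← hev, ← hev] at he
  have hc : ∀ l m : ℕ → ℕ,
      (p m).coeff (Finsupp.single 0 (l i) + Finsupp.single 1 i) = if m i = l i then 1 else 0 := by
    intro l m
    rw [hp, MvPolynomial.coeff_sum, sum_eq_single i]
    · rw [MvPolynomial.coeff_monomial]
      refine if_congr ⟨fun h => ?_, fun h => by rw [h]⟩ rfl rfl
      have := DFunLike.congr_fun h 0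
      simpa using this
    · intro b _ hb
      rw [MvPolynomial.coeff_monomial, if_neg]
      intro h
      have := DFunLike.congr_fun h 1
      simp at this
      exact hb this
    · intro h
      exact absurd (mem_range.mpr hi) h
  have h3 := congrArg (MvPolynomial.coeff (Finsupp.single 0 (l i) + Finsupp.single 1 i)) (h he)
  rw [hc l l, hc l m, if_pos rfl] at h3
  by_contra hne
  rw [if_neg (Ne.symm hne)] at h3
  exact one_ne_zero h3

/-- The partition without its first part. -/
def Ptn.tail (la : Ptn) : Ptn :=
  ⟨la.1.comapDomain (· + 1) (Function.Injective.injOn (add_left_injective 1)),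
    fun _ _ h => la.2 (Nat.add_le_add_right h 1)⟩

theorem Ptn.tail_apply (la : Ptn) (r : ℕ) : la.tail.1 r = la.1 (r + 1) := rfl

theorem toExp_eq_tail (la : Ptn) : (MPtn.toExp fun _ : Fin 1 => la) =
    Finsupp.single (0, 0) (la.1 0) + (MPtn.toExp fun _ : Fin 1 => la.tail).embDomain (shiftEmb 1) := by
  ext ⟨i, r⟩
  obtain rfl := Fin.eq_zero i
  rw [toExp_apply, Finsupp.add_apply]
  cases r with
  | zero =>
    have h := embDomain_shiftEmb_mem 1 (MPtn.toExp fun _ : Fin 1 => la.tail) 0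
    simp only [Fin.val_zero] at h
    rw [h, Finsupp.single_eq_same, add_zero]
  | succ r =>
    have h1 : ((0 : Fin 1), r + 1) = shiftEmb 1 (0, r) := rfl
    rw [Finsupp.single_eq_of_ne (by simp), h1, Finsupp.embDomain_apply_self, toExp_apply, zero_add,
      Ptn.tail_apply]

theorem macOp_C (Q τ : Kqt) (a : Kqt) : macOp Q τ (MvPolynomial.C a) = MvPolynomial.C a := by
  have h : shiftU Q (MvPolynomial.C a) = Polynomial.C (MvPolynomial.C a) := by
    rw [shiftU, pev_C]
    rfl
  rw [macOp_eq_sum Q τ _ 1 (by rw [h, Polynomial.natDegree_C]; exact one_pos), h]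
  simp [hseq]

/-- Induction on the number of parts, splitting off the first variable: `la.1 0` bounds the degree
of `f` in it, and `coeff_addLetter_macOp` gives the recursion of `macEig`. The statement concerns
any `f` with dominated monomials because the induction passes to a top coefficient of `f`. -/
theorem coeff_macOp (Q τ : Kqt) (N : ℕ) : ∀ (la : Ptn) (f : MSym 1), (∀ i, N ≤ i → la.1 i = 0) →
    (∀ d, MvPowerSeries.coeff d (toSeries 1 f) ≠ 0 →
      ∀ j, ∑ r ∈ range j, d (0, r) ≤ ∑ r ∈ range j, la.1 r) →
    MvPowerSeries.coeff (MPtn.toExp fun _ : Fin 1 => la) (toSeries 1 (macOp Q τ f)) =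
      macEig Q τ N la.1 *
        MvPowerSeries.coeff (MPtn.toExp fun _ : Fin 1 => la) (toSeries 1 f) := by
  induction N with
  | zero =>
    intro la f hla hf
    have hC : f = MvPolynomial.C (MvPowerSeries.coeff 0 (toSeries 1 f)) := by
      refine toSeries_injective 1 (MvPowerSeries.ext fun d => ?_)
      rw [MvPolynomial.algHom_C, MvPowerSeries.algebraMap_apply, MvPowerSeries.coeff_C]
      split_ifs with hd
      · rw [hd]
        rfl
      · by_contra hne
        refine hd (Finsupp.ext fun v => ?_)
        have h1 := hf d hne (v.2 + 1)
        rw [sum_congr rfl fun r _ => hla r (Nat.zero_le r), sum_const_zero] at h1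
        have h2 := single_le_sum (f := fun r => d (0, r)) (fun _ _ => Nat.zero_le _)
          (mem_range.mpr (Nat.lt_succ_self v.2))
        have h3 : v = (0, v.2) := Prod.ext (Fin.eq_zero v.1) rfl
        rw [h3]
        exact Nat.le_zero.mp (h2.trans h1)
    rw [hC, macOp_C, macEig, one_mul]
  | succ N ih =>
    intro la f hla hf
    -- In the coefficient of the `a`-th power of the letter, the remaining exponents are dominated
    -- up to the slack `la.1 0 - a`; for `j = 0` this bounds `a`, for `a = la.1 0` it is dominance
    -- by the tail.
    have hletter : ∀ a d, MvPowerSeries.coeff d (toSeries 1 ((addLetter f).coeff a)) ≠ 0 →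
        ∀ j, a + ∑ r ∈ range j, d (0, r) ≤ la.1 0 + ∑ r ∈ range j, la.1 (r + 1) := by
      intro a d hd j
      rw [← coeff_toSeries_letter] at hd
      have h1 := hf _ hd (j + 1)
      rw [sum_range_succ', sum_range_succ'] at h1
      have h0 := embDomain_shiftEmb_mem 1 d 0
      simp only [Fin.val_zero] at h0
      have h2 : ∀ r, d.embDomain (shiftEmb 1) (0, r + 1) = d (0, r) := fun r =>
        Finsupp.embDomain_apply_self (shiftEmb 1) d (0, r)
      simp only [Finsupp.add_apply, h0, h2, Finsupp.single_eq_same, add_zero,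
        Finsupp.single_apply, Prod.mk.injEq] at h1
      simp at h1
      omega
    have hdeg : (addLetter f).natDegree ≤ la.1 0 := by
      rw [Polynomial.natDegree_le_iff_coeff_eq_zero]
      intro a ha
      refine toSeries_injective 1 (MvPowerSeries.ext fun d => ?_)
      rw [map_zero, map_zero]
      by_contra hne
      have := hletter a d hne 0
      simp at this
      omega
    rw [toExp_eq_tail, coeff_toSeries_letter, coeff_toSeries_letter,
      coeff_addLetter_macOp Q τ _ f hdeg, map_add, map_add, map_smul, map_smul, map_smul, map_smul,
      ih la.tail _ (fun i hi => hla (i + 1) (by omega)) fun d hd j => by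
        have := hletter _ d hd j
        simp only [Ptn.tail_apply]
        omega]
    have htail : macEig Q τ N la.tail.1 = macEig Q τ N fun r => la.1 (r + 1) := rfl
    simp only [smul_eq_mul, macEig, htail]
    ring

/-! ### Macdonald polynomials -/

theorem exists_eq_const (la : MPtn 1) : la = fun _ => la 0 :=
  funext fun i => by rw [Fin.eq_zero i]

theorem coeff_macOp_mm (Q τ : Kqt) (la : MPtn 1) {N : ℕ} (hN : ∀ i, N ≤ i → (la 0).1 i = 0) :
    MvPowerSeries.coeff la.toExp (toSeries 1 (macOp Q τ (mm la))) = macEig Q τ N (la 0).1 := by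
  have h := coeff_macOp Q τ N (la 0) (mm la) hN fun d hd j => sum_range_le_of_coeff_mm hd 0 j
  rw [← exists_eq_const] at h
  rw [h, coeff_mm, if_pos rfl, mul_one]

theorem coeff_macOp_mm_injective {Q τ : Kqt} (h : AlgebraicIndependent ℚ ![Q, τ]) {la mu : MPtn 1}
    (he : MvPowerSeries.coeff la.toExp (toSeries 1 (macOp Q τ (mm la))) =
      MvPowerSeries.coeff mu.toExp (toSeries 1 (macOp Q τ (mm mu)))) : la = mu := by
  obtain ⟨J, hJ⟩ := exists_bound_toExp la
  obtain ⟨J', hJ'⟩ := exists_bound_toExp mu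
  rw [coeff_macOp_mm Q τ la (N := max J J') fun i hi => hJ 0 i (le_of_max_le_left hi),
    coeff_macOp_mm Q τ mu (N := max J J') fun i hi => hJ' 0 i (le_of_max_le_right hi)] at he
  rw [exists_eq_const la, exists_eq_const mu]
  funext _
  refine Subtype.ext (Finsupp.ext fun i => ?_)
  by_cases hi : i < max J J'
  · exact macEig_injective h he i hi
  · rw [hJ 0 i (le_of_max_le_left (not_lt.mp hi)), hJ' 0 i (le_of_max_le_right (not_lt.mp hi))]

theorem macOp_mm_sub_mem (Q τ : Kqt) (la : MPtn 1) :
    macOp Q τ (mm la) -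
      MvPowerSeries.coeff la.toExp (toSeries 1 (macOp Q τ (mm la))) • mm la ∈
        Submodule.span Kqt (mm '' {mu | mu.HDom la}) := by
  refine mem_span_mm _ _ fun mu hmu => ?_
  rw [map_sub, map_sub, map_smul, map_smul, coeff_mm] at hmu
  have hne : mu ≠ la := by
    rintro rfl
    simp at hmu
  rw [if_neg hne.symm, smul_zero, sub_zero] at hmu
  exact ⟨⟨dom_of_coeff_macOp_mm hmu, hne⟩, degree_eq_of_coeff_macOp_mm hmu⟩

theorem pow_ne_one_of_algebraicIndependent {x : Fin 2 → Kqt} (h : AlgebraicIndependent ℚ x)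
    (i : Fin 2) (k : ℕ) : x i ^ (k + 1) ≠ 1 := by
  intro h0
  have h1 : MvPolynomial.aeval x (MvPolynomial.X i ^ (k + 1) : MvPolynomial (Fin 2) ℚ) =
      MvPolynomial.aeval x (1 : MvPolynomial (Fin 2) ℚ) := by
    rw [map_pow, MvPolynomial.aeval_X, map_one, h0]
  have h2 := congrArg MvPolynomial.constantCoeff (h h1)
  rw [map_pow, MvPolynomial.constantCoeff_X, map_one, zero_pow (Nat.succ_ne_zero k)] at h2
  exact zero_ne_one h2

theorem macNorm_ne_zero {n : ℕ} {Q T : Kqt} (h : AlgebraicIndependent ℚ ![Q, T⁻¹])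
    (v : Fin n × ℕ) : macNorm Q T v ≠ 0 := by
  have hQ : Q ^ (v.2 + 1) ≠ 1 := pow_ne_one_of_algebraicIndependent h 0 v.2
  have hT : T⁻¹ ^ (v.2 + 1) ≠ 1 := pow_ne_one_of_algebraicIndependent h 1 v.2
  rw [inv_pow, Ne, inv_eq_one] at hT
  exact mul_ne_zero (Nat.cast_add_one_ne_zero v.2)
    (div_ne_zero (sub_ne_zero.mpr hQ.symm) (sub_ne_zero.mpr (Ne.symm hT)))

/-- Eigenvectors of a self-adjoint operator with distinct eigenvalues are orthogonal. -/
theorem exists_macdonald {Q T : Kqt} (h : AlgebraicIndependent ℚ ![Q, T⁻¹]) :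
    ∃ P : MPtn 1 → MSym 1,
      (∀ la, P la - mm la ∈ Submodule.span Kqt (mm '' {mu | mu.HDom la})) ∧
      (∀ la mu, la ≠ mu → fock (macNorm Q T) (P la) (P mu) = 0) := by
  have hT0 : T ≠ 0 := by
    have := h.ne_zero 1
    simpa using this
  have hT : ∀ k, T ^ (k + 1) ≠ 1 := fun k hk => by
    refine pow_ne_one_of_algebraicIndependent h 1 k ?_
    change T⁻¹ ^ (k + 1) = 1
    rw [inv_pow, hk, inv_one]
  choose P hP hE using exists_eigenvector mm (macOp Q T⁻¹) (wellFounded_hDom 1)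
    (fun _ _ _ => MPtn.HDom.trans)
    (fun la => MvPowerSeries.coeff la.toExp (toSeries 1 (macOp Q T⁻¹ (mm la))))
    (fun a b hab he => hab.1.2 (coeff_macOp_mm_injective h he)) (macOp_mm_sub_mem Q T⁻¹)
  refine ⟨P, hP, fun la mu hne => ?_⟩
  have h1 := fock_macOp (Q := Q) hT0 hT (P la) (P mu)
  rw [hE, hE, map_smul, map_smul, LinearMap.smul_apply, smul_eq_mul, smul_eq_mul, ← sub_eq_zero,
    ← sub_mul, mul_eq_zero, sub_eq_zero] at h1
  exact h1.resolve_left fun he => hne (coeff_macOp_mm_injective h he)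

theorem span_hDom_le {n : ℕ} (la : MPtn n) : Submodule.span Kqt (mm '' {mu | mu.HDom la}) ≤
    Submodule.span Kqt (mm '' {mu | mu.SDom la}) :=
  Submodule.span_mono (Set.image_mono fun _ h => h.1)

theorem macdonald_norm_ne_zero {Q T : Kqt} (h : AlgebraicIndependent ℚ ![Q, T⁻¹])
    {P : MPtn 1 → MSym 1}
    (hP : ∀ la, P la - mm la ∈ Submodule.span Kqt (mm '' {mu | mu.HDom la}))
    (horth : ∀ la mu, la ≠ mu → fock (macNorm Q T) (P la) (P mu) = 0) (la : MPtn 1) :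
    fock (macNorm Q T) (P la) (P la) ≠ 0 :=
  norm_ne_zero_of_triangular (fun _ hf => eq_zero_of_fock_eq_zero (macNorm_ne_zero h) hf)
    (fun a => span_hDom_le a (hP a)) horth la

/-- Under `φ` the norm of `p_k` is multiplied by `(T / Q)^k`. On homogeneous functions this changes
the form by a scalar, so the image family is again triangular and orthogonal for the original form,
and uniqueness applies. -/
theorem map_macdonald {Q T : Kqt} (h : AlgebraicIndependent ℚ ![Q, T⁻¹])
    {P : MPtn 1 → MSym 1}
    (hP : ∀ la, P la - mm la ∈ Submodule.span Kqt (mm '' {mu | mu.HDom la}))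
    (horth : ∀ la mu, la ≠ mu → fock (macNorm Q T) (P la) (P mu) = 0) {φ : Kqt →+* Kqt}
    (hφQ : φ Q = Q⁻¹) (hφT : φ T = T⁻¹) (la : MPtn 1) : MvPolynomial.map φ (P la) = P la := by
  have hQ0 : Q ≠ 0 := h.ne_zero 0
  have hT0 : T ≠ 0 := by
    have := h.ne_zero 1
    simpa using this
  have hP' : ∀ la, MvPolynomial.map φ (P la) - mm la ∈
      Submodule.span Kqt (mm '' {mu | mu.HDom la}) := by
    intro la
    have := map_mem_span_mm φ (hP la)
    rwa [map_sub, map_mm] at this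
  have hnorm : (fun v : Fin 1 × ℕ => φ (macNorm Q T v)) =
      fun v => (T / Q) ^ (v.2 + 1) * macNorm Q T v := by
    funext v
    have hQ : Q ^ (v.2 + 1) ≠ 1 := pow_ne_one_of_algebraicIndependent h 0 v.2
    have hT : T⁻¹ ^ (v.2 + 1) ≠ 1 := pow_ne_one_of_algebraicIndependent h 1 v.2
    rw [inv_pow, Ne, inv_eq_one] at hT
    have hT' : 1 - T ^ (v.2 + 1) ≠ 0 := sub_ne_zero.mpr (Ne.symm hT)
    have hT'' : 1 - (T ^ (v.2 + 1))⁻¹ ≠ 0 := by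
      rw [Ne, sub_eq_zero, eq_comm, inv_eq_one]
      exact hT
    simp only [macNorm, map_mul, map_div₀, map_sub, map_one, map_pow, hφQ, hφT, map_add,
      map_natCast, inv_pow, div_pow]
    have hTk := pow_ne_zero (v.2 + 1) hT0
    have hQk := pow_ne_zero (v.2 + 1) hQ0
    generalize T ^ (v.2 + 1) = x at *
    generalize Q ^ (v.2 + 1) = y at *
    have hx : x - 1 ≠ 0 := by
      rw [← neg_ne_zero, neg_sub]
      exact hT'
    field_simp
    ring
  refine congrFun (triangular_orthogonal_unique (P' := fun la => MvPolynomial.map φ (P la))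
    (wellFounded_hDom 1) (fun _ _ _ => MPtn.HDom.trans) (fun _ h => h.1.2 rfl) hP hP' horth
    (macdonald_norm_ne_zero h hP horth) fun a b hab => ?_) la
  have h1 := map_fock φ (macNorm Q T) (P a) (P b)
  rw [horth a b hab, map_zero, hnorm, fock_scale] at h1
  have h2 := scaleHom_of_triangular (hP' b) (T / Q)
  rw [scaleHom] at h2
  rw [h2, map_smul, smul_eq_mul, mul_eq_zero] at h1
  exact h1.resolve_left (pow_ne_zero _ (div_ne_zero hT0 hQ0))

/-! ### Orthogonal coordinates -/

/-- The field has transcendence degree at least two, so two elements over which it is algebraic form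
a transcendence basis. -/
theorem algebraicIndependent_of_isAlgebraic {x : Fin 2 → Kqt}
    (hq : IsAlgebraic (Algebra.adjoin ℚ (Set.range x)) q)
    (ht : IsAlgebraic (Algebra.adjoin ℚ (Set.range x)) t) : AlgebraicIndependent ℚ x := by
  set A := Algebra.adjoin ℚ (Set.range x) with hA
  have hpoly : ∀ f : MvPolynomial (Fin 2) ℚ,
      IsAlgebraic A (algebraMap (MvPolynomial (Fin 2) ℚ) Kqt f) := by
    intro f
    induction f using MvPolynomial.induction_on with
    | C a =>
      have h := isAlgebraic_algebraMap (R := A) (A := Kqt) (algebraMap ℚ A a)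
      rw [← IsScalarTower.algebraMap_apply ℚ A Kqt] at h
      rw [← MvPolynomial.algebraMap_eq, ← IsScalarTower.algebraMap_apply]
      exact h
    | add f g hf hg => rw [map_add]; exact hf.add hg
    | mul_X f i hf =>
      rw [map_mul]
      refine hf.mul ?_
      fin_cases i
      · exact hq
      · exact ht
  have halg : Algebra.IsAlgebraic A Kqt := by
    refine ⟨fun y => ?_⟩
    obtain ⟨a, b, -, rfl⟩ := IsFractionRing.div_surjective (A := MvPolynomial (Fin 2) ℚ) y
    rw [div_eq_mul_inv]
    exact (hpoly a).mul (hpoly b).inv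
  have hb : IsTranscendenceBasis ℚ x := by
    refine Algebra.IsAlgebraic.isTranscendenceBasis_of_le_trdeg_of_finite ℚ x ?_
    have h2 : AlgebraicIndependent ℚ
        (fun i : Fin 2 => algebraMap (MvPolynomial (Fin 2) ℚ) Kqt (MvPolynomial.X i)) :=
      (MvPolynomial.algebraicIndependent_X (Fin 2) ℚ).map'
        (f := IsScalarTower.toAlgHom ℚ (MvPolynomial (Fin 2) ℚ) Kqt)
        (IsFractionRing.injective (MvPolynomial (Fin 2) ℚ) Kqt)
    exact h2.cardinalMk_le_trdeg
  exact hb.1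

/-- The second parameter of the Macdonald polynomials for the `i`-th alphabet. -/
def parT (n i : ℕ) : Kqt := q ^ (n - 1 - i) * t

/-- The first parameter of the Macdonald polynomials for the `i`-th alphabet. -/
def parQ (n i : ℕ) : Kqt := if i = 0 then q else q * parT n i

theorem t_ne_zero : t ≠ 0 := by
  simp [t]

theorem parT_ne_zero (n i : ℕ) : parT n i ≠ 0 := mul_ne_zero (pow_ne_zero _ q_ne_zero) t_ne_zero

/-- `q` is either `Q` itself or `Q T⁻¹`, and then `t` is `T` divided by a power of `q`. -/
theorem algebraicIndependent_par (n i : ℕ) :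
    AlgebraicIndependent ℚ ![parQ n i, (parT n i)⁻¹] := by
  have hQ := isAlgebraic_algebraMap (A := Kqt)
    (⟨parQ n i, Algebra.subset_adjoin ⟨0, rfl⟩⟩ :
      Algebra.adjoin ℚ (Set.range ![parQ n i, (parT n i)⁻¹]))
  have hT := isAlgebraic_algebraMap (A := Kqt)
    (⟨(parT n i)⁻¹, Algebra.subset_adjoin ⟨1, rfl⟩⟩ :
      Algebra.adjoin ℚ (Set.range ![parQ n i, (parT n i)⁻¹]))
  have hq : IsAlgebraic (Algebra.adjoin ℚ (Set.range ![parQ n i, (parT n i)⁻¹])) q := by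
    by_cases hi : i = 0
    · have : parQ n i = q := if_pos hi
      rw [← this]
      exact hQ
    · have : q = parQ n i * (parT n i)⁻¹ := by
        rw [parQ, if_neg hi, mul_assoc, mul_inv_cancel₀ (parT_ne_zero n i), mul_one]
      rw [this]
      exact hQ.mul hT
  refine algebraicIndependent_of_isAlgebraic hq ?_
  have : t = (parT n i)⁻¹⁻¹ * (q ^ (n - 1 - i))⁻¹ := by
    rw [inv_inv, parT, mul_comm, inv_mul_cancel_left₀ (pow_ne_zero _ q_ne_zero)]
  rw [this]
  exact hT.inv.mul (hq.pow _).inv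

theorem parT_pow_ne_one (n i k : ℕ) : parT n i ^ (k + 1) ≠ 1 := by
  have h : (parT n i)⁻¹ ^ (k + 1) ≠ 1 :=
    pow_ne_one_of_algebraicIndependent (algebraicIndependent_par n i) 1 k
  rwa [inv_pow, Ne, inv_eq_one] at h

theorem t_pow_ne_one (k : ℕ) : t ^ (k + 1) ≠ 1 := by
  have h : t⁻¹ ^ (k + 1) ≠ 1 := pow_ne_one_of_algebraicIndependent algebraicIndependent_inv 1 k
  rwa [inv_pow, Ne, inv_eq_one] at h

/-- The unnormalized coefficient of the `m`-th alphabet in the orthogonal coordinates. -/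
def rawCoeff (n r m : ℕ) : Kqt :=
  if m < n then (q ^ ((n - 1 - m) * (r + 1)))⁻¹ - t ^ (r + 1) else 0

theorem rawCoeff_eq {n m : ℕ} (r : ℕ) (hm : m < n) : rawCoeff n r m =
    (1 - parT n m ^ (r + 1)) / q ^ ((n - 1 - m) * (r + 1)) := by
  have := pow_ne_zero ((n - 1 - m) * (r + 1)) q_ne_zero
  rw [rawCoeff, if_pos hm, parT, mul_pow, ← pow_mul]
  field_simp

theorem rawCoeff_ne_zero {n m : ℕ} (r : ℕ) (hm : m < n) : rawCoeff n r m ≠ 0 := by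
  rw [rawCoeff_eq r hm]
  exact div_ne_zero (sub_ne_zero.mpr (parT_pow_ne_one n m r).symm) (pow_ne_zero _ q_ne_zero)

/-- The right-hand side is free of `m`: this is what dictates the coefficients of the orthogonal
coordinates. The value `0` of `rawCoeff` at `n` accounts for the special norm of the last union. -/
theorem unionNorm_mul {n : ℕ} (m : Fin n) (r : ℕ) :
    unionNorm n (m, r) * (rawCoeff n r m - rawCoeff n r (m + 1)) =
      (r + 1) * (1 - q ^ (r + 1)) := by
  have ht : (1 : Kqt) - t ^ (r + 1) ≠ 0 := sub_ne_zero.mpr (t_pow_ne_one r).symm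
  simp only [unionNorm, rawCoeff, if_pos m.2]
  by_cases hm : (m : ℕ) + 1 = n
  · have h0 : n - 1 - (m : ℕ) = 0 := by omega
    rw [if_pos hm, if_neg (by omega), h0]
    simp only [zero_mul, pow_zero]
    field_simp
    ring
  · have h0 : n - 1 - (m : ℕ) = n - 1 - (m + 1) + 1 := by omega
    have hpow : q ^ ((n - 1 - (m : ℕ)) * (r + 1)) =
        q ^ ((n - 1 - ((m : ℕ) + 1)) * (r + 1)) * q ^ (r + 1) := by
      rw [h0, add_mul, one_mul, pow_add]
    rw [if_neg hm, if_pos (by omega), hpow]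
    have h1 := pow_ne_zero ((n - 1 - ((m : ℕ) + 1)) * (r + 1)) q_ne_zero
    have h2 := pow_ne_zero (r + 1) q_ne_zero
    generalize q ^ ((n - 1 - ((m : ℕ) + 1)) * (r + 1)) = x at *
    generalize q ^ (r + 1) = y at *
    field_simp
    ring

/-- The coefficient of the `m`-th alphabet in the `i`-th orthogonal coordinate. -/
def ortCoeff (n i r m : ℕ) : Kqt := if i ≤ m then rawCoeff n r m / rawCoeff n r i else 0

theorem ortCoeff_self {n i : ℕ} (r : ℕ) (hi : i < n) : ortCoeff n i r i = 1 := by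
  rw [ortCoeff, if_pos le_rfl, div_self (rawCoeff_ne_zero r hi)]

theorem ortCoeff_of_lt {n i m : ℕ} (r : ℕ) (hi : m < i) : ortCoeff n i r m = 0 := if_neg hi.not_ge

theorem ortCoeff_top {n i : ℕ} (r : ℕ) : ortCoeff n i r n = 0 := by
  rw [ortCoeff, rawCoeff, if_neg (lt_irrefl n), zero_div, ite_self]

/-- The power sums of the `i`-th orthogonal coordinate. -/
def ortSum (n i r : ℕ) : MSym n :=
  ∑ m : Fin n, MvPolynomial.C (ortCoeff n i r m) * MvPolynomial.X (m, r)

/-- The differences of the coefficients of an orthogonal coordinate. -/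
def ortDiff (n i r m : ℕ) : Kqt := ortCoeff n i r m - ortCoeff n i r (m + 1)

theorem sum_ortDiff (n i r : ℕ) :
    ∑ m : Fin n, ortDiff n i r m = if i = 0 then ortCoeff n i r 0 else 0 := by
  rw [Fin.sum_univ_eq_sum_range fun m => ortDiff n i r m]
  simp only [ortDiff]
  rw [sum_range_sub', ortCoeff_top, sub_zero]
  split_ifs with h
  · rfl
  · exact ortCoeff_of_lt r (Nat.pos_of_ne_zero h)

theorem unionNorm_mul_ortDiff {n i : ℕ} (r : ℕ) (m : Fin n) (hi : i ≤ m) :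
    unionNorm n (m, r) * ortDiff n i r m = (r + 1) * ((1 - q ^ (r + 1)) / rawCoeff n r i) := by
  rw [ortDiff, ortCoeff, ortCoeff, if_pos hi, if_pos (by omega), ← sub_div, mul_div_assoc',
    unionNorm_mul, mul_div_assoc]

theorem ortDiff_of_succ_eq {n i m : ℕ} (r : ℕ) (hi : i < n) (hm : m + 1 = i) :
    ortDiff n i r m = -1 := by
  rw [ortDiff, hm, ortCoeff_self r hi, ortCoeff_of_lt r (by omega), zero_sub]

theorem ortDiff_of_lt {n i m : ℕ} (r : ℕ) (hm : m + 1 < i) : ortDiff n i r m = 0 := by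
  rw [ortDiff, ortCoeff_of_lt r hm, ortCoeff_of_lt r (by omega), sub_zero]

/-- The differences for `j` vanish below `j - 1`, thus wherever `m < i`; for `m ≥ i` the norm times
the difference for `i` is constant. What remains is the sum of the differences for `j > 0`, which
telescopes to zero. -/
theorem sum_ortDiff_mul_of_lt {n i j : ℕ} (r : ℕ) (hij : i < j) :
    ∑ m : Fin n, ortDiff n i r m * ortDiff n j r m * unionNorm n (m, r) = 0 := by
  have h : ∀ m : Fin n, ortDiff n i r m * ortDiff n j r m * unionNorm n (m, r) =
      ((r + 1) * ((1 - q ^ (r + 1)) / rawCoeff n r i)) * ortDiff n j r m := by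
    intro m
    by_cases hm : i ≤ m
    · rw [← unionNorm_mul_ortDiff r m hm]
      ring
    · rw [ortDiff_of_lt (i := j) r (by omega)]
      ring
  rw [sum_congr rfl fun m _ => h m, ← mul_sum, sum_ortDiff, if_neg (by omega), mul_zero]

/-- The norms of the orthogonal coordinates. -/
def ortNorm (n : ℕ) (v : Fin n × ℕ) : Kqt :=
  ∑ m : Fin n, ortDiff n v.1 v.2 m * ortDiff n v.1 v.2 m * unionNorm n (m, v.2)

theorem ortNorm_eq {n : ℕ} (i : Fin n) (r : ℕ) :
    ortNorm n (i, r) = (q ^ (n - 1 - (i : ℕ))) ^ (r + 1) *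
      macNorm (n := 1) (parQ n i) (parT n i) (0, r) := by
  simp only [ortNorm, macNorm]
  set c : Kqt := (r + 1) * ((1 - q ^ (r + 1)) / rawCoeff n r i) with hc
  -- For `m ≥ i` the norm times one difference is `c`. The only other non-zero difference is `-1` at
  -- `m = i - 1`, where `unionNorm` replaces `-c`, hence the correction.
  have h : ∀ m : Fin n, ortDiff n i r m * ortDiff n i r m * unionNorm n (m, r) =
      c * ortDiff n i r m + if (m : ℕ) + 1 = i then unionNorm n (m, r) + c else 0 := by
    intro m
    by_cases hm : i ≤ m
    · rw [← unionNorm_mul_ortDiff r m hm] at hc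
      rw [hc, if_neg (by have := Fin.le_def.mp hm; omega)]
      ring
    · rw [not_le, Fin.lt_def] at hm
      split_ifs with hm'
      · rw [ortDiff_of_succ_eq r i.2 hm']
        ring
      · rw [ortDiff_of_lt r (by omega)]
        ring
  rw [sum_congr rfl fun m _ => h m, sum_add_distrib, ← mul_sum, sum_ortDiff]
  have hT : (1 : Kqt) - parT n i ^ (r + 1) ≠ 0 := sub_ne_zero.mpr (parT_pow_ne_one n i r).symm
  have hq := pow_ne_zero ((n - 1 - (i : ℕ)) * (r + 1)) q_ne_zero
  rw [rawCoeff_eq r i.2] at hc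
  by_cases hi : (i : ℕ) = 0
  · rw [if_pos hi, sum_eq_zero fun m _ => if_neg (by omega), parQ, if_pos hi]
    have : ortCoeff n i r 0 = 1 := by
      rw [← hi]
      exact ortCoeff_self r i.2
    rw [this, mul_one, add_zero, hc, ← pow_mul]
    field_simp
  · have hm : (i : ℕ) - 1 < n := by omega
    rw [if_neg hi, mul_zero, zero_add, sum_eq_single ⟨(i : ℕ) - 1, hm⟩, if_pos (by simp; omega),
      unionNorm, if_neg (by simp; omega), parQ, if_neg hi, hc]
    · have h1 : n - 1 - ((i : ℕ) - 1) = n - 1 - i + 1 := by omega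
      simp only [h1]
      rw [mul_pow, add_mul, one_mul, pow_add, ← pow_mul]
      field_simp
      ring
    · intro m _ hne
      rw [if_neg]
      intro h'
      exact hne (Fin.ext (by simp; omega))
    · simp

/-! ### Products in separate groups of variables -/

/-- The symmetric functions in one alphabet as polynomials in the `i`-th group of variables. -/
def inject {n : ℕ} (i : Fin n) : MSym 1 →ₐ[Kqt] MSym n :=
  MvPolynomial.rename fun v => (i, v.2)

theorem injective_pair {n : ℕ} (i : Fin n) :
    Function.Injective fun v : Fin 1 × ℕ => (i, v.2) := by
  intro v w h
  exact Prod.ext (Subsingleton.elim _ _) (Prod.ext_iff.mp h).2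

theorem inject_X {n : ℕ} (i : Fin n) (v : Fin 1 × ℕ) :
    inject i (MvPolynomial.X v) = MvPolynomial.X (i, v.2) :=
  MvPolynomial.rename_X _ _

theorem pderiv_inject {n : ℕ} (i : Fin n) (v : Fin 1 × ℕ) (f : MSym 1) :
    MvPolynomial.pderiv (i, v.2) (inject i f) = inject i (MvPolynomial.pderiv v f) :=
  MvPolynomial.pderiv_rename (injective_pair i) v f

theorem pderiv_inject_of_ne {n : ℕ} {i l : Fin n} (h : l ≠ i) (r : ℕ) (f : MSym 1) :
    MvPolynomial.pderiv (i, r) (inject l f) = 0 := by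
  induction f using MvPolynomial.induction_on with
  | C a => rw [inject, MvPolynomial.rename_C, MvPolynomial.pderiv_C]
  | add f g hf hg => rw [map_add, map_add, hf, hg, add_zero]
  | mul_X f v hf =>
    rw [map_mul, inject_X, MvPolynomial.pderiv_mul, hf, MvPolynomial.pderiv_X_of_ne, zero_mul,
      mul_zero, add_zero]
    exact fun h' => h (Prod.ext_iff.mp h').1

theorem pderiv_prod_inject {n : ℕ} {i : Fin n} {s : Finset (Fin n)} (hi : i ∉ s)
    (f : Fin n → MSym 1) (r : ℕ) :
    MvPolynomial.pderiv (i, r) (∏ l ∈ s, inject l (f l)) = 0 := by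
  refine prod_induction _ (fun F => MvPolynomial.pderiv (i, r) F = 0) (fun a b ha hb => ?_)
    MvPolynomial.pderiv_one fun l hl => pderiv_inject_of_ne (ne_of_mem_of_not_mem hl hi) r _
  rw [MvPolynomial.pderiv_mul, ha, hb, zero_mul, mul_zero, add_zero]

/-- Variables of the `i`-th group can be moved across as derivatives, which act on `f` and `g` only
because `F` and `G` do not involve that group. -/
theorem fock_inject_mul {n : ℕ} (N : Fin n × ℕ → Kqt) (i : Fin n) {F G : MSym n}
    (hF : ∀ r, MvPolynomial.pderiv (i, r) F = 0) (hG : ∀ r, MvPolynomial.pderiv (i, r) G = 0)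
    (f : MSym 1) : ∀ g : MSym 1, fock N (inject i f * F) (inject i g * G) =
      fock (fun v : Fin 1 × ℕ => N (i, v.2)) f g * fock N F G := by
  induction f using MvPolynomial.induction_on with
  | C a =>
    intro g
    have h1 : fock (fun v : Fin 1 × ℕ => N (i, v.2)) (MvPolynomial.C a) g =
        a * MvPolynomial.constantCoeff g := by
      rw [← mul_one (MvPolynomial.C a), fock_C_mul, fock_one]
    rw [h1, inject, MvPolynomial.rename_C, fock_C_mul, fock_symm, ← inject, mul_assoc]
    congr 1
    clear h1
    induction g using MvPolynomial.induction_on with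
    | C b =>
      rw [inject, MvPolynomial.rename_C, fock_C_mul, fock_symm, MvPolynomial.constantCoeff_C]
    | add g h hg hh =>
      rw [map_add, add_mul, map_add, LinearMap.add_apply, hg, hh, map_add, add_mul]
    | mul_X g v _ =>
      rw [map_mul (inject i), inject_X, mul_comm (inject i g), mul_assoc, fock_X_mul, hF, map_zero,
        mul_zero, map_mul, MvPolynomial.constantCoeff_X, mul_zero, zero_mul]
  | add f h hf hh =>
    intro g
    rw [map_add, add_mul, map_add, LinearMap.add_apply, hf, hh, map_add, LinearMap.add_apply,
      add_mul]
  | mul_X f v hf =>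
    intro g
    rw [map_mul (inject i), inject_X, mul_comm (inject i f), mul_assoc, fock_X_mul, MvPolynomial.pderiv_mul,
      hG, mul_zero, add_zero, pderiv_inject, hf, mul_comm f, fock_X_mul, mul_assoc]

theorem fock_prod_inject {n : ℕ} (N : Fin n × ℕ → Kqt) (f g : Fin n → MSym 1)
    (s : Finset (Fin n)) : fock N (∏ i ∈ s, inject i (f i)) (∏ i ∈ s, inject i (g i)) =
      ∏ i ∈ s, fock (fun v : Fin 1 × ℕ => N (i, v.2)) (f i) (g i) := by
  induction s using Finset.induction_on with
  | empty =>
    rw [prod_empty, prod_empty, prod_empty, fock_one, map_one]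
  | insert i s hi ih =>
    rw [prod_insert hi, prod_insert hi, prod_insert hi,
      fock_inject_mul N i (pderiv_prod_inject hi f) (pderiv_prod_inject hi g), ih]

/-! ### Symmetric functions in orthogonal coordinates -/

/-- The symmetric functions in one alphabet as functions of the `i`-th orthogonal coordinate. -/
def ortHom {n : ℕ} (i : Fin n) : MSym 1 →ₐ[Kqt] MSym n := pev fun r => ortSum n i r

/-- The orthogonal coordinates in terms of the power sums of the unions of alphabets. -/
def ortUnion (n : ℕ) : MSym n →ₐ[Kqt] MSym n :=
  MvPolynomial.aeval fun v =>
    ∑ m : Fin n, MvPolynomial.C (ortDiff n v.1 v.2 m) * MvPolynomial.X (m, v.2)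

/-- Abel summation; the boundary term vanishes since `ortCoeff` is zero at `n`. -/
theorem unionCoords_ortSum {n : ℕ} (i : Fin n) (r : ℕ) :
    unionCoords n (ortSum n i r) =
      ∑ m : Fin n, MvPolynomial.C (ortDiff n i r m) * MvPolynomial.X (m, r) := by
  simp only [ortSum, map_sum, map_mul, MvPolynomial.algHom_C, MvPolynomial.algebraMap_eq,
    unionCoords, MvPolynomial.aeval_X, mul_sub, sum_sub_distrib, ortDiff, MvPolynomial.C_sub,
    sub_mul]
  congr 1
  simp only [mul_sum, sum_filter]
  rw [sum_comm]
  refine sum_congr rfl fun m _ => ?_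
  by_cases hm : (m : ℕ) + 1 < n
  · rw [sum_eq_single ⟨(m : ℕ) + 1, hm⟩]
    · rw [if_pos rfl]
    · intro b _ hb
      rw [if_neg fun h => hb (Fin.ext h.symm), mul_zero]
    · simp
  · have h1 : (m : ℕ) + 1 = n := by omega
    rw [h1, ortCoeff_top, MvPolynomial.C_0, zero_mul]
    refine sum_eq_zero fun b _ => ?_
    rw [if_neg (by omega), mul_zero]

theorem unionCoords_ortHom {n : ℕ} (i : Fin n) (f : MSym 1) :
    unionCoords n (ortHom i f) = ortUnion n (inject i f) := by
  have : (unionCoords n).comp (ortHom i) = (ortUnion n).comp (inject i) := by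
    refine MvPolynomial.algHom_ext fun v => ?_
    rw [AlgHom.comp_apply, AlgHom.comp_apply, ortHom, pev_X, unionCoords_ortSum, inject_X, ortUnion,
      MvPolynomial.aeval_X]
  exact DFunLike.congr_fun this f

theorem fock_sum_X {σ : Type*} (N : σ → Kqt) {ι : Type*} (s : Finset ι) (v : ι → σ)
    (a : ι → Kqt) (h : MvPolynomial σ Kqt) :
    fock N (∑ m ∈ s, MvPolynomial.C (a m) * MvPolynomial.X (v m)) h =
      ∑ m ∈ s, a m * (N (v m) * MvPolynomial.constantCoeff (MvPolynomial.pderiv (v m) h)) := by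
  rw [map_sum, LinearMap.sum_apply]
  refine sum_congr rfl fun m _ => ?_
  rw [fock_C_mul, ← mul_one (MvPolynomial.X (v m)), fock_X_mul, fock_one]

theorem fock_ortUnion_X {n : ℕ} (v w : Fin n × ℕ) :
    fock (unionNorm n) (ortUnion n (MvPolynomial.X v)) (ortUnion n (MvPolynomial.X w)) =
      if v.2 = w.2 then ∑ m : Fin n,
        ortDiff n v.1 v.2 m * ortDiff n w.1 v.2 m * unionNorm n (m, v.2) else 0 := by
  rw [ortUnion, MvPolynomial.aeval_X, MvPolynomial.aeval_X, fock_sum_X]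
  have h : ∀ m : Fin n, MvPolynomial.constantCoeff (MvPolynomial.pderiv (m, v.2)
      (∑ l : Fin n, MvPolynomial.C (ortDiff n w.1 w.2 l) * MvPolynomial.X (l, w.2))) =
      if v.2 = w.2 then ortDiff n w.1 w.2 m else 0 := by
    intro m
    rw [map_sum, map_sum, sum_eq_single m]
    · rw [MvPolynomial.pderiv_C_mul]
      split_ifs with hvw
      · rw [hvw, MvPolynomial.pderiv_X_self]
        simp
      · rw [MvPolynomial.pderiv_X_of_ne (i := (m, v.2)) (j := (m, w.2)) fun h => hvw (Prod.ext_iff.mp h).2.symm]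
        simp
    · intro l _ hl
      rw [MvPolynomial.pderiv_C_mul,
        MvPolynomial.pderiv_X_of_ne fun h => hl (Prod.ext_iff.mp h).1]
      simp
    · simp
  simp only [h]
  split_ifs with hvw
  · refine sum_congr rfl fun m _ => ?_
    rw [hvw]
    ring
  · simp

theorem fock_ortUnion {n : ℕ} (f h : MSym n) :
    fock (unionNorm n) (ortUnion n f) (ortUnion n h) = fock (ortNorm n) f h := by
  refine fock_linear_subst _ _ _ (fun v => ?_) (fun v => ?_) (fun v w hvw => ?_) f h
  · refine ⟨univ ×ˢ {v.2}, fun w => ortDiff n v.1 v.2 w.1, ?_⟩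
    rw [ortUnion, MvPolynomial.aeval_X, sum_product]
    simp
  · rw [fock_ortUnion_X, if_pos rfl, ortNorm]
  · rw [fock_ortUnion_X]
    split_ifs with h
    · rcases lt_trichotomy v.1 w.1 with hlt | heq | hlt
      · exact sum_ortDiff_mul_of_lt v.2 hlt
      · exact absurd (Prod.ext heq h) hvw
      · rw [← sum_ortDiff_mul_of_lt v.2 hlt]
        refine sum_congr rfl fun m _ => ?_
        ring
    · rfl

/-- The coordinates are pairwise orthogonal on generators, so `fock_linear_subst` makes the form one
with independent variables, and such a form is multiplicative over the groups. -/
theorem scalarProduct_prod_ortHom {n : ℕ} (f h : Fin n → MSym 1) :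
    scalarProduct n (∏ i, ortHom i (f i)) (∏ i, ortHom i (h i)) =
      ∏ i : Fin n, fock (fun v : Fin 1 × ℕ => (q ^ (n - 1 - (i : ℕ))) ^ (v.2 + 1) *
        macNorm (parQ n i) (parT n i) v) (f i) (h i) := by
  rw [scalarProduct_eq_fock, map_prod (unionCoords n), map_prod (unionCoords n)]
  simp only [unionCoords_ortHom]
  rw [← map_prod (ortUnion n), ← map_prod (ortUnion n), fock_ortUnion, fock_prod_inject]
  refine prod_congr rfl fun i _ => ?_
  refine congrArg (fun N => fock N (f i) (h i)) (funext fun v => ?_)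
  rw [ortNorm_eq]
  rfl

/-! ### Monomials of functions of orthogonal coordinates -/

theorem sum_le_degree {σ : Type*} (d : σ →₀ ℕ) (s : Finset σ) : ∑ v ∈ s, d v ≤ d.degree := by
  classical
  rw [Finsupp.degree_apply, ← sum_filter_ne_zero]
  refine sum_le_sum_of_subset fun v hv => ?_
  exact Finsupp.mem_support_iff.mpr (mem_filter.mp hv).2

theorem eq_of_le_of_degree_eq {σ : Type*} {l m : σ →₀ ℕ} (h : l ≤ m)
    (hd : m.degree = l.degree) : m = l := by
  have h1 : (m - l).degree + l.degree = m.degree := by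
    rw [← map_add, tsub_add_cancel_of_le h]
  have h2 : m - l = 0 := (Finsupp.degree_eq_zero_iff _).mp (by omega)
  rw [← tsub_add_cancel_of_le h, h2, zero_add]

theorem sum_range_le_of_triangular {la : MPtn 1} {f : MSym 1}
    (hf : f - mm la ∈ Submodule.span Kqt (mm '' {mu | mu.HDom la})) {d : (Fin 1 × ℕ) →₀ ℕ}
    (hd : MvPowerSeries.coeff d (toSeries 1 f) ≠ 0) (j : ℕ) :
    ∑ r ∈ range j, d (0, r) ≤ ∑ r ∈ range j, (la 0).1 r := by
  obtain ⟨mu, σ, rfl⟩ := exists_perm_toExp d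
  have h1 : mu.Dom la := by
    by_contra hne
    have h2 := coeff_eq_zero_of_mem_span_mm hf (la := mu) fun h => hne h.1.1
    have h3 : la ≠ mu := by
      rintro rfl
      exact hne fun _ _ => le_rfl
    rw [map_sub, map_sub, coeff_mm, if_neg h3, sub_zero] at h2
    rw [coeff_toSeries_perm] at hd
    exact hd h2
  have h2 : MvPowerSeries.coeff (mu.toExp.embDomain (permVar σ).toEmbedding)
      (toSeries 1 (mm mu)) ≠ 0 := by
    rw [coeff_toSeries_perm, coeff_mm, if_pos rfl]
    exact one_ne_zero
  refine (sum_range_le_of_coeff_mm h2 0 j).trans ?_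
  have h3 := h1 0 j
  have h4 : Iio (0 : Fin 1) = ∅ := by decide
  rwa [h4, sum_empty, sum_empty, zero_add, zero_add] at h3

/-- The power sums of an orthogonal coordinate as power series. -/
def ortSeries (n i r : ℕ) : MvPowerSeries (Fin n × ℕ) Kqt :=
  ∑ m : Fin n, ortCoeff n i r m • powerSumSeries n m (r + 1)

theorem toSeries_ortHom {n : ℕ} (i : Fin n) (f : MSym 1) :
    toSeries n (ortHom i f) = pev (fun r => ortSeries n i r) f := by
  have : (toSeries n).comp (ortHom i) = pev fun r => ortSeries n i r := by
    refine MvPolynomial.algHom_ext fun v => ?_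
    rw [AlgHom.comp_apply, ortHom, pev_X, pev_X, ortSum, ortSeries, map_sum]
    refine sum_congr rfl fun m _ => ?_
    rw [map_mul, MvPolynomial.algHom_C, ← Algebra.smul_def, toSeries_X]
  exact DFunLike.congr_fun this f

/-- The exponents that involve only the alphabets from the `i`-th one on. -/
def fromAlphabet {n : ℕ} (i : Fin n) : AddSubmonoid ((Fin n × ℕ) →₀ ℕ) where
  carrier := {d | ∀ l < i, ∀ r, d (l, r) = 0}
  zero_mem' := fun _ _ _ => rfl
  add_mem' := fun {a b} ha hb l hl r => by rw [Finsupp.add_apply, ha l hl r, hb l hl r]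

theorem powerSumSeries_mem {n : ℕ} (m : Fin n) (k : ℕ) {S : AddSubmonoid ((Fin n × ℕ) →₀ ℕ)}
    (hS : ∀ j, Finsupp.single (m, j) k ∈ S) : powerSumSeries n m k ∈ supportedSubalgebra S := by
  intro d hd
  rw [coeff_powerSumSeries] at hd
  split_ifs at hd with h
  · obtain ⟨j, rfl⟩ := h
    exact hS j
  · exact absurd rfl hd

theorem apply_eq_zero_of_coeff_ortHom {n : ℕ} {i : Fin n} {f : MSym 1} {d : (Fin n × ℕ) →₀ ℕ}
    (hd : MvPowerSeries.coeff d (toSeries n (ortHom i f)) ≠ 0) {l : Fin n} (hl : l < i) (r : ℕ) :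
    d (l, r) = 0 := by
  rw [toSeries_ortHom] at hd
  have hc : ∀ r, ortSeries n i r ∈ supportedSubalgebra (fromAlphabet i) := by
    intro r
    refine Subalgebra.sum_mem _ fun m _ => ?_
    by_cases hm : (i : ℕ) ≤ m
    · refine Subalgebra.smul_mem _ (powerSumSeries_mem m _ fun j => ?_) _
      intro l hl r
      refine Finsupp.single_eq_of_ne fun h => ?_
      have := (Prod.ext_iff.mp h).1
      simp only at this
      rw [Fin.lt_def, this] at hl
      omega
    · rw [ortCoeff, if_neg hm, zero_smul]
      exact Subalgebra.zero_mem _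
  exact pev_mem hc f d hd l hl r

theorem scaleHom_ortHom {n : ℕ} (i : Fin n) (c : Kqt) (f : MSym 1) :
    scaleHom n c (ortHom i f) = ortHom i (scaleHom 1 c f) := by
  have : (scaleHom n c).comp (ortHom i) = (ortHom i).comp (scaleHom 1 c) := by
    refine MvPolynomial.algHom_ext fun v => ?_
    rw [AlgHom.comp_apply, AlgHom.comp_apply, scaleHom, scaleHom, MvPolynomial.aeval_X, map_mul,
      MvPolynomial.algHom_C, ortHom, pev_X, ortSum, map_sum, mul_sum]
    refine sum_congr rfl fun m _ => ?_
    rw [map_mul, MvPolynomial.algHom_C, MvPolynomial.aeval_X]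
    exact mul_left_comm _ _ _
  exact DFunLike.congr_fun this f

theorem degree_eq_of_coeff_ortHom {n : ℕ} {i : Fin n} {la : MPtn 1} {f : MSym 1}
    (hf : f - mm la ∈ Submodule.span Kqt (mm '' {mu | mu.HDom la})) {d : (Fin n × ℕ) →₀ ℕ}
    (hd : MvPowerSeries.coeff d (toSeries n (ortHom i f)) ≠ 0) : d.degree = la.toExp.degree := by
  have h1 := coeff_scaleHom 2 (ortHom i f) d
  rw [scaleHom_ortHom, scaleHom_of_triangular hf, map_smul, map_smul, map_smul, smul_eq_mul] at h1
  have h2 := mul_right_cancel₀ hd h1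
  have h3 : (2 : ℕ) ^ la.toExp.degree = 2 ^ d.degree := by exact_mod_cast h2
  exact (Nat.pow_right_injective le_rfl h3).symm

/-- In the `i`-th coordinate the alphabet `x⁽ⁱ⁾` has coefficient one. Its first `j` variables are
therefore genuine letters added to a series that avoids them, and the bound for one alphabet carries
over. -/
theorem sum_range_le_of_coeff_ortHom {n : ℕ} {i : Fin n} {la : MPtn 1} {f : MSym 1}
    (hf : f - mm la ∈ Submodule.span Kqt (mm '' {mu | mu.HDom la})) {d : (Fin n × ℕ) →₀ ℕ}
    (hd : MvPowerSeries.coeff d (toSeries n (ortHom i f)) ≠ 0) (j : ℕ) :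
    ∑ r ∈ range j, d (i, r) ≤ ∑ r ∈ range j, (la 0).1 r := by
  rw [toSeries_ortHom] at hd
  rw [← Fin.sum_univ_eq_sum_range fun r => d (i, r)]
  refine sum_le_of_natDegree_le (v := fun b : Fin j => (i, (b : ℕ))) (fun a b h => ?_) (fun r => ?_)
    (natDegree_addLetters_le fun d hd => sum_range_le_of_triangular hf hd j) hd
  · exact Fin.ext (Prod.ext_iff.mp h).2
  · rw [ortSeries, ← add_sum_erase _ _ (mem_univ i), ortCoeff_self r i.2, one_smul,
      powerSumSeries_eq n i j r, add_sub_right_comm, add_sub_cancel_right]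
    refine Subalgebra.add_mem _ (tailSeries_mem n i j _) (Subalgebra.sum_mem _ fun m hm => ?_)
    refine Subalgebra.smul_mem _ (powerSumSeries_mem m _ fun l => ?_) _
    intro b
    refine Finsupp.single_eq_of_ne fun h => ?_
    exact (mem_erase.mp hm).1 (Prod.ext_iff.mp h).1.symm

/-- The inclusion of the variables of a single alphabet as those of the `i`-th alphabet. -/
def alphabetEmb {n : ℕ} (i : Fin n) : Fin 1 × ℕ ↪ Fin n × ℕ :=
  ⟨fun v => (i, v.2), injective_pair i⟩

/-- Setting all other alphabets to zero turns the `i`-th coordinate into `x⁽ⁱ⁾`. -/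
theorem coeff_embDomain_ortHom {n : ℕ} (i : Fin n) (f : MSym 1) (d : (Fin 1 × ℕ) →₀ ℕ) :
    MvPowerSeries.coeff (d.embDomain (alphabetEmb i)) (toSeries n (ortHom i f)) =
      MvPowerSeries.coeff d (toSeries 1 f) := by
  have h : (MvPowerSeries.killCompl (alphabetEmb i)).comp (pev fun r => ortSeries n i r) =
      toSeries 1 := by
    refine MvPolynomial.algHom_ext fun v => MvPowerSeries.ext fun d => ?_
    rw [AlgHom.comp_apply, MvPowerSeries.coeff_killCompl, toSeries_X, pev_X, ortSeries, map_sum,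
      sum_eq_single i]
    · rw [ortCoeff_self _ i.2, one_smul, coeff_powerSumSeries, coeff_powerSumSeries]
      congr 1
      refine propext ⟨?_, ?_⟩
      · rintro ⟨l, hl⟩
        refine ⟨l, Finsupp.embDomain_injective (alphabetEmb i) ?_⟩
        rw [hl, Finsupp.embDomain_single]
        rfl
      · rintro ⟨l, rfl⟩
        exact ⟨l, by rw [Finsupp.embDomain_single]; rfl⟩
    · intro m _ hm
      rw [map_smul, coeff_powerSumSeries, if_neg, smul_zero]
      rintro ⟨l, hl⟩
      have h1 := DFunLike.congr_fun hl (m, l)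
      rw [Finsupp.single_eq_same, Finsupp.embDomain_of_notMem_range] at h1
      · omega
      · rintro ⟨w, hw⟩
        exact hm (Prod.ext_iff.mp hw).1.symm
    · simp
  rw [toSeries_ortHom, ← MvPowerSeries.coeff_killCompl, ← AlgHom.comp_apply, h]

theorem toExp_const_embDomain {n : ℕ} (i : Fin n) (la : Ptn) :
    (MPtn.toExp fun _ : Fin 1 => la).embDomain (alphabetEmb i) =
      la.1.mapDomain (fun j => (i, j)) := by
  ext v
  by_cases hv : v.1 = i
  · have h1 : v = alphabetEmb i (0, v.2) := Prod.ext hv rfl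
    have h2 : v = (i, v.2) := Prod.ext hv rfl
    rw [h1, Finsupp.embDomain_apply_self, toExp_apply, ← h1, h2]
    exact (Finsupp.mapDomain_apply (Prod.mk_right_injective i) la.1 v.2).symm
  · rw [Finsupp.embDomain_of_notMem_range, Finsupp.mapDomain_of_notMem_range]
    · rintro ⟨w, rfl⟩
      exact hv rfl
    · rintro ⟨w, rfl⟩
      exact hv rfl

/-! ### Products of functions of orthogonal coordinates -/

section Product

variable {n : ℕ} {P : Fin n → MPtn 1 → MSym 1}

/-- The product of symmetric functions in the orthogonal coordinates. -/
def ortProd (P : Fin n → MPtn 1 → MSym 1) (la : MPtn n) : MSym n :=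
  ∏ i, ortHom i (P i fun _ => la i)

theorem degree_const (la : Ptn) : (MPtn.toExp fun _ : Fin 1 => la).degree = la.size := by
  rw [degree_toExp, Fin.sum_univ_one]

/-- A monomial of the product splits as `∏ m i`, with `m i` in the alphabets from `i` on and of
degree `|λ⁽ⁱ⁾|`. In a partial sum up to `(k, j)`, factors `i < k` contribute at most their degree,
factor `k` at most its first `j` parts, later factors nothing. -/
theorem dom_of_coeff_ortProd
    (hP : ∀ i la, P i la - mm la ∈ Submodule.span Kqt (mm '' {mu | mu.HDom la}))
    {la mu : MPtn n} (h : MvPowerSeries.coeff mu.toExp (toSeries n (ortProd P la)) ≠ 0) :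
    mu.Dom la := by
  rw [ortProd, map_prod] at h
  obtain ⟨m, hm, hm'⟩ := exists_coeff_ne_zero_of_prod _ _ _ h
  intro k j
  obtain ⟨J, hJ⟩ := exists_bound_toExp mu
  -- The variables whose exponents add up to the partial sum at `(k, j)`; the bound `J` makes each
  -- full alphabet finite without losing any part of `mu`.
  set s : Finset (Fin n × ℕ) := Iio k ×ˢ range J ∪ {k} ×ˢ range j with hs
  have hdisj : Disjoint (Iio k ×ˢ range J) (({k} : Finset (Fin n)) ×ˢ range j) := by
    rw [disjoint_left]
    rintro v hv hv'
    simp only [mem_product, mem_Iio, mem_singleton] at hv hv'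
    exact hv.1.ne hv'.1
  have hw : ∀ d : (Fin n × ℕ) →₀ ℕ, ∑ v ∈ s, d v =
      ∑ a ∈ Iio k, ∑ r ∈ range J, d (a, r) + ∑ r ∈ range j, d (k, r) := by
    intro d
    rw [hs, sum_union hdisj, sum_product, sum_product, sum_singleton]
  have h1 : ∑ i ∈ Iio k, (mu i).size + ∑ r ∈ range j, (mu k).1 r = ∑ v ∈ s, mu.toExp v := by
    rw [hw]
    simp only [toExp_apply]
    congr 1
    exact sum_congr rfl fun a _ => (mu a).size_eq_sum_range (hJ a)
  have h2 : ∑ v ∈ s, mu.toExp v = ∑ i, ∑ v ∈ s, m i v := by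
    rw [← hm, sum_comm]
    exact sum_congr rfl fun v _ => Finsupp.finsetSum_apply _ _ _
  have h3 : ∑ i, ∑ v ∈ s, m i v = ∑ i ∈ Iio k, ∑ v ∈ s, m i v + ∑ v ∈ s, m k v := by
    rw [add_comm, ← sum_insert (f := fun i => ∑ v ∈ s, m i v) (by simp), Iio_insert]
    refine (sum_subset (subset_univ _) fun i _ hi => sum_eq_zero fun v hv => ?_).symm
    rw [mem_Iic, not_le] at hi
    have hv' : v.1 ≤ k := by
      rw [hs, mem_union, mem_product, mem_product, mem_Iio, mem_singleton] at hv
      exact hv.elim (fun h => h.1.le) fun h => h.1.le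
    exact apply_eq_zero_of_coeff_ortHom (hm' i (mem_univ i)) (hv'.trans_lt hi) v.2
  rw [h1, h2, h3]
  refine add_le_add (sum_le_sum fun i _ => ?_) ?_
  · refine (sum_le_degree _ s).trans ?_
    rw [degree_eq_of_coeff_ortHom (hP i _) (hm' i (mem_univ i)), degree_const]
  · rw [hw, sum_eq_zero, zero_add]
    · exact sum_range_le_of_coeff_ortHom (hP k _) (hm' k (mem_univ k)) j
    · intro a ha
      exact sum_eq_zero fun r _ =>
        apply_eq_zero_of_coeff_ortHom (hm' k (mem_univ k)) (mem_Iio.mp ha) r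

theorem coeff_toExp_ortProd
    (hP : ∀ i la, P i la - mm la ∈ Submodule.span Kqt (mm '' {mu | mu.HDom la})) (la : MPtn n) :
    MvPowerSeries.coeff la.toExp (toSeries n (ortProd P la)) = 1 := by
  rw [ortProd, map_prod, MPtn.toExp, coeff_prod_of_unique]
  · refine prod_eq_one fun i _ => ?_
    rw [← toExp_const_embDomain, coeff_embDomain_ortHom]
    exact coeff_toExp_of_triangular (hP i _) fun h => h.1.2 rfl
  · intro m hm hm'
    have key : ∀ i, m i = (la i).1.mapDomain (fun j => (i, j)) := by
      intro i
      induction i using WellFoundedLT.induction with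
      | _ i ih =>
        -- Later factors do not reach alphabet `i` and earlier ones stay in their own by induction.
        -- So `m i` contains all of `λ⁽ⁱ⁾`, and its degree leaves room for nothing else.
        refine eq_of_le_of_degree_eq (fun v => ?_) ?_
        · by_cases hv : v.1 = i
          · have h1 := DFunLike.congr_fun hm v
            rw [Finsupp.finsetSum_apply, Finsupp.finsetSum_apply, sum_eq_single i,
              sum_eq_single i] at h1
            · exact h1.ge
            · intro l _ hl
              refine Finsupp.mapDomain_of_notMem_range _ _ ?_
              rintro ⟨w, rfl⟩
              exact hl hv
            · simp
            · intro l _ hl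
              rcases lt_or_gt_of_ne hl with h | h
              · rw [ih l h]
                refine Finsupp.mapDomain_of_notMem_range _ _ ?_
                rintro ⟨w, rfl⟩
                exact hl hv
              · exact apply_eq_zero_of_coeff_ortHom (hm' l (mem_univ l)) (hv ▸ h) v.2
            · simp
          · rw [Finsupp.mapDomain_of_notMem_range]
            · exact Nat.zero_le _
            · rintro ⟨w, rfl⟩
              exact hv rfl
        · rw [degree_eq_of_coeff_ortHom (hP i _) (hm' i (mem_univ i)), degree_const,
            Finsupp.degree_mapDomain]
          rfl
    exact fun i _ => key i

theorem ortProd_triangular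
    (hP : ∀ i la, P i la - mm la ∈ Submodule.span Kqt (mm '' {mu | mu.HDom la})) (la : MPtn n) :
    ortProd P la - mm la ∈ Submodule.span Kqt (mm '' {mu | mu.SDom la}) := by
  refine mem_span_mm _ _ fun mu hmu => ?_
  rw [map_sub, map_sub, coeff_mm] at hmu
  have hne : mu ≠ la := by
    rintro rfl
    rw [coeff_toExp_ortProd hP, if_pos rfl, sub_self] at hmu
    exact hmu rfl
  rw [if_neg hne.symm, sub_zero] at hmu
  exact ⟨dom_of_coeff_ortProd hP hmu, hne⟩

end Product

/-! ### Multi-Macdonald polynomials as products -/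

theorem toSeries_sub_mem_span_iff {n : ℕ} {la : MPtn n} {f : MSym n} {S : Set (MPtn n)} :
    toSeries n f - multiMonomial la ∈ Submodule.span Kqt (multiMonomial '' S) ↔
      f - mm la ∈ Submodule.span Kqt (mm '' S) := by
  have h : Submodule.span Kqt (multiMonomial '' S) =
      (Submodule.span Kqt (mm '' S)).map (toSeries n).toLinearMap := by
    rw [Submodule.map_span, Set.image_image]
    simp only [AlgHom.toLinearMap_apply, toSeries_mm]
  rw [h, ← toSeries_mm, ← map_sub, ← AlgHom.toLinearMap_apply]
  exact Function.Injective.mem_set_image (toSeries_injective n)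

/-- The factor `c ^ k` in the norm of `p_k` amounts to scaling the homogeneous argument `h`. -/
theorem fock_scaled_macNorm {Q T c : Kqt} {la : MPtn 1} (f : MSym 1) {h : MSym 1}
    (hh : h - mm la ∈ Submodule.span Kqt (mm '' {mu | mu.HDom la})) :
    fock (fun v : Fin 1 × ℕ => c ^ (v.2 + 1) * macNorm Q T v) f h =
      c ^ la.toExp.degree * fock (macNorm Q T) f h := by
  rw [fock_scale, ← smul_eq_mul, ← map_smul, ← scaleHom_of_triangular hh, scaleHom]

/-- Families of Macdonald polynomials whose products are the multi-Macdonald polynomials. -/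
structure IsMacdonaldFamily {n : ℕ} (P : Fin n → MPtn 1 → MSym 1) : Prop where
  triangular : ∀ i la, P i la - mm la ∈ Submodule.span Kqt (mm '' {mu | mu.HDom la})
  orthogonal : ∀ (i : Fin n) la mu, la ≠ mu → fock (macNorm (parQ n i) (parT n i)) (P i la) (P i mu) = 0

theorem exists_isMacdonaldFamily (n : ℕ) :
    ∃ P : Fin n → MPtn 1 → MSym 1, IsMacdonaldFamily P := by
  choose P hP horth using fun i : Fin n => exists_macdonald (algebraicIndependent_par n i)
  exact ⟨P, hP, horth⟩

namespace IsMacdonaldFamily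

variable {n : ℕ} {P : Fin n → MPtn 1 → MSym 1}

theorem scalarProduct_eq (h : IsMacdonaldFamily P) (la mu : MPtn n) :
    scalarProduct n (ortProd P la) (ortProd P mu) =
      ∏ i : Fin n, (q ^ (n - 1 - (i : ℕ))) ^ (mu i).size *
        fock (macNorm (parQ n i) (parT n i)) (P i fun _ => la i) (P i fun _ => mu i) := by
  rw [ortProd, ortProd, scalarProduct_prod_ortHom]
  refine prod_congr rfl fun i _ => ?_
  rw [fock_scaled_macNorm _ (h.triangular i _), degree_const]

theorem scalarProduct_eq_zero (h : IsMacdonaldFamily P) {la mu : MPtn n} (hne : la ≠ mu) :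
    scalarProduct n (ortProd P la) (ortProd P mu) = 0 := by
  obtain ⟨i, hi⟩ := Function.ne_iff.mp hne
  rw [h.scalarProduct_eq]
  refine prod_eq_zero (mem_univ i) ?_
  rw [h.orthogonal i _ _ fun he => hi (congrFun he 0), mul_zero]

theorem scalarProduct_self_ne_zero (h : IsMacdonaldFamily P) (la : MPtn n) :
    scalarProduct n (ortProd P la) (ortProd P la) ≠ 0 := by
  rw [h.scalarProduct_eq]
  exact prod_ne_zero_iff.mpr fun i _ => mul_ne_zero (pow_ne_zero _ (pow_ne_zero _ q_ne_zero))
    (macdonald_norm_ne_zero (algebraicIndependent_par n i) (h.triangular i) (h.orthogonal i) _)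

theorem isMultiMacdonald (h : IsMacdonaldFamily P) : IsMultiMacdonald n (ortProd P) where
  linearIndependent := LinearMap.linearIndependent_of_isOrthoᵢ (B := scalarProduct n)
    (fun _ _ hne => h.scalarProduct_eq_zero hne) fun la => h.scalarProduct_self_ne_zero la
  span_eq_top := by
    rw [eq_top_iff, ← span_mm_eq_top, ← Set.image_univ, ← Set.image_univ]
    exact span_triangular_le (wellFounded_sDom n) (ortProd_triangular h.triangular) _
      fun _ _ _ _ => Set.mem_univ _
  triangular la := toSeries_sub_mem_span_iff.mpr (ortProd_triangular h.triangular la)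
  orthogonal _ _ hne := h.scalarProduct_eq_zero hne

theorem eq_ortProd (h : IsMacdonaldFamily P) {P' : MPtn n → MSym n}
    (hP' : IsMultiMacdonald n P') : P' = ortProd P :=
  triangular_orthogonal_unique (wellFounded_sDom n) (fun _ _ _ => MPtn.SDom.trans)
    (fun _ h => h.2 rfl) (ortProd_triangular h.triangular)
    (fun la => toSeries_sub_mem_span_iff.mp (hP'.triangular la))
    (fun _ _ hne => h.scalarProduct_eq_zero hne) h.scalarProduct_self_ne_zero hP'.orthogonal

end IsMacdonaldFamily

/-! ### The inversion of the parameters -/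

theorem invQT_parT (n i : ℕ) : invQT (parT n i) = (parT n i)⁻¹ := by
  rw [parT, map_mul, map_pow, invQT_q, invQT_t, mul_inv, inv_pow]

theorem invQT_parQ (n i : ℕ) : invQT (parQ n i) = (parQ n i)⁻¹ := by
  unfold parQ
  split_ifs
  · exact invQT_q
  · rw [map_mul, invQT_q, invQT_parT, mul_inv]

/-- The factor involving `t` is the same for all alphabets and cancels in the ratios `ortCoeff`;
only the powers of `q` survive. -/
theorem invQT_rawCoeff (n r m : ℕ) : invQT (rawCoeff n r m) =
    -(q ^ ((n - 1 - m) * (r + 1)) * (t ^ (r + 1))⁻¹) * rawCoeff n r m := by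
  unfold rawCoeff
  split_ifs
  · have h1 := pow_ne_zero ((n - 1 - m) * (r + 1)) q_ne_zero
    have h2 := pow_ne_zero (r + 1) t_ne_zero
    rw [map_sub, map_inv₀, map_pow, map_pow, invQT_q, invQT_t, inv_pow, inv_inv, inv_pow]
    field_simp
    ring
  · rw [map_zero, mul_zero]

theorem invQT_ortCoeff {n i : ℕ} (r m : ℕ) (hi : i < n) : invQT (ortCoeff n i r m) =
    (q ^ (n - 1 - i))⁻¹ ^ (r + 1) * (ortCoeff n i r m * q ^ ((r + 1) * (n - 1 - m))) := by
  unfold ortCoeff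
  split_ifs
  · have h1 := pow_ne_zero ((n - 1 - i) * (r + 1)) q_ne_zero
    have h2 := pow_ne_zero (r + 1) t_ne_zero
    have h3 := rawCoeff_ne_zero r hi
    rw [map_div₀, invQT_rawCoeff, invQT_rawCoeff, inv_pow, ← pow_mul, mul_comm (r + 1) (n - 1 - m)]
    generalize q ^ ((n - 1 - i) * (r + 1)) = x at *
    generalize q ^ ((n - 1 - m) * (r + 1)) = y at *
    generalize t ^ (r + 1) = z at *
    field_simp
  · rw [map_zero, zero_mul, mul_zero]

/-- By `invQT_ortCoeff`, inversion multiplies the coefficient of `x⁽ᵐ⁾` in the `i`-th coordinate by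
a power of `q` depending on `m`, which is the plethystic scaling, and one depending on `i`, which
scales the coordinate as a whole. -/
theorem invertParams_ortHom {n : ℕ} (i : Fin n) (f : MSym 1) :
    invertParams n (ortHom i f) = plethScale (fun i : Fin n => n - 1 - (i : ℕ))
      (ortHom i (scaleHom 1 (q ^ (n - 1 - (i : ℕ)))⁻¹ (MvPolynomial.map invQT f))) := by
  have : (invertParams n).comp (ortHom i : MSym 1 →+* MSym n) =
      (((plethScale fun i : Fin n => n - 1 - (i : ℕ)).comp
        ((ortHom i).comp (scaleHom 1 (q ^ (n - 1 - (i : ℕ)))⁻¹)) : MSym 1 →ₐ[Kqt] MSym n) :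
          MSym 1 →+* MSym n).comp (MvPolynomial.map invQT) := by
    refine MvPolynomial.ringHom_ext (fun a => ?_) fun v => ?_
    · simp only [RingHom.comp_apply, RingHom.coe_coe, MvPolynomial.algHom_C,
        MvPolynomial.algebraMap_eq, invertParams, MvPolynomial.map_C]
    · simp only [RingHom.comp_apply, RingHom.coe_coe, AlgHom.comp_apply, MvPolynomial.map_X,
        scaleHom, MvPolynomial.aeval_X, map_mul, MvPolynomial.algHom_C,
        MvPolynomial.algebraMap_eq, ortHom, pev_X, ortSum, map_sum, invertParams,
        MvPolynomial.map_C, plethScale, mul_sum]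
      refine sum_congr rfl fun m _ => ?_
      rw [invQT_ortCoeff _ _ i.2, MvPolynomial.C_mul, MvPolynomial.C_mul]
      ring
  exact DFunLike.congr_fun this f

theorem prod_pow_size {n : ℕ} (la : MPtn n) :
    ∏ i : Fin n, (q ^ (n - 1 - (i : ℕ)))⁻¹ ^ (la i).size =
      q ^ ((compN la.bar : ℤ) - ((n : ℤ) - 1) * (compSize la.bar : ℤ)) := by
  have h : (compN la.bar : ℤ) - ((n : ℤ) - 1) * compSize la.bar =
      -((∑ i : Fin n, (n - 1 - (i : ℕ)) * (la i).size : ℕ) : ℤ) := by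
    simp only [compSize, compN, MPtn.bar]
    push_cast
    rw [mul_sum, ← sum_sub_distrib, ← sum_neg_distrib]
    refine sum_congr rfl fun i _ => ?_
    have := i.2
    rw [Nat.cast_sub (by omega), Nat.cast_sub (by omega)]
    push_cast
    ring
  rw [h, zpow_neg, zpow_natCast, ← prod_pow_eq_pow_sum, ← prod_inv_distrib]
  refine prod_congr rfl fun i _ => ?_
  rw [inv_pow, pow_mul]

/-- Each factor is fixed by the inversion of its own parameters and is homogeneous, so the scaling
of its coordinate becomes a scalar; `prod_pow_size` collects these scalars. -/
theorem IsMacdonaldFamily.invertParams_ortProd {n : ℕ} {P : Fin n → MPtn 1 → MSym 1}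
    (h : IsMacdonaldFamily P) (la : MPtn n) : invertParams n (ortProd P la) =
      q ^ ((compN la.bar : ℤ) - ((n : ℤ) - 1) * (compSize la.bar : ℤ)) •
        plethScale (fun i : Fin n => n - 1 - (i : ℕ)) (ortProd P la) := by
  rw [ortProd, map_prod, map_prod, ← prod_pow_size, ← prod_smul]
  refine prod_congr rfl fun i _ => ?_
  rw [invertParams_ortHom, map_macdonald (algebraicIndependent_par n i) (h.triangular i)
    (h.orthogonal i) (invQT_parQ n i) (invQT_parT n i), scaleHom_of_triangular (h.triangular i _),
    degree_const, map_smul, map_smul]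

end

end MultiMac

/-! ### The main theorem -/

theorem mainTheorem7 (n : ℕ) (hn : 1 ≤ n) :
    (∃! P : MultiMac.MPtn n → MultiMac.MSym n, MultiMac.IsMultiMacdonald n P) ∧
      ∀ P : MultiMac.MPtn n → MultiMac.MSym n, MultiMac.IsMultiMacdonald n P →
        ∀ la : MultiMac.MPtn n,
          MultiMac.invertParams n (P la) =
            MultiMac.q ^ ((MultiMac.compN la.bar : ℤ) -
                ((n : ℤ) - 1) * (MultiMac.compSize la.bar : ℤ)) •
              MultiMac.plethScale (fun i : Fin n => n - 1 - (i : ℕ)) (P la) := by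
  obtain ⟨P, hP⟩ := MultiMac.exists_isMacdonaldFamily n
  refine ⟨⟨_, hP.isMultiMacdonald, fun P' hP' => hP.eq_ortProd hP'⟩, fun P' hP' la => ?_⟩
  rw [hP.eq_ortProd hP']
  exact hP.invertParams_ortProd la
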